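/- **Setting.** All manifolds and Lie groups are real, smooth and modelled on Banach spaces. A *weak symplectic form* is a smooth closed two-form $\omega$ such that $v\mapsto\omega(p)(v,\cdot)$ is injective on every tangent space. Let $G$ be a Banach Lie group with Lie algebra $\mathfrak g$ and $H\subset G$ a closed Banach Lie subgroup (a subgroup that is a split submanifold) with Lie algebra $\mathfrak h\subset\mathfrak g$. Let $\mathfrak g_*$ be a predual of $\mathfrak g$, that is, a Banach space with $(\mathfrak g_*)^*\cong\mathfrak g$, such that $\mathfrak g_*\subset\mathfrak g^*$ is invariant under $\mathrm{Ad}^*_g$ for all $g\in G$, where $\langle \mathrm{Ad}^*_g\rho,x\rangle=\langle\rho,\mathrm{Ad}_g x\rangle$. Let $\mathfrak g_*=\mathfrak h_*\oplus\mathfrak h_*^\perp$ be a splitting into closed subspaces, both invariant under $\mathrm{Ad}^*_h$ for all $h\in H$, such that the annihilator of $\mathfrak h_*^\perp$ in $\mathfrak g$ is $\mathfrak h$ (so $\mathfrak h_*$ is a predual of $\mathfrak h$). Let $\Pi:\mathfrak g_*\to\mathfrak h_*$ be the projection and $\mathfrak h^\perp\subset\mathfrak g$ the annihilator of $\mathfrak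 h_*$; thus $\mathfrak g=\mathfrak h\oplus\mathfrak h^\perp$. Write $\langle\mathrm{ad}^*_x\rho,y\rangle=\langle\rho,[x,y]\rangle$; this defines an operator $\mathrm{ad}^*_x$ on $\mathfrak g_*$. Let $(P,\omega)$ be a weak symplectic Banach manifold on which $H$ acts smoothly and symplectically, with infinitesimal generators $z_P$, and let $J=\mathbf J^H_P:P\to\mathfrak h_*$ be smooth and $H$-equivariant, $J(h\cdot p)=\mathrm{Ad}^*_{h^{-1}}J(p)$, such that $\mathbf d\langle J,z\rangle=\omega(z_P,\cdot)$ for all $z\in\mathfrak h$. Let $H$ act on $G\times P\times\mathfrak h_*^\perp$ by $h\cdot(g,p,\rho^\perp)=(gh^{-1},h\cdot p,\mathrm{Ad}^*_{h^{-1}}\rho^\perp)$, let $M=G\times_H(P\times\mathfrak h_*^\perp)$ be the orbit space with the quotient topology and $\pi_0:G\times P\times\mathfrak h_*^\perp\to M$ the projection. **Proposition 3.4 (induction theorem).** $G/H$ and $M$ carry smooth Banach manifold structures for which $G\to G/H$ and $\pi_0$ are submersions, and $M\to G/H$, $[g,p,\rho^\perp]\mapsto gH$, is a smooth fiber bundle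 with fiber $P\times\mathfrak h_*^\perp$, with local trivializations $(u,p,\rho^\perp)\mapsto[s(u),p,\rho^\perp]$ given by smooth local sections $s$ of $G\to G/H$. If $P$ is Hausdorff, so is $M$. The map $[g,p,\rho^\perp]\mapsto[p,g,J(p)+\rho^\perp]$ is a homeomorphism of $M$ onto the reduced space $$\{(p,g,\tilde\rho)\in P\times G\times\mathfrak g_*\mid J(p)-\Pi\tilde\rho=0\}/H,\qquad h\cdot(p,g,\tilde\rho)=(h\cdot p,gh^{-1},\mathrm{Ad}^*_{h^{-1}}\tilde\rho).$$ There is a weak symplectic form $\Omega$ on $M$ with the following properties. It is the reduced form: for $\tilde x,\tilde y\in\mathfrak g$, $a_p,b_p\in T_pP$ and $\rho^\perp,\mu^\perp,\nu^\perp\in\mathfrak h_*^\perp$, $$\begin{aligned}&\Omega(\pi_0(g,p,\rho^\perp))\big(T\pi_0(T_eL_g\tilde x,a_p,\mu^\perp),T\pi_0(T_eL_g\tilde y,b_p,\nu^\perp)\big)\\&\quad=\omega(p)(a_p,b_p)+\langle T_pJ(b_p)+\nu^\perp,\tilde x\rangle-\langle T_pJ(a_p)+\mu^\perp,\tilde y\rangle+\langle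 J(p)+\rho^\perp,[\tilde x,\tilde y]\rangle.\end{aligned}$$ Moreover, for $\tilde x=x+x^\perp$, $\tilde y=y+y^\perp$ with $x,y\in\mathfrak h$ and $x^\perp,y^\perp\in\mathfrak h^\perp$, this value equals $$\begin{aligned}&\omega(p)(a_p,b_p)+\langle T_pJ(b_p),x\rangle+\langle\nu^\perp,x^\perp\rangle-\langle T_pJ(a_p),y\rangle-\langle\mu^\perp,y^\perp\rangle\\&\quad+\langle J(p),[x,y]\rangle+\langle\rho^\perp,[x^\perp,y]+[x,y^\perp]\rangle+\langle J(p)+\rho^\perp,[x^\perp,y^\perp]\rangle\end{aligned}$$ and also equals $$\begin{aligned}&\omega(p)(a_p-x_P(p),b_p-y_P(p))+\langle T_pJ(b_p-y_P(p)),2x\rangle+\langle\nu^\perp+\mathrm{ad}^*_y\rho^\perp,x^\perp\rangle\\&\quad-\langle T_pJ(a_p-x_P(p)),2y\rangle-\langle\mu^\perp+\mathrm{ad}^*_x\rho^\perp,y^\perp\rangle+\langle J(p),[2x,2y]\rangle\\&\quad+\langle\rho^\perp,[x^\perp,2y]+[2x,y^\perp]\rangle+\langle J(p)+\rho^\perp,[x^\perp,y^\perp]\rangle.\end{aligned}$$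 The tangent vectors $(T_eL_g(2x+x^\perp),\,a_p-x_P(p),\,\mu^\perp+\mathrm{ad}^*_x\rho^\perp)$ of $G\times P\times\mathfrak h_*^\perp$ that occur in the last expression are transversal to the $H$-orbits (together with the tangent vectors of the orbit through $(g,p,\rho^\perp)$ they span the tangent space), and every element of $T_{\pi_0(g,p,\rho^\perp)}M$ is the image of such a vector under $T\pi_0$. **Proposition 3.5 (induction theorem, second).** $G$ acts smoothly on $M$ by $g'\cdot[g,p,\rho^\perp]=[g'g,p,\rho^\perp]$ and preserves $\Omega$. The map $$\mathbf J^G_M:M\to\mathfrak g_*,\qquad \mathbf J^G_M([g,p,\rho^\perp])=\mathrm{Ad}^*_{g^{-1}}\big(J(p)+\rho^\perp\big)$$ is well defined, smooth and $G$-equivariant, $\mathbf J^G_M(g\cdot m)=\mathrm{Ad}^*_{g^{-1}}\mathbf J^G_M(m)$, for every $z\in\mathfrak g$ the function $\langle\mathbf J^G_M,z\rangle$ has the infinitesimal generator $z_M$ as its Hamiltonian vector field, $\mathbf d\langle\mathbf J^G_M,z\rangle=\Omega(z_M,\cdot)$, and $\mathbf J^G_M$ is a momentum map: whenever $\varphi,\psi$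 are locally defined smooth functions on $\mathfrak g_*$ such that $\varphi\circ\mathbf J^G_M$ and $\psi\circ\mathbf J^G_M$ have Hamiltonian vector fields $X,Y$ on an open set of $M$, then on that set $\Omega(X,Y)=\{\varphi,\psi\}\circ\mathbf J^G_M$, where $\{\varphi,\psi\}(\rho)=\langle\rho,[\mathbf d\varphi(\rho),\mathbf d\psi(\rho)]\rangle$ is the Lie-Poisson bracket on $\mathfrak g_*$. -/

import Mathlib

open scoped Manifold ContDiff Topology

noncomputable section

namespace SymplecticInduction

/-! ### Two-forms on Banach manifolds -/

section Forms

variable {E : Type*} [NormedAddCommGroup E] [NormedSpace ℝ E]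
  {M : Type*} [TopologicalSpace M] [ChartedSpace E M]

variable (E M) in
/-- A (not necessarily smooth) two-form: a continuous alternating bilinear form on every
tangent space. -/
abbrev TwoForm : Type _ := ∀ p : M, TangentSpace 𝓘(ℝ, E) p [⋀^Fin 2]→L[ℝ] ℝ

/-- The expression of a two-form in the preferred chart at `x`, i.e. its pull-back to the model
space under the inverse of the chart. -/
def TwoForm.inChart (Ω : TwoForm E M) (x : M) (y : E) : E [⋀^Fin 2]→L[ℝ] ℝ :=
  (Ω ((extChartAt 𝓘(ℝ, E) x).symm y)).compContinuousLinearMap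
    (mfderiv 𝓘(ℝ, E) 𝓘(ℝ, E) (extChartAt 𝓘(ℝ, E) x).symm y)

/-- A weak symplectic form: a smooth, closed two-form such that `v ↦ ω(p)(v, ·)` is injective on
every tangent space. Smoothness and closedness are expressed in the charts of the manifold. -/
structure IsWeakSymplectic (Ω : TwoForm E M) : Prop where
  smooth : ∀ x : M, ContDiffOn ℝ ∞ (Ω.inChart x) (extChartAt 𝓘(ℝ, E) x).target
  closed : ∀ x : M, ∀ y ∈ (extChartAt 𝓘(ℝ, E) x).target, extDeriv (Ω.inChart x) y = 0
  nondegenerate : ∀ (p : M) (v : TangentSpace 𝓘(ℝ, E) p),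
    (∀ w : TangentSpace 𝓘(ℝ, E) p, Ω p ![v, w] = 0) → v = 0

/-- On the open set `W`, the smooth function `f` admits the smooth Hamiltonian vector field `X`,
that is, `df = ω(X, ·)`. -/
structure IsHamiltonianVectorField [IsManifold 𝓘(ℝ, E) ∞ M] (Ω : TwoForm E M) (W : Set M) (f : M → ℝ)
    (X : ∀ p : M, TangentSpace 𝓘(ℝ, E) p) : Prop where
  smooth : ContMDiffOn 𝓘(ℝ, E) 𝓘(ℝ, ℝ) ∞ f W
  smooth_field : ContMDiffOn 𝓘(ℝ, E) 𝓘(ℝ, E).tangent ∞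
    (fun p => (⟨p, X p⟩ : TangentBundle 𝓘(ℝ, E) M)) W
  eq : ∀ p ∈ W, ∀ v : TangentSpace 𝓘(ℝ, E) p,
    (mfderiv 𝓘(ℝ, E) 𝓘(ℝ, ℝ) f p v : ℝ) = Ω p ![X p, v]

end Forms

/-! ### Lie groups, the adjoint action and actions on manifolds -/

section Groups

variable {E : Type*} [NormedAddCommGroup E] [NormedSpace ℝ E]
  {G : Type*} [TopologicalSpace G] [ChartedSpace E G] [Group G]

variable (E G) in
/-- The Lie algebra of a Banach Lie group (with the bracket of left-invariant vector fields). -/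
abbrev LieAlg : Type _ := GroupLieAlgebra 𝓘(ℝ, E) G

/-- `Ad_g`, the derivative at the identity of the conjugation `a ↦ g a g⁻¹`. -/
def Ad (g : G) : LieAlg E G →L[ℝ] LieAlg E G :=
  (mfderiv 𝓘(ℝ, E) 𝓘(ℝ, E) (fun a : G => g * a * g⁻¹) 1 : E →L[ℝ] E)

theorem Ad_mul [LieGroup 𝓘(ℝ, E) ∞ G] (g h : G) (x : LieAlg E G) :
    Ad (g * h) x = Ad g (Ad h x) := by
  have hs : ∀ k : G, ContMDiff 𝓘(ℝ, E) 𝓘(ℝ, E) ∞ (fun a : G => k * a * k⁻¹) := fun k =>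
    (contMDiff_mul_right (a := k⁻¹)).comp (contMDiff_mul_left (a := k))
  have hd : ∀ k b : G, MDifferentiableAt 𝓘(ℝ, E) 𝓘(ℝ, E) (fun a : G => k * a * k⁻¹) b :=
    fun k b => ((hs k) b).mdifferentiableAt (by simp)
  have hc : (fun a : G => (g * h) * a * (g * h)⁻¹)
      = (fun a : G => g * a * g⁻¹) ∘ (fun a : G => h * a * h⁻¹) := by
    funext a; simp [mul_assoc]
  have h1 : h * 1 * h⁻¹ = (1 : G) := by simp
  have key := mfderiv_comp (I := 𝓘(ℝ, E)) (I' := 𝓘(ℝ, E)) (I'' := 𝓘(ℝ, E)) (1 : G)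
    (hd g (h * 1 * h⁻¹)) (hd h 1)
  have key2 : ∀ b : G, b = 1 →
      (mfderiv 𝓘(ℝ, E) 𝓘(ℝ, E) (fun a : G => g * a * g⁻¹) b : E →L[ℝ] E)
        = (mfderiv 𝓘(ℝ, E) 𝓘(ℝ, E) (fun a : G => g * a * g⁻¹) 1 : E →L[ℝ] E) := by
    rintro b rfl; rfl
  have e1 : (mfderiv 𝓘(ℝ, E) 𝓘(ℝ, E) (fun a : G => (g * h) * a * (g * h)⁻¹) 1 : E →L[ℝ] E)
      = (mfderiv 𝓘(ℝ, E) 𝓘(ℝ, E) (fun a : G => g * a * g⁻¹) (h * 1 * h⁻¹) : E →L[ℝ] E).comp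
        (mfderiv 𝓘(ℝ, E) 𝓘(ℝ, E) (fun a : G => h * a * h⁻¹) 1 : E →L[ℝ] E) := by
    rw [hc]; exact key
  rw [key2 _ h1] at e1
  exact congrArg (fun T : E →L[ℝ] E => T x) e1

theorem Ad_one (x : LieAlg E G) : Ad (1 : G) x = x := by
  have hc : (fun a : G => (1 : G) * a * (1 : G)⁻¹) = id := by
    funext a; simp
  have e1 : (mfderiv 𝓘(ℝ, E) 𝓘(ℝ, E) (fun a : G => (1 : G) * a * (1 : G)⁻¹) 1 : E →L[ℝ] E)
      = ContinuousLinearMap.id ℝ E := by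
    rw [hc]; exact mfderiv_id
  exact congrArg (fun T : E →L[ℝ] E => T x) e1

/-- The infinitesimal generator `z_P(p)` of an action: the derivative at the identity, in the
direction `z`, of `g ↦ g • p`. -/
def generator {E' : Type*} [NormedAddCommGroup E'] [NormedSpace ℝ E']
    {P : Type*} [TopologicalSpace P] [ChartedSpace E' P] [MulAction G P]
    (z : LieAlg E G) (p : P) : TangentSpace 𝓘(ℝ, E') p :=
  ((mfderiv 𝓘(ℝ, E) 𝓘(ℝ, E') (fun g : G => g • p) 1 : E →L[ℝ] E') z : E')

/-- A Banach Lie group `G` acts symplectically on `(P, ω)` with a smooth equivariant map `J` into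
`F` such that for every `z` in the Lie algebra the function `p ↦ ⟨J(p), z⟩` has the infinitesimal
generator of `z` as its Hamiltonian vector field. Here `ev` is the pairing of the Lie algebra with
its predual `F` and `coAd g` is the operator `Ad*_g` on the predual. -/
structure IsHamiltonianAction {E' : Type*} [NormedAddCommGroup E'] [NormedSpace ℝ E']
    {P : Type*} [TopologicalSpace P] [ChartedSpace E' P] [IsManifold 𝓘(ℝ, E') ∞ P]
    [MulAction G P] {F : Type*} [NormedAddCommGroup F] [NormedSpace ℝ F]
    (Ω : TwoForm E' P) (ev : F → LieAlg E G → ℝ) (coAd : G → F → F) (J : P → F) : Prop where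
  smooth_action : ContMDiffSMul 𝓘(ℝ, E) 𝓘(ℝ, E') ∞ G P
  symplectic : ∀ (g : G) (p : P) (v w : TangentSpace 𝓘(ℝ, E') p),
    Ω (g • p) ![mfderiv 𝓘(ℝ, E') 𝓘(ℝ, E') (fun q : P => g • q) p v,
      mfderiv 𝓘(ℝ, E') 𝓘(ℝ, E') (fun q : P => g • q) p w] = Ω p ![v, w]
  smooth : ContMDiff 𝓘(ℝ, E') 𝓘(ℝ, F) ∞ J
  equivariant : ∀ (g : G) (p : P), J (g • p) = coAd g⁻¹ (J p)
  hamiltonian : ∀ z : LieAlg E G,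
    IsHamiltonianVectorField Ω Set.univ (fun p => ev (J p) z) (fun p => generator z p)

end Groups

/-! ### Preduals and the coadjoint action -/

/-- A predual `F = 𝔤_*` of the Lie algebra `𝔤` of `G`: an isomorphism of `𝔤` with the dual of the
Banach space `F`, such that `F`, as a subspace of `𝔤^*`, is invariant under the coadjoint action
of `G`. -/
structure InvariantPredual (E : Type*) [NormedAddCommGroup E] [NormedSpace ℝ E]
    (G : Type*) [TopologicalSpace G] [ChartedSpace E G] [Group G]
    (F : Type*) [NormedAddCommGroup F] [NormedSpace ℝ F] where
  iso : LieAlg E G ≃L[ℝ] (F →L[ℝ] ℝ)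
  invariant : ∀ (g : G) (ρ : F), ∃ σ : F, ∀ x : LieAlg E G, iso x σ = iso (Ad g x) ρ

namespace InvariantPredual

variable {E : Type*} [NormedAddCommGroup E] [NormedSpace ℝ E]
  {G : Type*} [TopologicalSpace G] [ChartedSpace E G] [Group G]
  {F : Type*} [NormedAddCommGroup F] [NormedSpace ℝ F] (Q : InvariantPredual E G F)

/-- The pairing `⟨ρ, x⟩` of `ρ ∈ 𝔤_*` and `x ∈ 𝔤`. -/
def pair (ρ : F) (x : LieAlg E G) : ℝ := Q.iso x ρ

/-- `Ad*_g` on the predual: `⟨Ad*_g ρ, x⟩ = ⟨ρ, Ad_g x⟩`. -/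
def coAd (g : G) (ρ : F) : F := Classical.choose (Q.invariant g ρ)

theorem pair_coAd (g : G) (ρ : F) (x : LieAlg E G) :
    Q.pair (Q.coAd g ρ) x = Q.pair ρ (Ad g x) :=
  Classical.choose_spec (Q.invariant g ρ) x

theorem ext {ρ σ : F} (h : ∀ x : LieAlg E G, Q.pair ρ x = Q.pair σ x) : ρ = σ := by
  rw [SeparatingDual.eq_iff_forall_dual_eq (R := ℝ)]
  intro f
  simpa [pair] using h (Q.iso.symm f)

theorem coAd_add (g : G) (ρ σ : F) : Q.coAd g (ρ + σ) = Q.coAd g ρ + Q.coAd g σ := by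
  apply Q.ext
  intro x
  have h := Q.pair_coAd
  simp only [pair] at h
  simp [pair, map_add, h]

theorem coAd_one (ρ : F) : Q.coAd 1 ρ = ρ := by
  apply Q.ext
  intro x
  rw [pair_coAd, Ad_one]

theorem coAd_mul [LieGroup 𝓘(ℝ, E) ∞ G] (g h : G) (ρ : F) :
    Q.coAd (g * h) ρ = Q.coAd h (Q.coAd g ρ) := by
  apply Q.ext
  intro x
  simp only [pair_coAd, Ad_mul]

/-- `ad*_x` on the predual: `ad*_x ρ` is the unique element of `𝔤_*` with
`⟨ad*_x ρ, y⟩ = ⟨ρ, [x, y]⟩` for all `y ∈ 𝔤`. -/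
def coad (x : LieAlg E G) (ρ : F) : F :=
  Classical.epsilon fun σ : F => ∀ y : LieAlg E G, Q.pair σ y = Q.pair ρ ⁅x, y⁆

/-- The Lie-Poisson bracket `{φ, ψ}(ρ) = ⟨ρ, [dφ(ρ), dψ(ρ)]⟩` on `𝔤_*`, where `dφ(ρ)` is regarded
as an element of `𝔤 = (𝔤_*)^*`. -/
def lieBracket (φ ψ : F → ℝ) (ρ : F) : ℝ :=
  Q.pair ρ ⁅Q.iso.symm (fderiv ℝ φ ρ), Q.iso.symm (fderiv ℝ ψ ρ)⁆

/-- A smooth map `J : P → 𝔤_*` is a momentum map if `{φ ∘ J, ψ ∘ J}_ω = {φ, ψ} ∘ J` for all locally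
defined smooth functions `φ, ψ` on `𝔤_*` for which `φ ∘ J` and `ψ ∘ J` have (on some open set `W`)
Hamiltonian vector fields `X` and `Y`; by definition `{φ ∘ J, ψ ∘ J}_ω = ω(X, Y)`. -/
structure IsMomentumMap {E' : Type*} [NormedAddCommGroup E'] [NormedSpace ℝ E']
    {P : Type*} [TopologicalSpace P] [ChartedSpace E' P] [IsManifold 𝓘(ℝ, E') ∞ P]
    (Ω : TwoForm E' P) (J : P → F) : Prop where
  smooth : ContMDiff 𝓘(ℝ, E') 𝓘(ℝ, F) ∞ J
  poisson : ∀ (U : Set F) (φ ψ : F → ℝ), IsOpen U → ContDiffOn ℝ ∞ φ U → ContDiffOn ℝ ∞ ψ U →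
    ∀ (W : Set P) (X Y : ∀ p : P, TangentSpace 𝓘(ℝ, E') p), IsOpen W → Set.MapsTo J W U →
      IsHamiltonianVectorField Ω W (φ ∘ J) X → IsHamiltonianVectorField Ω W (ψ ∘ J) Y →
      ∀ p ∈ W, Ω p ![X p, Y p] = Q.lieBracket φ ψ (J p)

end InvariantPredual

/-! ### The splitting of the predual -/

/-- The inclusion `𝔥 → 𝔤` of the Lie algebra of a Lie subgroup. -/
def incl {E : Type*} [NormedAddCommGroup E] [NormedSpace ℝ E]
    {G : Type*} [TopologicalSpace G] [ChartedSpace E G] [Group G] (H : Subgroup G)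
    {EH : Type*} [NormedAddCommGroup EH] [NormedSpace ℝ EH] [ChartedSpace EH H] :
    LieAlg EH H →L[ℝ] LieAlg E G :=
  (mfderiv 𝓘(ℝ, EH) 𝓘(ℝ, E) (fun h : H => (h : G)) 1 : EH →L[ℝ] E)

/-- An `Ad*_H`-invariant splitting `𝔤_* = 𝔥_* ⊕ 𝔥_*^⊥` into closed subspaces such that the
annihilator of `𝔥_*^⊥` in `𝔤` is `𝔥`. (Then restriction of functionals identifies `𝔥` with the dual
of `𝔥_*`, so that `𝔥_*` is a predual of `𝔥`.) -/
structure InvariantSplitting {E : Type*} [NormedAddCommGroup E] [NormedSpace ℝ E]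
    {G : Type*} [TopologicalSpace G] [ChartedSpace E G] [Group G]
    {F : Type*} [NormedAddCommGroup F] [NormedSpace ℝ F] (Q : InvariantPredual E G F)
    (H : Subgroup G)
    (EH : Type*) [NormedAddCommGroup EH] [NormedSpace ℝ EH] [ChartedSpace EH H] where
  /-- the subspace `𝔥_*` -/
  sub : Submodule ℝ F
  /-- the subspace `𝔥_*^⊥` -/
  perp : Submodule ℝ F
  isClosed_sub : IsClosed (sub : Set F)
  isClosed_perp : IsClosed (perp : Set F)
  isCompl : IsCompl sub perp
  coAd_mem_sub : ∀ h : H, ∀ ρ ∈ sub, Q.coAd (h : G) ρ ∈ sub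
  coAd_mem_perp : ∀ h : H, ∀ ρ ∈ perp, Q.coAd (h : G) ρ ∈ perp
  annihilator_perp : ∀ x : LieAlg E G,
    (∀ ρ ∈ perp, Q.pair ρ x = 0) ↔ ∃ z : LieAlg EH H, incl H z = x

namespace InvariantSplitting

variable {E : Type*} [NormedAddCommGroup E] [NormedSpace ℝ E]
  {G : Type*} [TopologicalSpace G] [ChartedSpace E G] [Group G]
  {F : Type*} [NormedAddCommGroup F] [NormedSpace ℝ F] {Q : InvariantPredual E G F}
  {H : Subgroup G}
  {EH : Type*} [NormedAddCommGroup EH] [NormedSpace ℝ EH] [ChartedSpace EH H]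
  (S : InvariantSplitting Q H EH)

/-- The inclusion `𝔥 → 𝔤`. -/
def emb (_S : InvariantSplitting Q H EH) : LieAlg EH H →L[ℝ] LieAlg E G := incl H

/-- `x ∈ 𝔥^⊥`, the annihilator of `𝔥_*` in `𝔤`. -/
def MemPerp (x : LieAlg E G) : Prop := ∀ ρ ∈ S.sub, Q.pair ρ x = 0

/-- The projection `Π : 𝔤_* → 𝔥_*` along `𝔥_*^⊥`. -/
def proj : F →ₗ[ℝ] S.sub := S.sub.projectionOnto S.perp S.isCompl

/-- The pairing of `𝔥_*` with `𝔥`. -/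
def pairSub (ρ : S.sub) (z : LieAlg EH H) : ℝ := Q.pair (ρ : F) (S.emb z)

/-- `Ad*_h` on `𝔥_*`. -/
def coAdSub (h : H) (ρ : S.sub) : S.sub := ⟨Q.coAd (h : G) ρ, S.coAd_mem_sub h ρ ρ.2⟩

/-- `Ad*_h` on `𝔥_*^⊥`. -/
def coAdPerp (h : H) (ρ : S.perp) : S.perp := ⟨Q.coAd (h : G) ρ, S.coAd_mem_perp h ρ ρ.2⟩

/-! ### The induced space -/

variable {P : Type*} [MulAction H P]

/-- The action `h · (p, g, ρ) = (h · p, g h⁻¹, Ad*_{h⁻¹} ρ)` on `P × G × 𝔤_*`. -/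
def bigAct (_S : InvariantSplitting Q H EH) (h : H) (q : P × G × F) : P × G × F :=
  (h • q.1, q.2.1 * (h : G)⁻¹, Q.coAd ((h : G)⁻¹) q.2.2)

/-- The action `h · (g, p, ρ) = (g h⁻¹, h · p, Ad*_{h⁻¹} ρ)` on `G × P × 𝔥_*^⊥`. -/
def act (h : H) (q : G × P × S.perp) : G × P × S.perp :=
  (q.1 * (h : G)⁻¹, h • q.2.1, S.coAdPerp h⁻¹ q.2.2)

theorem bigAct_one (q : P × G × F) : S.bigAct 1 q = q := by
  simp [bigAct, Q.coAd_one]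

theorem act_one (q : G × P × S.perp) : S.act 1 q = q := by
  simp [act, coAdPerp, Q.coAd_one]

variable [LieGroup 𝓘(ℝ, E) ∞ G]

theorem bigAct_mul (h k : H) (q : P × G × F) :
    S.bigAct (h * k) q = S.bigAct h (S.bigAct k q) := by
  simp [bigAct, mul_smul, mul_assoc, Q.coAd_mul]

theorem act_mul (h k : H) (q : G × P × S.perp) :
    S.act (h * k) q = S.act h (S.act k q) := by
  simp [act, coAdPerp, mul_smul, mul_assoc, Q.coAd_mul]

variable (P) in
/-- The orbit equivalence relation of `H` on `G × P × 𝔥_*^⊥`. -/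
def inducedSetoid : Setoid (G × P × S.perp) where
  r a b := ∃ h : H, S.act h a = b
  iseqv :=
    { refl := fun a => ⟨1, S.act_one a⟩
      symm := by
        rintro a b ⟨h, rfl⟩
        exact ⟨h⁻¹, by rw [← S.act_mul, inv_mul_cancel, S.act_one]⟩
      trans := by
        rintro a b c ⟨h, rfl⟩ ⟨k, rfl⟩
        exact ⟨k * h, S.act_mul k h a⟩ }

variable (P) in
/-- The induced space `G ×_H (P × 𝔥_*^⊥)`. -/
def InducedSpace : Type _ := Quotient (S.inducedSetoid P)

/-- The projection `π₀ : G × P × 𝔥_*^⊥ → G ×_H (P × 𝔥_*^⊥)`. -/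
def proj₀ (q : G × P × S.perp) : S.InducedSpace P := Quotient.mk (S.inducedSetoid P) q

/-- The quotient topology. -/
instance [TopologicalSpace P] : TopologicalSpace (S.InducedSpace P) :=
  inferInstanceAs (TopologicalSpace (Quotient (S.inducedSetoid P)))

/-- The action `g' · [g, p, ρ] = [g' g, p, ρ]` of `G` on the induced space. -/
instance : MulAction G (S.InducedSpace P) where
  smul g' := Quotient.map (fun q => (g' * q.1, q.2)) (by
    rintro a b ⟨h, rfl⟩
    exact ⟨h, by simp [act, mul_assoc]⟩)
  one_smul m := by
    induction m using Quotient.inductionOn with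
    | h q => exact congrArg (Quotient.mk _) (by simp)
  mul_smul a b m := by
    induction m using Quotient.inductionOn with
    | h q => exact congrArg (Quotient.mk _) (by simp [mul_assoc])

/-- The bundle projection `[g, p, ρ] ↦ g H`. -/
def toBase : S.InducedSpace P → G ⧸ H :=
  Quotient.lift (fun q => (QuotientGroup.mk q.1 : G ⧸ H)) (by
    rintro a b ⟨h, rfl⟩
    rw [QuotientGroup.eq]
    simp [act])

/-- The map `[g, p, ρ] ↦ Ad*_{g⁻¹} (J(p) + ρ)`. -/
def inducedMomentum (J : P → S.sub)
    (hJ : ∀ (h : H) (p : P), J (h • p) = S.coAdSub h⁻¹ (J p)) : S.InducedSpace P → F :=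
  Quotient.lift (fun q => Q.coAd q.1⁻¹ ((J q.2.1 : F) + (q.2.2 : F))) (by
    rintro a b ⟨h, rfl⟩
    have e : ((S.coAdSub h⁻¹ (J a.2.1) : F) + (S.coAdPerp h⁻¹ a.2.2 : F))
        = Q.coAd (h : G)⁻¹ ((J a.2.1 : F) + (a.2.2 : F)) := by
      simp [coAdSub, coAdPerp, Q.coAd_add]
    simp only [act, hJ, e]
    rw [← Q.coAd_mul]
    simp)

/-! ### The reduced space -/

/-- The zero level set of `(p, g, ρ) ↦ J(p) - Π ρ` on `P × G × 𝔤_*`. -/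
def zeroLevel (J : P → S.sub) : Set (P × G × F) := {q | J q.1 - S.proj q.2.2 = 0}

/-- The orbit equivalence relation of `H` on the zero level set. -/
def reducedSetoid (J : P → S.sub) : Setoid (S.zeroLevel J) where
  r a b := ∃ h : H, S.bigAct h a.1 = b.1
  iseqv :=
    { refl := fun a => ⟨1, S.bigAct_one a.1⟩
      symm := by
        rintro a b ⟨h, hb⟩
        exact ⟨h⁻¹, by rw [← hb, ← S.bigAct_mul, inv_mul_cancel, S.bigAct_one]⟩
      trans := by
        rintro a b c ⟨h, hb⟩ ⟨k, hc⟩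
        exact ⟨k * h, by rw [S.bigAct_mul, hb, hc]⟩ }

/-- The reduced space: the orbit space of the zero level set. -/
def ReducedSpace (J : P → S.sub) : Type _ := Quotient (S.reducedSetoid J)

/-- The quotient topology. -/
instance [TopologicalSpace P] (J : P → S.sub) : TopologicalSpace (S.ReducedSpace J) :=
  inferInstanceAs (TopologicalSpace (Quotient (S.reducedSetoid J)))

/-- The weak symplectic form `ω ⊕ ω_L` of `P × G × 𝔤_*` at `(p, g, ρ)`, evaluated on the tangent
vectors `(a, T_e L_g x, μ)` and `(b, T_e L_g y, ν)`. -/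
def sumForm {EP : Type*} [NormedAddCommGroup EP] [NormedSpace ℝ EP]
    [TopologicalSpace P] [ChartedSpace EP P] (_S : InvariantSplitting Q H EH)
    (Ω : TwoForm EP P) (p : P) (ρ : F)
    (a : TangentSpace 𝓘(ℝ, EP) p) (x : LieAlg E G) (μ : F)
    (b : TangentSpace 𝓘(ℝ, EP) p) (y : LieAlg E G) (ν : F) : ℝ :=
  Ω p ![a, b] + Q.pair ν x - Q.pair μ y + Q.pair ρ ⁅x, y⁆

/-- The model space `𝔥^⊥ × T_pP × 𝔥_*^⊥` of the induced space, where `𝔥^⊥` is realized as the dual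
of `𝔥_*^⊥`. -/
abbrev Model (EP : Type*) : Type _ := (S.perp →L[ℝ] ℝ) × EP × S.perp

section Tangent

variable {EP : Type*} [NormedAddCommGroup EP] [NormedSpace ℝ EP]
  [TopologicalSpace P] [ChartedSpace EP P]

/-- The tangent vector `(T_e L_g x, a, μ)` of `G × P × 𝔥_*^⊥` at `(g, p, ρ)`. -/
def tangentVector (g : G) (p : P) (ρ : S.perp)
    (x : LieAlg E G) (a : TangentSpace 𝓘(ℝ, EP) p) (μ : S.perp) :
    TangentSpace (𝓘(ℝ, E).prod (𝓘(ℝ, EP).prod 𝓘(ℝ, S.perp))) (g, p, ρ) :=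
  ((mulInvariantVectorField x g : E), (a : EP), μ)

/-- The derivative `T_{(g, p, ρ)} π₀`, applied to `(T_e L_g x, a, μ)`. -/
def tangentProj [ChartedSpace (S.Model EP) (S.InducedSpace P)] (g : G) (p : P) (ρ : S.perp)
    (x : LieAlg E G) (a : TangentSpace 𝓘(ℝ, EP) p) (μ : S.perp) :
    TangentSpace 𝓘(ℝ, S.Model EP) (S.proj₀ (g, p, ρ)) :=
  mfderiv (𝓘(ℝ, E).prod (𝓘(ℝ, EP).prod 𝓘(ℝ, S.perp))) 𝓘(ℝ, S.Model EP)
    (fun q : G × P × S.perp => S.proj₀ q) (g, p, ρ) (S.tangentVector g p ρ x a μ)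

/-- The tangent vector at `(g, p, ρ)` of the `H`-orbit, in the direction `z ∈ 𝔥`: the derivative at
the identity of `h ↦ h · (g, p, ρ)`. -/
def orbitTangent (g : G) (p : P) (ρ : S.perp) (z : LieAlg EH H) :
    TangentSpace (𝓘(ℝ, E).prod (𝓘(ℝ, EP).prod 𝓘(ℝ, S.perp))) (g, p, ρ) :=
  ((mfderiv 𝓘(ℝ, EH) (𝓘(ℝ, E).prod (𝓘(ℝ, EP).prod 𝓘(ℝ, S.perp)))
    (fun h : H => S.act h (g, p, ρ)) 1 : EH →L[ℝ] E × EP × S.perp) z : E × EP × S.perp)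

/-- `T_pJ(a)`, as an element of `𝔤_*`, for `a ∈ T_pP`. -/
def tangentMap (J : P → S.sub) (p : P) (a : TangentSpace 𝓘(ℝ, EP) p) : F :=
  S.sub.subtype (mfderiv 𝓘(ℝ, EP) 𝓘(ℝ, S.sub) J p a)

end Tangent

end InvariantSplitting

end SymplecticInduction

end

open scoped Manifold ContDiff Topology

noncomputable section

namespace SymplecticInduction

/-! ### Derivatives of maps between manifolds as operators between the model spaces -/

section TangentDerivative

variable {E : Type*} [NormedAddCommGroup E] [NormedSpace ℝ E]
  {HM : Type*} [TopologicalSpace HM] {I : ModelWithCorners ℝ E HM}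
  {M : Type*} [TopologicalSpace M] [ChartedSpace HM M]
  {E' : Type*} [NormedAddCommGroup E'] [NormedSpace ℝ E']
  {HM' : Type*} [TopologicalSpace HM'] {I' : ModelWithCorners ℝ E' HM'}
  {M' : Type*} [TopologicalSpace M'] [ChartedSpace HM' M']
  {E'' : Type*} [NormedAddCommGroup E''] [NormedSpace ℝ E'']
  {HM'' : Type*} [TopologicalSpace HM''] {I'' : ModelWithCorners ℝ E'' HM''}
  {M'' : Type*} [TopologicalSpace M''] [ChartedSpace HM'' M'']

/-! All constructions live on `G × P × 𝔥_*^⊥`, which parametrizes the zero level set by `(g, p, ρ) ↦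
(p, g, J p + ρ)`, and are then pushed down along `π₀`.

Quotients. The annihilator condition gives `𝔤 = 𝔥^⊥ ⊕ 𝔥`, where `𝔥^⊥` is the dual of `𝔥_*^⊥`. The
inverse function theorem, applied to the product of a transversal in the directions of `𝔥^⊥` with a
chart of `H`, decomposes a neighbourhood of `1` in `G`. As `H` carries the subspace topology, the
transversal can be shrunk until it meets every coset at most once (`nonempty_slice`). Translates of
this slice give local sections everywhere. `PrincipalChart` abstracts what they provide and treats
`G → G ⧸ H` and `π₀` together: smooth structure, submersion property, descent of smooth maps, and
the kernel of the derivative as the tangent space of the fibre. Closedness of `H` makes the orbit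
relation closed, hence the Hausdorff property.

Predual. `Ad*_g` is known only as the restriction of a transpose to `𝔤_*`. Transposition embeds the
operators on `𝔤_*` into the operators from `𝔤` to the dual of `𝔤_*`, with closed but perhaps
uncomplemented range. Smoothness can still be tested after such an embedding
(`contDiffOn_of_comp_antilipschitz`), because limits of difference quotients stay in a closed range.
So `Ad*` is smooth for the operator norm and its derivative is `ad*` (`contMDiff_coAdL`,
`isoE_coadL`). Differentiating the `H`-invariance of the two summands shows that `ad*_x`, for `x ∈
𝔥`, preserves both.

Form. `bigForm` is the restriction of `ω ⊕ ω_L` to the level set. It is `H`-invariant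
(`bigForm_act`), and its kernel is exactly the tangent space of the orbit (`bigForm_orbit`,
`exists_orbit_of_bigForm_eq_zero`). It therefore descends to a nondegenerate form. Smoothness and
closedness are checked along the sections that define the charts: with `θ` the pulled-back
Maurer-Cartan form, the canonical part is `-d⟨J + ρ, θ⟩` by the Maurer-Cartan equation
(`fderiv_mcForm_sub`), so in coordinates the reduced form is `ω` in a chart of `P` minus an exact
form.

Formulas. The first explicit formula uses `[𝔥, 𝔥] ⊂ 𝔥` and `[𝔥, 𝔥^⊥] ⊂ 𝔥^⊥`. In the second, each
tangent vector has been changed by an orbit vector, which does not affect its image under `Tπ₀`.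

Momentum map. Left translations commute with `H` and preserve `bigForm`; the generator of `z` lifts
to `(TL_g Ad_{g⁻¹} z, 0, 0)`. Contraction with this lift gives `d⟨J, z⟩` for the induced map
(`isoE_tderiv_totalMomentum`), and two generators pair to `⟨J, [x, y]⟩` (`inducedForm_generators`).
By nondegeneracy the Hamiltonian vector field of `φ ∘ J` at `m` is the generator of `dφ(J m)`, which
yields the Poisson property. -/

variable (I I') in
/-- The manifold derivative, as a continuous linear map between the model spaces. -/
def tderiv (f : M → M') (x : M) : E →L[ℝ] E' := mfderiv I I' f x

theorem tderiv_comp {g : M' → M''} {f : M → M'} {x : M}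
    (hg : MDifferentiableAt I' I'' g (f x)) (hf : MDifferentiableAt I I' f x) :
    tderiv I I'' (fun y => g (f y)) x = (tderiv I' I'' g (f x)).comp (tderiv I I' f x) :=
  mfderiv_comp x hg hf

theorem tderiv_comp_apply {g : M' → M''} {f : M → M'} {x : M}
    (hg : MDifferentiableAt I' I'' g (f x)) (hf : MDifferentiableAt I I' f x) (v : E) :
    tderiv I I'' (fun y => g (f y)) x v = tderiv I' I'' g (f x) (tderiv I I' f x v) := by
  rw [tderiv_comp hg hf]; rfl

theorem tderiv_congr {f g : M → M'} {x : M} (h : f =ᶠ[𝓝 x] g) :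
    tderiv I I' f x = tderiv I I' g x :=
  h.mfderiv_eq

theorem tderiv_id (x : M) : tderiv I I (fun y : M => y) x = ContinuousLinearMap.id ℝ E :=
  mfderiv_id

theorem tderiv_const (c : M') (x : M) : tderiv I I' (fun _ : M => c) x = 0 :=
  mfderiv_const

theorem tderiv_eq_fderiv (f : E → E') (x : E) :
    tderiv 𝓘(ℝ, E) 𝓘(ℝ, E') f x = fderiv ℝ f x :=
  mfderiv_eq_fderiv

theorem tderiv_clm (f : E →L[ℝ] E') (x : E) :
    tderiv 𝓘(ℝ, E) 𝓘(ℝ, E') f x = f := by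
  rw [tderiv_eq_fderiv, f.fderiv]

theorem tderiv_clm_comp (L : E' →L[ℝ] E'') {f : M → E'} {x : M}
    (hf : MDifferentiableAt I 𝓘(ℝ, E') f x) :
    tderiv I 𝓘(ℝ, E'') (fun y => L (f y)) x = L.comp (tderiv I 𝓘(ℝ, E') f x) := by
  rw [tderiv_comp (g := L) (I' := 𝓘(ℝ, E')) L.mdifferentiableAt hf, tderiv_clm]

theorem tderiv_prodMk {f : M → M'} {g : M → M''} {x : M}
    (hf : MDifferentiableAt I I' f x) (hg : MDifferentiableAt I I'' g x) :
    tderiv I (I'.prod I'') (fun y => (f y, g y)) x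
      = (tderiv I I' f x).prod (tderiv I I'' g x) :=
  mfderiv_prodMk hf hg

theorem tderiv_fst (x : M × M') :
    tderiv (I.prod I') I (fun y : M × M' => y.1) x = ContinuousLinearMap.fst ℝ E E' :=
  mfderiv_fst

theorem tderiv_snd (x : M × M') :
    tderiv (I.prod I') I' (fun y : M × M' => y.2) x = ContinuousLinearMap.snd ℝ E E' :=
  mfderiv_snd

/-- The total derivative is the sum of the partial derivatives. -/
theorem tderiv_prod_apply {f : M × M' → M''} {x : M} {y : M'}
    (hf : MDifferentiableAt (I.prod I') I'' f (x, y)) (u : E) (v : E') :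
    tderiv (I.prod I') I'' f (x, y) (u, v)
      = tderiv I I'' (fun a => f (a, y)) x u + tderiv I' I'' (fun b => f (x, b)) y v :=
  mfderiv_prod_eq_add_apply hf

/-- The chain rule for a map of two variables evaluated along two maps. -/
theorem tderiv_comp₂ {N : Type*} [TopologicalSpace N] {E₀ : Type*} [NormedAddCommGroup E₀]
    [NormedSpace ℝ E₀] {HN : Type*} [TopologicalSpace HN] {IN : ModelWithCorners ℝ E₀ HN}
    [ChartedSpace HN N] {F : M × M' → M''} {f : N → M} {g : N → M'} {x : N}
    (hF : MDifferentiableAt (I.prod I') I'' F (f x, g x))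
    (hf : MDifferentiableAt IN I f x) (hg : MDifferentiableAt IN I' g x) (v : E₀) :
    tderiv IN I'' (fun y => F (f y, g y)) x v
      = tderiv I I'' (fun a => F (a, g x)) (f x) (tderiv IN I f x v)
        + tderiv I' I'' (fun b => F (f x, b)) (g x) (tderiv IN I' g x v) := by
  rw [tderiv_comp_apply (g := F) (f := fun y => (f y, g y)) (I' := I.prod I') hF (hf.prodMk hg),
    tderiv_prodMk hf hg]
  exact tderiv_prod_apply hF _ _

end TangentDerivative

/-! ### Smooth maps with values in a closed subspace -/

section ClosedEmbedding

universe u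

/-- If a map becomes smooth after composition with a linear embedding of Banach spaces, then it is
smooth (version for spaces in the same universe). -/
theorem contDiffOn_of_comp_antilipschitz_aux {E : Type u} [NormedAddCommGroup E] [NormedSpace ℝ E]
    {U : Set E} (hU : IsOpen U) (n : ℕ) : ∀ {X Y : Type u} [NormedAddCommGroup X]
    [NormedSpace ℝ X] [NormedAddCommGroup Y] [NormedSpace ℝ Y] [CompleteSpace Y]
    (i : Y →L[ℝ] X) (_ : ∃ C : ℝ, ∀ y, ‖y‖ ≤ C * ‖i y‖) (f : E → Y)
    (_ : ContDiffOn ℝ n (fun x => i (f x)) U), ContDiffOn ℝ n f U := by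
  induction n with
  | zero =>
    intro X Y _ _ _ _ _ i hi f hf
    obtain ⟨C, hC⟩ := hi
    have hcont : ContinuousOn f U := by
      have h0 : ContinuousOn (fun x => i (f x)) U := hf.continuousOn
      intro x hx
      have h1 := tendsto_iff_norm_sub_tendsto_zero.1 (h0 x hx)
      refine tendsto_iff_norm_sub_tendsto_zero.2 ?_
      refine squeeze_zero (fun _ => norm_nonneg _) (fun y => hC (f y - f x)) ?_
      simpa using h1.const_mul C
    exact contDiffOn_zero.2 hcont
  | succ n ih =>
    intro X Y _ _ _ _ _ i hi f hf
    obtain ⟨C, hC⟩ := hi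
    have hanti : AntilipschitzWith (Real.toNNReal C) i := by
      refine AddMonoidHomClass.antilipschitz_of_bound i fun y => (hC y).trans ?_
      gcongr
      exact Real.le_coe_toNNReal C
    have hclosed : IsClosed (Set.range i) := hanti.isClosed_range i.uniformContinuous
    have hinj : Function.Injective i := hanti.injective
    have hf' := (contDiffOn_succ_iff_fderiv_of_isOpen hU).1 (by exact_mod_cast hf :
      ContDiffOn ℝ ((n : WithTop ℕ∞) + 1) (fun x => i (f x)) U)
    obtain ⟨hd, -, hD⟩ := hf'
    -- The range of `i` is closed, since `i` is bounded below on a complete space, and it contains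
    -- the difference quotients of `i ∘ f`. No complement of the range is needed.
    have hmem : ∀ x ∈ U, ∀ v, ∃ y, i y = fderiv ℝ (fun x => i (f x)) x v := by
      intro x hx v
      have hdx := (hd.differentiableAt (hU.mem_nhds hx)).hasFDerivAt
      have hl := hdx.lim_real v
      have : fderiv ℝ (fun x => i (f x)) x v ∈ closure (Set.range i) := by
        refine mem_closure_of_tendsto hl (Filter.Eventually.of_forall fun c => ?_)
        exact ⟨c • (f (x + c⁻¹ • v) - f x), by simp⟩
      rwa [hclosed.closure_eq] at this
    have hC0 : ∀ y, ‖y‖ ≤ (max C 0) * ‖i y‖ := fun y =>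
      (hC y).trans (mul_le_mul_of_nonneg_right (le_max_left _ _) (norm_nonneg _))
    -- The preimages of the directional derivatives depend linearly on `v` by injectivity of `i` and
    -- are bounded by the lower estimate on `i`.
    have hL : ∀ x ∈ U, ∃ L : E →L[ℝ] Y, i.comp L = fderiv ℝ (fun x => i (f x)) x := by
      intro x hx
      choose y hy using hmem x hx
      refine ⟨LinearMap.mkContinuous
        { toFun := y
          map_add' := fun v w => hinj (by simp [hy])
          map_smul' := fun c v => hinj (by simp [hy]) }
        (max C 0 * ‖fderiv ℝ (fun x => i (f x)) x‖) (fun v => ?_), ?_⟩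
      · refine (hC0 _).trans ?_
        rw [mul_assoc]
        refine mul_le_mul_of_nonneg_left ?_ (le_max_right _ _)
        simpa [hy] using (fderiv ℝ (fun x => i (f x)) x).le_opNorm v
      · ext v
        simp [hy]
    have hderiv : ∀ x ∈ U, ∃ L : E →L[ℝ] Y, HasFDerivAt f L x ∧
        i.comp L = fderiv ℝ (fun x => i (f x)) x := by
      intro x hx
      obtain ⟨L, hLx⟩ := hL x hx
      refine ⟨L, ?_, hLx⟩
      have hdx := (hd.differentiableAt (hU.mem_nhds hx)).hasFDerivAt
      rw [hasFDerivAt_iff_isLittleO] at hdx ⊢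
      -- The remainder of `f` is at most a constant times the remainder of `i ∘ f`.
      refine (Asymptotics.IsBigO.of_bound (max C 0) (Filter.Eventually.of_forall fun y => ?_)).trans_isLittleO hdx
      refine (hC0 _).trans (le_of_eq ?_)
      rw [← hLx]
      simp
    have goal' : ContDiffOn ℝ ((n : WithTop ℕ∞) + 1) f U := by
     refine (contDiffOn_succ_iff_fderiv_of_isOpen hU).2
      ⟨fun x hx => ?_, fun h => absurd h (by simp), ?_⟩
     · obtain ⟨L, h, -⟩ := hderiv x hx
       exact h.differentiableAt.differentiableWithinAt
     -- The derivative is handled by the induction hypothesis for spaces of operators, with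
     -- post-composition by `i` as the new embedding. This is why the spaces vary during the
     -- induction and share one universe with `E`.
     · refine ih (ContinuousLinearMap.compL ℝ E Y X i) ⟨max C 0, fun T => ?_⟩ (fderiv ℝ f) ?_
       · refine T.opNorm_le_bound (by positivity) fun v => (hC0 _).trans ?_
         rw [mul_assoc]
         exact mul_le_mul_of_nonneg_left ((i.comp T).le_opNorm v) (le_max_right _ _)
       · refine hD.congr fun x hx => ?_
         obtain ⟨L, h, h'⟩ := hderiv x hx
         rw [h.fderiv]
         exact h'
    exact_mod_cast goal'

universe v w

/-- If a map becomes smooth after composition with a linear embedding of Banach spaces, then it is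
smooth. -/
theorem contDiffOn_of_comp_antilipschitz {E : Type u} [NormedAddCommGroup E] [NormedSpace ℝ E]
    {U : Set E} (hU : IsOpen U) {X : Type v} {Y : Type w} [NormedAddCommGroup X]
    [NormedSpace ℝ X] [NormedAddCommGroup Y] [NormedSpace ℝ Y] [CompleteSpace Y]
    (i : Y →L[ℝ] X) {C : ℝ} (hi : ∀ y, ‖y‖ ≤ C * ‖i y‖) {f : E → Y}
    (hf : ContDiffOn ℝ ∞ (fun x => i (f x)) U) : ContDiffOn ℝ ∞ f U := by
  rw [contDiffOn_infty]
  intro n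
  -- All three spaces are moved to a common universe.
  let eE : ULift.{max v w} E ≃L[ℝ] E := ContinuousLinearEquiv.ulift
  let eX : ULift.{max u w} X ≃L[ℝ] X := ContinuousLinearEquiv.ulift
  let eY : ULift.{max u v} Y ≃L[ℝ] Y := ContinuousLinearEquiv.ulift
  have hEc : ContDiff ℝ ∞ eE := eE.contDiff
  have key := contDiffOn_of_comp_antilipschitz_aux (hU.preimage eE.continuous) n
    ((eX.symm : X →L[ℝ] ULift.{max u w} X).comp (i.comp (eY : ULift.{max u v} Y →L[ℝ] Y)))
    ⟨C, fun y => hi (eY y)⟩ (fun x => eY.symm (f (eE x))) (by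
      refine (eX.symm.contDiff (n := n)).comp_contDiffOn ?_
      have := (hf.of_le (by exact_mod_cast le_top : (n : WithTop ℕ∞) ≤ ∞)).comp
        (g := fun x => i (f x)) ((hEc.of_le (by exact_mod_cast le_top)).contDiffOn (s := eE ⁻¹' U))
        (fun x hx => hx)
      exact this)
  have h2 : ContDiffOn ℝ n (fun x => eY (eY.symm (f (eE (eE.symm x))))) U :=
    (eY.contDiff (n := n)).comp_contDiffOn (key.comp ((eE.symm.contDiff (n := n)).contDiffOn (s := U))
      (fun x hx => by simpa using hx))
  simpa using h2

end ClosedEmbedding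

/-! ### Calculus on Banach Lie groups -/

section ConstantBase

variable {E : Type*} [NormedAddCommGroup E] [NormedSpace ℝ E]
  {M : Type*} [TopologicalSpace M] [ChartedSpace E M] [IsManifold 𝓘(ℝ, E) ∞ M]
  {E' : Type*} [NormedAddCommGroup E'] [NormedSpace ℝ E']
  {M' : Type*} [TopologicalSpace M'] [ChartedSpace E' M'] [IsManifold 𝓘(ℝ, E') ∞ M']
  {E₀ : Type*} [NormedAddCommGroup E₀] [NormedSpace ℝ E₀]
  {N : Type*} [TopologicalSpace N] [ChartedSpace E₀ N] [IsManifold 𝓘(ℝ, E₀) ∞ N]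

/-- The derivative at a fixed point of a smooth family of maps preserving base points depends
smoothly on the parameter. -/
theorem contMDiffAt_tderiv_of_const {n₀ : N} {f : N → M → M'} {x₀ : M} {y₀ : M'}
    (hf : ContMDiffAt (𝓘(ℝ, E₀).prod 𝓘(ℝ, E)) 𝓘(ℝ, E') ∞ (Function.uncurry f) (n₀, x₀))
    (hy : ∀ n, f n x₀ = y₀) :
    ContMDiffAt 𝓘(ℝ, E₀) 𝓘(ℝ, E →L[ℝ] E') ∞
      (fun n => tderiv 𝓘(ℝ, E) 𝓘(ℝ, E') (f n) x₀) n₀ := by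
  have h := ContMDiffAt.mfderiv (m := ∞) f (fun _ : N => x₀) hf contMDiffAt_const le_rfl
  refine h.congr_of_eventuallyEq (Filter.Eventually.of_forall fun n => ?_)
  have hx : x₀ ∈ (chartAt E x₀).source := mem_chart_source _ _
  have hy' : f n x₀ ∈ (chartAt E' (f n₀ x₀)).source := by
    simp only [hy]
    exact mem_chart_source _ _
  refine Eq.trans ?_ (inTangentCoordinates_eq (I := 𝓘(ℝ, E)) (I' := 𝓘(ℝ, E'))
    (f := fun _ : N => x₀) (g := fun n => f n x₀)
    (ϕ := fun n => tderiv 𝓘(ℝ, E) 𝓘(ℝ, E') (f n) x₀) (x₀ := n₀) (x := n) hx hy').symm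
  ext v
  -- Both base points are independent of the parameter, so the coordinate changes of the tangent
  -- bundles hidden in `inTangentCoordinates` are identities.
  have e1 : (tangentBundleCore 𝓘(ℝ, E) M).coordChange (achart E x₀) (achart E x₀) x₀ v = v :=
    (tangentBundleCore 𝓘(ℝ, E) M).coordChange_self (achart E x₀) x₀ (mem_chart_source E x₀) v
  have e2 : ∀ w, (tangentBundleCore 𝓘(ℝ, E') M').coordChange (achart E' (f n x₀))
      (achart E' (f n₀ x₀)) (f n x₀) w = w := by
    intro w
    rw [hy, hy]
    exact (tangentBundleCore 𝓘(ℝ, E') M').coordChange_self (achart E' y₀) y₀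
      (mem_chart_source E' y₀) w
  simp only [ContinuousLinearMap.comp_apply]
  rw [e1, e2]

end ConstantBase

section LieGroups

set_option linter.unusedSectionVars false

variable {E : Type*} [NormedAddCommGroup E] [NormedSpace ℝ E]
  {G : Type*} [TopologicalSpace G] [ChartedSpace E G] [Group G]

variable (E) in
/-- The derivative at the identity of the left multiplication by `g`. -/
def leftT (g : G) : E →L[ℝ] E := tderiv 𝓘(ℝ, E) 𝓘(ℝ, E) (fun a : G => g * a) 1

variable (E) in
/-- The derivative at `g` of the left multiplication by `g⁻¹`. -/
def leftTInv (g : G) : E →L[ℝ] E := tderiv 𝓘(ℝ, E) 𝓘(ℝ, E) (fun a : G => g⁻¹ * a) g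

variable (E) in
/-- `Ad_g` as an operator on the model space. -/
def adMap (g : G) : E →L[ℝ] E := tderiv 𝓘(ℝ, E) 𝓘(ℝ, E) (fun a : G => g * a * g⁻¹) 1

variable (G) in
/-- The Lie bracket, on the model space. -/
def brk (x y : E) : E := Bracket.bracket (L := LieAlg E G) (M := LieAlg E G) x y

variable [LieGroup 𝓘(ℝ, E) ∞ G]

theorem contMDiff_conj (g : G) : ContMDiff 𝓘(ℝ, E) 𝓘(ℝ, E) ∞ (fun a : G => g * a * g⁻¹) :=
  (contMDiff_mul_right (a := g⁻¹)).comp (contMDiff_mul_left (a := g))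

theorem mdiffAt_mul_left (g a : G) :
    MDifferentiableAt 𝓘(ℝ, E) 𝓘(ℝ, E) (fun b : G => g * b) a :=
  ((contMDiff_mul_left (I := 𝓘(ℝ, E)) (n := ∞) (a := g)) a).mdifferentiableAt (by simp)

theorem mdiffAt_mul_right (g a : G) :
    MDifferentiableAt 𝓘(ℝ, E) 𝓘(ℝ, E) (fun b : G => b * g) a :=
  ((contMDiff_mul_right (I := 𝓘(ℝ, E)) (n := ∞) (a := g)) a).mdifferentiableAt (by simp)

theorem mdiffAt_conj (g a : G) :
    MDifferentiableAt 𝓘(ℝ, E) 𝓘(ℝ, E) (fun a : G => g * a * g⁻¹) a :=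
  ((contMDiff_conj g) a).mdifferentiableAt (by simp)

theorem leftTInv_leftT (g : G) (x : E) : leftTInv E g (leftT E g x) = x := by
  have h := tderiv_comp_apply (I := 𝓘(ℝ, E)) (I' := 𝓘(ℝ, E)) (I'' := 𝓘(ℝ, E)) (x := (1 : G))
    (f := fun a : G => g * a) (g := fun a : G => g⁻¹ * a)
    (mdiffAt_mul_left _ _) (mdiffAt_mul_left _ _) x
  simp only [inv_mul_cancel_left, mul_one, tderiv_id] at h
  exact h.symm

theorem leftT_leftTInv (g : G) (x : E) : leftT E g (leftTInv E g x) = x := by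
  have h := tderiv_comp_apply (I := 𝓘(ℝ, E)) (I' := 𝓘(ℝ, E)) (I'' := 𝓘(ℝ, E)) (x := g)
    (f := fun a : G => g⁻¹ * a) (g := fun a : G => g * a)
    (mdiffAt_mul_left _ _) (mdiffAt_mul_left _ _) x
  simp only [mul_inv_cancel_left, inv_mul_cancel, tderiv_id] at h
  exact h.symm

theorem leftT_mul (g k : G) (x : E) :
    tderiv 𝓘(ℝ, E) 𝓘(ℝ, E) (fun a : G => g * a) k (leftT E k x) = leftT E (g * k) x := by
  have h := tderiv_comp_apply (I := 𝓘(ℝ, E)) (I' := 𝓘(ℝ, E)) (I'' := 𝓘(ℝ, E)) (x := (1 : G))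
    (f := fun a : G => k * a) (g := fun a : G => g * a)
    (mdiffAt_mul_left _ _) (mdiffAt_mul_left _ _) x
  simp only [mul_one] at h
  rw [leftT, leftT, ← h]
  simp only [mul_assoc]

theorem leftTInv_mul (g k : G) (w : E) :
    leftTInv E (g * k) (tderiv 𝓘(ℝ, E) 𝓘(ℝ, E) (fun a : G => g * a) k w) = leftTInv E k w := by
  rw [← leftT_leftTInv k w, leftT_mul, leftTInv_leftT, leftTInv_leftT]

theorem leftT_one (x : E) : leftT E (1 : G) x = x := by
  simp [leftT, tderiv_id]

/-- Right multiplication in terms of left multiplication and the adjoint action. -/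
theorem rightT_leftT (g k : G) (x : E) :
    tderiv 𝓘(ℝ, E) 𝓘(ℝ, E) (fun a : G => a * k) g (leftT E g x)
      = leftT E (g * k) (adMap E k⁻¹ x) := by
  have h1 := tderiv_comp_apply (I := 𝓘(ℝ, E)) (I' := 𝓘(ℝ, E)) (I'' := 𝓘(ℝ, E)) (x := (1 : G))
    (f := fun a : G => g * a) (g := fun a : G => a * k)
    (mdiffAt_mul_right _ _) (mdiffAt_mul_left _ _) x
  have h2 := tderiv_comp_apply (I := 𝓘(ℝ, E)) (I' := 𝓘(ℝ, E)) (I'' := 𝓘(ℝ, E)) (x := (1 : G))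
    (f := fun a : G => k⁻¹ * a * k⁻¹⁻¹) (g := fun a : G => (g * k) * a)
    (mdiffAt_mul_left _ _) (mdiffAt_conj _ _) x
  simp only [mul_one, inv_inv, inv_mul_cancel] at h1 h2
  rw [leftT, leftT, adMap, ← h1]
  simp only [inv_inv]
  rw [← h2]
  -- Both derivatives come from the identity `(g a) k = (g k) (k⁻¹ a k)`.
  congr 2
  funext a
  group

theorem adMap_mul (g k : G) (x : E) : adMap E (g * k) x = adMap E g (adMap E k x) :=
  Ad_mul (E := E) g k x

theorem adMap_one (x : E) : adMap E (1 : G) x = x := Ad_one (E := E) x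

theorem adMap_inv_adMap (g : G) (x : E) : adMap E g⁻¹ (adMap E g x) = x := by
  rw [← adMap_mul, inv_mul_cancel, adMap_one]

/-- The adjoint representation is smooth for the operator norm. -/
theorem contMDiff_adMap : ContMDiff 𝓘(ℝ, E) 𝓘(ℝ, E →L[ℝ] E) ∞ (fun g : G => adMap E g) := by
  intro g₀
  -- Every conjugation fixes `1`, so the derivatives are operators on one fixed tangent space.
  refine contMDiffAt_tderiv_of_const (y₀ := (1 : G)) (f := fun g a : G => g * a * g⁻¹) ?_
    (by simp)
  have h1 : ContMDiff (𝓘(ℝ, E).prod 𝓘(ℝ, E)) 𝓘(ℝ, E) ∞ (fun q : G × G => q.1 * q.2 * q.1⁻¹) :=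
    (contMDiff_fst.mul contMDiff_snd).mul contMDiff_fst.inv
  exact h1 _

end LieGroups

/-! ### The Lie bracket as a second derivative of the multiplication in a chart. -/

section ChartMultiplication

set_option linter.unusedSectionVars false

section Charts

variable {E : Type*} [NormedAddCommGroup E] [NormedSpace ℝ E]
  {M : Type*} [TopologicalSpace M] [ChartedSpace E M] [IsManifold 𝓘(ℝ, E) ∞ M]

theorem tderiv_extChartAt_self (x : M) :
    tderiv 𝓘(ℝ, E) 𝓘(ℝ, E) (extChartAt 𝓘(ℝ, E) x) x = ContinuousLinearMap.id ℝ E :=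
  mfderiv_extChartAt_self

theorem contMDiffAt_extChartAt_symm {x : M} {y : E} (hy : y ∈ (extChartAt 𝓘(ℝ, E) x).target) :
    ContMDiffAt 𝓘(ℝ, E) 𝓘(ℝ, E) ∞ (extChartAt 𝓘(ℝ, E) x).symm y :=
  (contMDiffOn_extChartAt_symm x).contMDiffAt ((isOpen_extChartAt_target x).mem_nhds hy)

theorem contMDiffAt_extChartAt_of_mem {x y : M} (hy : y ∈ (extChartAt 𝓘(ℝ, E) x).source) :
    ContMDiffAt 𝓘(ℝ, E) 𝓘(ℝ, E) ∞ (extChartAt 𝓘(ℝ, E) x) y :=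
  contMDiffAt_extChartAt' (by simpa using hy)

theorem tderiv_extChartAt_symm_self (x : M) :
    tderiv 𝓘(ℝ, E) 𝓘(ℝ, E) (extChartAt 𝓘(ℝ, E) x).symm (extChartAt 𝓘(ℝ, E) x x)
      = ContinuousLinearMap.id ℝ E := by
  ext v
  have h := tderiv_comp_apply (I := 𝓘(ℝ, E)) (I' := 𝓘(ℝ, E)) (I'' := 𝓘(ℝ, E))
    (g := extChartAt 𝓘(ℝ, E) x) (f := (extChartAt 𝓘(ℝ, E) x).symm)
    (x := extChartAt 𝓘(ℝ, E) x x)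
    (by
      rw [extChartAt_to_inv]
      exact (contMDiffAt_extChartAt (n := ∞)).mdifferentiableAt (by simp))
    ((contMDiffAt_extChartAt_symm (mem_extChartAt_target x)).mdifferentiableAt (by simp)) v
  rw [extChartAt_to_inv, tderiv_extChartAt_self] at h
  rw [← ContinuousLinearMap.id_apply (R₁ := ℝ) (tderiv 𝓘(ℝ, E) 𝓘(ℝ, E) _ _ v), ← h,
    tderiv_congr (g := fun y => y), tderiv_id]
  filter_upwards [extChartAt_target_mem_nhds (I := 𝓘(ℝ, E)) x] with z hz
  exact (extChartAt 𝓘(ℝ, E) x).right_inv hz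

/-- The inverse of the derivative of an inverse chart is the derivative of the chart. -/
theorem tderiv_extChartAt_symm_tderiv_extChartAt {x : M} {y : E}
    (hy : y ∈ (extChartAt 𝓘(ℝ, E) x).target) (v : E) :
    tderiv 𝓘(ℝ, E) 𝓘(ℝ, E) (extChartAt 𝓘(ℝ, E) x).symm y
      (tderiv 𝓘(ℝ, E) 𝓘(ℝ, E) (extChartAt 𝓘(ℝ, E) x) ((extChartAt 𝓘(ℝ, E) x).symm y) v) = v := by
  have hs := (extChartAt 𝓘(ℝ, E) x).map_target hy
  have h := tderiv_comp_apply (I := 𝓘(ℝ, E)) (I' := 𝓘(ℝ, E)) (I'' := 𝓘(ℝ, E))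
    (f := extChartAt 𝓘(ℝ, E) x) (g := (extChartAt 𝓘(ℝ, E) x).symm)
    (x := (extChartAt 𝓘(ℝ, E) x).symm y)
    (by
      rw [(extChartAt 𝓘(ℝ, E) x).right_inv hy]
      exact (contMDiffAt_extChartAt_symm hy).mdifferentiableAt (by simp))
    ((contMDiffAt_extChartAt_of_mem hs).mdifferentiableAt (by simp)) v
  rw [(extChartAt 𝓘(ℝ, E) x).right_inv hy] at h
  rw [← h, tderiv_congr (g := fun y => y), tderiv_id]
  · rfl
  filter_upwards [(isOpen_extChartAt_source x).mem_nhds hs] with z hz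
  exact (extChartAt 𝓘(ℝ, E) x).left_inv hz

theorem tderiv_extChartAt_tderiv_extChartAt_symm {x : M} {y : E}
    (hy : y ∈ (extChartAt 𝓘(ℝ, E) x).target) (v : E) :
    tderiv 𝓘(ℝ, E) 𝓘(ℝ, E) (extChartAt 𝓘(ℝ, E) x) ((extChartAt 𝓘(ℝ, E) x).symm y)
      (tderiv 𝓘(ℝ, E) 𝓘(ℝ, E) (extChartAt 𝓘(ℝ, E) x).symm y v) = v := by
  have hs := (extChartAt 𝓘(ℝ, E) x).map_target hy
  have h := tderiv_comp_apply (I := 𝓘(ℝ, E)) (I' := 𝓘(ℝ, E)) (I'' := 𝓘(ℝ, E))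
    (g := extChartAt 𝓘(ℝ, E) x) (f := (extChartAt 𝓘(ℝ, E) x).symm) (x := y)
    ((contMDiffAt_extChartAt_of_mem hs).mdifferentiableAt (by simp))
    ((contMDiffAt_extChartAt_symm hy).mdifferentiableAt (by simp)) v
  rw [← h, tderiv_congr (g := fun y => y), tderiv_id]
  · rfl
  filter_upwards [(isOpen_extChartAt_target x).mem_nhds hy] with z hz
  exact (extChartAt 𝓘(ℝ, E) x).right_inv hz

/-- The Lie bracket of vector fields on a manifold is defined by pull-back with the operator
`inverse`; this makes that inverse explicit for a chart. -/
theorem inverse_tderiv_extChartAt_symm {x : M} {y : E}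
    (hy : y ∈ (extChartAt 𝓘(ℝ, E) x).target) :
    (tderiv 𝓘(ℝ, E) 𝓘(ℝ, E) (extChartAt 𝓘(ℝ, E) x).symm y).inverse
      = tderiv 𝓘(ℝ, E) 𝓘(ℝ, E) (extChartAt 𝓘(ℝ, E) x) ((extChartAt 𝓘(ℝ, E) x).symm y) := by
  refine ContinuousLinearMap.inverse_eq ?_ ?_
  · ext v
    exact tderiv_extChartAt_symm_tderiv_extChartAt hy v
  · ext v
    exact tderiv_extChartAt_tderiv_extChartAt_symm hy v

end Charts

variable {E : Type*} [NormedAddCommGroup E] [NormedSpace ℝ E]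
  {G : Type*} [TopologicalSpace G] [ChartedSpace E G] [Group G]

variable (E G) in
/-- The coordinates of the identity. -/
def chartOne : E := extChartAt 𝓘(ℝ, E) (1 : G) 1

variable (G) in
/-- The multiplication in the preferred chart at the identity. -/
def chartMul (q : E × E) : E :=
  extChartAt 𝓘(ℝ, E) (1 : G)
    ((extChartAt 𝓘(ℝ, E) (1 : G)).symm q.1 * (extChartAt 𝓘(ℝ, E) (1 : G)).symm q.2)

theorem chartOne_symm : (extChartAt 𝓘(ℝ, E) (1 : G)).symm (chartOne E G) = 1 :=
  extChartAt_to_inv 1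

theorem chartOne_mem_target : chartOne E G ∈ (extChartAt 𝓘(ℝ, E) (1 : G)).target :=
  mem_extChartAt_target 1

variable [LieGroup 𝓘(ℝ, E) ∞ G]

theorem contDiffAt_chartMul {a b : E} (ha : a ∈ (extChartAt 𝓘(ℝ, E) (1 : G)).target)
    (hb : b ∈ (extChartAt 𝓘(ℝ, E) (1 : G)).target)
    (hab : (extChartAt 𝓘(ℝ, E) (1 : G)).symm a * (extChartAt 𝓘(ℝ, E) (1 : G)).symm b
      ∈ (extChartAt 𝓘(ℝ, E) (1 : G)).source) : ContDiffAt ℝ ∞ (chartMul (E := E) G) (a, b) := by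
  rw [← contMDiffAt_iff_contDiffAt]
  have h1 : ContMDiffAt 𝓘(ℝ, E × E) 𝓘(ℝ, E) ∞
      (fun q : E × E => (extChartAt 𝓘(ℝ, E) (1 : G)).symm q.1) (a, b) :=
    ContMDiffAt.comp (I' := 𝓘(ℝ, E)) (a, b) (f := Prod.fst)
      (contMDiffAt_extChartAt_symm ha) contDiff_fst.contMDiff.contMDiffAt
  have h2 : ContMDiffAt 𝓘(ℝ, E × E) 𝓘(ℝ, E) ∞
      (fun q : E × E => (extChartAt 𝓘(ℝ, E) (1 : G)).symm q.2) (a, b) :=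
    ContMDiffAt.comp (I' := 𝓘(ℝ, E)) (a, b) (f := Prod.snd)
      (contMDiffAt_extChartAt_symm hb) contDiff_snd.contMDiff.contMDiffAt
  exact ContMDiffAt.comp (I' := 𝓘(ℝ, E)) (a, b) (contMDiffAt_extChartAt_of_mem hab) (h1.mul h2)

theorem contDiffAt_chartMul_one :
    ContDiffAt ℝ ∞ (chartMul (E := E) G) (chartOne E G, chartOne E G) :=
  contDiffAt_chartMul chartOne_mem_target chartOne_mem_target (by
    rw [chartOne_symm, one_mul]
    exact mem_extChartAt_source 1)

/-- The partial derivative of the multiplication in the second variable at the identity. -/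
theorem fderiv_chartMul_right {a : E} (ha : a ∈ (extChartAt 𝓘(ℝ, E) (1 : G)).target) (y : E) :
    fderiv ℝ (chartMul (E := E) G) (a, chartOne E G) (0, y)
      = tderiv 𝓘(ℝ, E) 𝓘(ℝ, E) (extChartAt 𝓘(ℝ, E) (1 : G))
          ((extChartAt 𝓘(ℝ, E) (1 : G)).symm a)
          (leftT E ((extChartAt 𝓘(ℝ, E) (1 : G)).symm a) y) := by
  set g := (extChartAt 𝓘(ℝ, E) (1 : G)).symm a with hg
  have hs : g ∈ (extChartAt 𝓘(ℝ, E) (1 : G)).source := (extChartAt 𝓘(ℝ, E) (1 : G)).map_target ha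
  have hd : DifferentiableAt ℝ (chartMul (E := E) G) (a, chartOne E G) :=
    (contDiffAt_chartMul ha chartOne_mem_target (by
      rw [chartOne_symm, mul_one]; exact hs)).differentiableAt (by simp)
  have h1 : fderiv ℝ (chartMul (E := E) G) (a, chartOne E G) (0, y)
      = fderiv ℝ (fun b => chartMul (E := E) G (a, b)) (chartOne E G) y := by
    have := (hd.hasFDerivAt.comp (chartOne E G)
      ((hasFDerivAt_const a (chartOne E G)).prodMk (hasFDerivAt_id (chartOne E G)))).fderiv
    simp only [Function.comp_def] at this
    rw [this]
    simp
  rw [h1, ← tderiv_eq_fderiv]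
  have h2 := tderiv_comp_apply (I := 𝓘(ℝ, E)) (I' := 𝓘(ℝ, E)) (I'' := 𝓘(ℝ, E))
    (f := (extChartAt 𝓘(ℝ, E) (1 : G)).symm) (g := fun b : G => g * b) (x := chartOne E G)
    (mdiffAt_mul_left _ _)
    ((contMDiffAt_extChartAt_symm chartOne_mem_target).mdifferentiableAt (by simp)) y
  have h3 := tderiv_comp_apply (I := 𝓘(ℝ, E)) (I' := 𝓘(ℝ, E)) (I'' := 𝓘(ℝ, E))
    (f := fun b => g * (extChartAt 𝓘(ℝ, E) (1 : G)).symm b)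
    (g := extChartAt 𝓘(ℝ, E) (1 : G)) (x := chartOne E G)
    (by
      rw [chartOne_symm, mul_one]
      exact (contMDiffAt_extChartAt_of_mem hs).mdifferentiableAt (by simp))
    ((mdiffAt_mul_left _ _).comp (I' := 𝓘(ℝ, E)) (chartOne E G)
      ((contMDiffAt_extChartAt_symm chartOne_mem_target).mdifferentiableAt (by simp))) y
  refine h3.trans ?_
  rw [h2, chartOne_symm, mul_one]
  have h4 : tderiv 𝓘(ℝ, E) 𝓘(ℝ, E) (extChartAt 𝓘(ℝ, E) (1 : G)).symm (chartOne E G) y = y := by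
    rw [chartOne, tderiv_extChartAt_symm_self]; rfl
  rw [h4]
  rfl

theorem fderiv_chartMul_one_right (y : E) :
    fderiv ℝ (chartMul (E := E) G) (chartOne E G, chartOne E G) (0, y) = y := by
  rw [fderiv_chartMul_right chartOne_mem_target, chartOne_symm, leftT_one, tderiv_extChartAt_self]
  rfl

theorem hasFDerivAt_prodMk_const {E₁ E₂ : Type*} [NormedAddCommGroup E₁] [NormedSpace ℝ E₁]
    [NormedAddCommGroup E₂] [NormedSpace ℝ E₂] (a : E₁) (b : E₂) :
    HasFDerivAt (fun x : E₁ => (x, b)) (ContinuousLinearMap.inl ℝ E₁ E₂) a :=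
  ((hasFDerivAt_id a).prodMk (hasFDerivAt_const b a)).congr_fderiv (by ext <;> simp)

theorem hasFDerivAt_const_prodMk {E₁ E₂ : Type*} [NormedAddCommGroup E₁] [NormedSpace ℝ E₁]
    [NormedAddCommGroup E₂] [NormedSpace ℝ E₂] (a : E₁) (b : E₂) :
    HasFDerivAt (fun x : E₂ => (a, x)) (ContinuousLinearMap.inr ℝ E₁ E₂) b :=
  ((hasFDerivAt_const a b).prodMk (hasFDerivAt_id b)).congr_fderiv (by ext <;> simp)

theorem two_le_infty : (2 : WithTop ℕ∞) ≤ ∞ := WithTop.coe_le_coe.2 le_top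

theorem fderiv_chartMul_one_left (y : E) :
    fderiv ℝ (chartMul (E := E) G) (chartOne E G, chartOne E G) (y, 0) = y := by
  have hd : DifferentiableAt ℝ (chartMul (E := E) G) (chartOne E G, chartOne E G) :=
    contDiffAt_chartMul_one.differentiableAt (by simp)
  have h1 := hd.hasFDerivAt.comp (f := fun a : E => (a, chartOne E G)) (chartOne E G)
    (hasFDerivAt_prodMk_const (chartOne E G) (chartOne E G))
  have h2 : HasFDerivAt (fun a : E => a) (ContinuousLinearMap.id ℝ E) (chartOne E G) :=
    hasFDerivAt_id _
  have h3 := h1.unique (h2.congr_of_eventuallyEq (by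
    filter_upwards [(isOpen_extChartAt_target (I := 𝓘(ℝ, E)) (1 : G)).mem_nhds
      chartOne_mem_target] with a ha
    simp only [Function.comp_def, chartMul, chartOne_symm, mul_one]
    exact (extChartAt 𝓘(ℝ, E) (1 : G)).right_inv ha))
  simpa using congrArg (fun L => L y) h3

variable (G) in
/-- The mixed second derivative of the multiplication at the identity. -/
def chartMul₂ (x y : E) : E :=
  fderiv ℝ (fderiv ℝ (chartMul (E := E) G)) (chartOne E G, chartOne E G) (x, 0) (0, y)

theorem hasFDerivAt_fderiv_chartMul :
    HasFDerivAt (fderiv ℝ (chartMul (E := E) G))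
      (fderiv ℝ (fderiv ℝ (chartMul (E := E) G)) (chartOne E G, chartOne E G))
      (chartOne E G, chartOne E G) := by
  refine DifferentiableAt.hasFDerivAt ?_
  exact (contDiffAt_chartMul_one.fderiv_right (m := 1) (by
    rw [one_add_one_eq_two]; exact two_le_infty)).differentiableAt (by simp)

/-- Second derivatives are symmetric, so the order of differentiation is immaterial. What remains is
the asymmetry between the two factors of the product, and this produces the bracket. -/
theorem chartMul₂_symm (x y : E) :
    fderiv ℝ (fderiv ℝ (chartMul (E := E) G)) (chartOne E G, chartOne E G) (0, y) (x, 0)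
      = chartMul₂ G x y :=
  (contDiffAt_chartMul_one.isSymmSndFDerivAt (by simpa using two_le_infty)).eq _ _

/-- The Lie bracket in terms of the second derivative of the multiplication. -/
theorem brk_eq (x y : E) : brk G x y = chartMul₂ G x y - chartMul₂ G y x := by
  -- In the chart, the left-invariant field of `z` is the partial derivative of the multiplication
  -- in the second factor at the identity.
  have hV : ∀ z : E,
      (VectorField.mpullbackWithin 𝓘(ℝ, E) 𝓘(ℝ, E) (extChartAt 𝓘(ℝ, E) (1 : G)).symm
        (mulInvariantVectorField (z : LieAlg E G)) (Set.range 𝓘(ℝ, E)) : E → E)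
      =ᶠ[𝓝 (chartOne E G)] fun a => fderiv ℝ (chartMul (E := E) G) (a, chartOne E G) (0, z) := by
    intro z
    filter_upwards [(isOpen_extChartAt_target (I := 𝓘(ℝ, E)) (1 : G)).mem_nhds
      chartOne_mem_target] with a ha
    rw [fderiv_chartMul_right ha, ← inverse_tderiv_extChartAt_symm ha,
      VectorField.mpullbackWithin_apply]
    simp only [modelWithCornersSelf_coe, Set.range_id, mfderivWithin_univ]
    rfl
  have hD : ∀ z : E, HasFDerivAt
      (fun a => fderiv ℝ (chartMul (E := E) G) (a, chartOne E G) (0, z))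
      (((fderiv ℝ (fderiv ℝ (chartMul (E := E) G)) (chartOne E G, chartOne E G)).comp
        (ContinuousLinearMap.inl ℝ E E)).flip (0, z)) (chartOne E G) := by
    intro z
    have h1 := (hasFDerivAt_fderiv_chartMul (E := E) (G := G)).comp
      (f := fun a : E => (a, chartOne E G)) (chartOne E G)
      (hasFDerivAt_prodMk_const (chartOne E G) (chartOne E G))
    have h2 := h1.clm_apply (hasFDerivAt_const ((0 : E), z) (chartOne E G))
    refine h2.congr_fderiv ?_
    ext v
    simp
  -- The bracket unfolds to the bracket of the pulled-back fields. Naming these fields allows their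
  -- replacement by fields with the same germs.
  obtain ⟨V, W, hVx, hWy, h0⟩ : ∃ V W : E → E,
      (V =ᶠ[𝓝 (chartOne E G)] fun a => fderiv ℝ (chartMul (E := E) G) (a, chartOne E G) (0, x)) ∧
      (W =ᶠ[𝓝 (chartOne E G)] fun a => fderiv ℝ (chartMul (E := E) G) (a, chartOne E G) (0, y)) ∧
      brk G x y = (tderiv 𝓘(ℝ, E) 𝓘(ℝ, E) (extChartAt 𝓘(ℝ, E) (1 : G)) 1).inverse
        (VectorField.lieBracketWithin ℝ V W
          ((extChartAt 𝓘(ℝ, E) (1 : G)).symm ⁻¹' Set.univ ∩ Set.range 𝓘(ℝ, E))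
          (chartOne E G)) :=
    ⟨_, _, hV x, hV y, rfl⟩
  rw [h0, tderiv_extChartAt_self, ContinuousLinearMap.inverse_id]
  simp only [modelWithCornersSelf_coe, Set.range_id, Set.preimage_univ, Set.inter_univ,
    VectorField.lieBracketWithin_univ, ContinuousLinearMap.id_apply]
  rw [hVx.lieBracket_vectorField_eq hWy, VectorField.lieBracket,
    (hD x).fderiv, (hD y).fderiv, fderiv_chartMul_one_right, fderiv_chartMul_one_right]
  rfl

theorem brk_swap (x y : E) : brk G x y = -brk G y x := by
  rw [brk_eq, brk_eq, neg_sub]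

end ChartMultiplication

/-! ### The derivative of the adjoint representation and the Maurer-Cartan equation. -/

section MaurerCartan

set_option linter.unusedSectionVars false

variable {E : Type*} [NormedAddCommGroup E] [NormedSpace ℝ E]
  {G : Type*} [TopologicalSpace G] [ChartedSpace E G] [Group G] [LieGroup 𝓘(ℝ, E) ∞ G]

theorem mdiffAt_adMap (g : G) :
    MDifferentiableAt 𝓘(ℝ, E) 𝓘(ℝ, E →L[ℝ] E) (fun g : G => adMap E g) g :=
  (contMDiff_adMap g).mdifferentiableAt (by simp)

/-- The reason is `(g a g⁻¹) g = g a`, differentiated at `a = 1`. It expresses `Ad` near the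
identity through the multiplication alone, in a form that can be differentiated once more. -/
theorem fderiv_chartMul_adMap {b : E} (hb : b ∈ (extChartAt 𝓘(ℝ, E) (1 : G)).target) (y : E) :
    fderiv ℝ (chartMul (E := E) G) (chartOne E G, b)
        (adMap E ((extChartAt 𝓘(ℝ, E) (1 : G)).symm b) y, 0)
      = fderiv ℝ (chartMul (E := E) G) (b, chartOne E G) (0, y) := by
  set φ := extChartAt 𝓘(ℝ, E) (1 : G) with hφ
  set g := φ.symm b with hg
  have hs : g ∈ φ.source := φ.map_target hb
  have hsymm : ContMDiffAt 𝓘(ℝ, E) 𝓘(ℝ, E) ∞ φ.symm (chartOne E G) :=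
    contMDiffAt_extChartAt_symm chartOne_mem_target
  have hone : φ.symm (chartOne E G) = 1 := chartOne_symm
  have hconj1 : g * φ.symm (chartOne E G) * g⁻¹ = 1 := by rw [hone]; group
  have hconj : ContMDiffAt 𝓘(ℝ, E) 𝓘(ℝ, E) ∞ (fun a => g * φ.symm a * g⁻¹) (chartOne E G) :=
    ContMDiffAt.comp (I' := 𝓘(ℝ, E)) (chartOne E G) ((contMDiff_conj g) _) hsymm
  have hφ1 : ContMDiffAt 𝓘(ℝ, E) 𝓘(ℝ, E) ∞ φ (g * φ.symm (chartOne E G) * g⁻¹) := by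
    rw [hconj1]
    exact contMDiffAt_extChartAt
  have hc : HasFDerivAt (fun a => φ (g * φ.symm a * g⁻¹)) (adMap E g) (chartOne E G) := by
    have hd : DifferentiableAt ℝ (fun a => φ (g * φ.symm a * g⁻¹)) (chartOne E G) :=
      ((hφ1.comp (I' := 𝓘(ℝ, E)) (chartOne E G) hconj).mdifferentiableAt
        (by simp)).differentiableAt
    refine hd.hasFDerivAt.congr_fderiv ?_
    rw [← tderiv_eq_fderiv, tderiv_comp (I' := 𝓘(ℝ, E)) (g := φ)
      (f := fun a => g * φ.symm a * g⁻¹) (hφ1.mdifferentiableAt (by simp))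
      (hconj.mdifferentiableAt (by simp)), hconj1, hφ, tderiv_extChartAt_self,
      tderiv_comp (I' := 𝓘(ℝ, E)) (f := (extChartAt 𝓘(ℝ, E) (1 : G)).symm)
      (g := fun a => g * a * g⁻¹)
      (mdiffAt_conj _ _) (hsymm.mdifferentiableAt (by simp)), chartOne,
      tderiv_extChartAt_symm_self, extChartAt_to_inv]
    rfl
  have hc1 : φ (g * φ.symm (chartOne E G) * g⁻¹) = chartOne E G := by rw [hconj1]; rfl
  have hm1 : HasFDerivAt (chartMul (E := E) G) (fderiv ℝ (chartMul (E := E) G) (chartOne E G, b))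
      (φ (g * φ.symm (chartOne E G) * g⁻¹), b) := by
    rw [hc1]
    refine (contDiffAt_chartMul chartOne_mem_target hb ?_).differentiableAt (by simp)
      |>.hasFDerivAt
    rw [chartOne_symm, one_mul]
    exact hs
  have hm2 : HasFDerivAt (chartMul (E := E) G) (fderiv ℝ (chartMul (E := E) G) (b, chartOne E G))
      (b, chartOne E G) := by
    refine (contDiffAt_chartMul hb chartOne_mem_target ?_).differentiableAt (by simp)
      |>.hasFDerivAt
    rw [chartOne_symm, mul_one]
    exact hs
  have h1 := hm1.comp (f := fun a => (φ (g * φ.symm a * g⁻¹), b)) (chartOne E G)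
    (hc.prodMk (hasFDerivAt_const b (chartOne E G)))
  have h2 := hm2.comp (f := fun a => (b, a)) (chartOne E G) (hasFDerivAt_const_prodMk _ _)
  have h3 : (chartMul (E := E) G ∘ fun a => (φ (g * φ.symm a * g⁻¹), b))
      =ᶠ[𝓝 (chartOne E G)] (chartMul (E := E) G ∘ fun a => (b, a)) := by
    have hev : ∀ᶠ a in 𝓝 (chartOne E G), g * φ.symm a * g⁻¹ ∈ φ.source := by
      refine hconj.continuousAt.eventually_mem ?_
      rw [hconj1]
      exact (isOpen_extChartAt_source (1 : G)).mem_nhds (mem_extChartAt_source 1)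
    filter_upwards [hev] with a ha
    simp only [Function.comp_def, chartMul, ← hφ, φ.left_inv ha, ← hg]
    simp
  have h4 := h1.unique (h2.congr_of_eventuallyEq h3)
  simpa using congrArg (fun L => L y) h4

/-- The derivative of the adjoint representation is the Lie bracket. -/
theorem tderiv_adMap (x y : E) :
    tderiv 𝓘(ℝ, E) 𝓘(ℝ, E →L[ℝ] E) (fun g : G => adMap E g) 1 x y = brk G x y := by
  set φ := extChartAt 𝓘(ℝ, E) (1 : G) with hφ
  have hsymm : ContMDiffAt 𝓘(ℝ, E) 𝓘(ℝ, E) ∞ φ.symm (chartOne E G) :=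
    contMDiffAt_extChartAt_symm chartOne_mem_target
  have hone : φ.symm (chartOne E G) = 1 := chartOne_symm
  have hA : HasFDerivAt (fun b => adMap E (φ.symm b))
      (tderiv 𝓘(ℝ, E) 𝓘(ℝ, E →L[ℝ] E) (fun g : G => adMap E g) 1) (chartOne E G) := by
    have hc : ContMDiffAt 𝓘(ℝ, E) 𝓘(ℝ, E →L[ℝ] E) ∞ (fun b => adMap E (φ.symm b))
        (chartOne E G) :=
      ContMDiffAt.comp (I' := 𝓘(ℝ, E)) (chartOne E G) (contMDiff_adMap _) hsymm
    refine ((hc.mdifferentiableAt (by simp)).differentiableAt).hasFDerivAt.congr_fderiv ?_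
    rw [← tderiv_eq_fderiv, tderiv_comp (I' := 𝓘(ℝ, E)) (g := fun g : G => adMap E g)
      (f := φ.symm) (mdiffAt_adMap _) (hsymm.mdifferentiableAt (by simp)), hone, hφ, chartOne,
      tderiv_extChartAt_symm_self]
    rfl
  have hA1 : adMap E (φ.symm (chartOne E G)) y = y := by rw [hone, adMap_one]
  have h1 := (hasFDerivAt_fderiv_chartMul (E := E) (G := G)).comp
      (f := fun b : E => (chartOne E G, b)) (chartOne E G)
      (hasFDerivAt_const_prodMk (chartOne E G) (chartOne E G))
  have h2 := h1.clm_apply ((hA.clm_apply (hasFDerivAt_const y (chartOne E G))).prodMk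
    (hasFDerivAt_const (0 : E) (chartOne E G)))
  have h3 := (hasFDerivAt_fderiv_chartMul (E := E) (G := G)).comp
      (f := fun b : E => (b, chartOne E G)) (chartOne E G)
      (hasFDerivAt_prodMk_const (chartOne E G) (chartOne E G))
  have h4 := h3.clm_apply (hasFDerivAt_const ((0 : E), y) (chartOne E G))
  -- The identity `fderiv_chartMul_adMap` is differentiated in `b` at the identity. One side gives a
  -- mixed second derivative plus the derivative of `Ad`, the other side the mixed derivative with
  -- the factors exchanged.
  have h5 := h2.unique (h4.congr_of_eventuallyEq (by
    filter_upwards [(isOpen_extChartAt_target (I := 𝓘(ℝ, E)) (1 : G)).mem_nhds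
      chartOne_mem_target] with b hb
    exact fderiv_chartMul_adMap hb y))
  have h6 := congrArg (fun L => L x) h5
  simp [hA1, chartMul₂_symm, fderiv_chartMul_one_left] at h6
  rw [brk_eq, ← h6.trans (by rfl : _ = chartMul₂ G x y)]
  simp

variable {V : Type*} [NormedAddCommGroup V] [NormedSpace ℝ V]

/-- The pull-back of the left Maurer-Cartan form under a map into the group. -/
def mcForm (s : V → G) (v : V) : V →L[ℝ] E :=
  (leftTInv E (s v)).comp (tderiv 𝓘(ℝ, V) 𝓘(ℝ, E) s v)

theorem eventually_mdifferentiableAt {E₁ E₂ M N : Type*} [NormedAddCommGroup E₁]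
    [NormedSpace ℝ E₁] [NormedAddCommGroup E₂] [NormedSpace ℝ E₂] [TopologicalSpace M]
    [ChartedSpace E₁ M] [TopologicalSpace N] [ChartedSpace E₂ N] [IsManifold 𝓘(ℝ, E₁) ∞ M]
    [IsManifold 𝓘(ℝ, E₂) ∞ N] {f : M → N} {x : M} (hf : ContMDiffAt 𝓘(ℝ, E₁) 𝓘(ℝ, E₂) ∞ f x) :
    ∀ᶠ y in 𝓝 x, MDifferentiableAt 𝓘(ℝ, E₁) 𝓘(ℝ, E₂) f y := by
  have h1 : ContMDiffAt 𝓘(ℝ, E₁) 𝓘(ℝ, E₂) 1 f x := hf.of_le (by simp)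
  filter_upwards [(contMDiffAt_iff_contMDiffAt_nhds (by simp)).1 h1] with y hy
  exact hy.mdifferentiableAt (by simp)

/-- The form at `v` is the derivative at `w = 0` of `w ↦ s(v)⁻¹ s(v + w)`. All these maps send `0`
to `1`, so `contMDiffAt_tderiv_of_const` applies. -/
theorem contDiffAt_mcForm {s : V → G} {v₀ : V} (hs : ContMDiffAt 𝓘(ℝ, V) 𝓘(ℝ, E) ∞ s v₀) :
    ContDiffAt ℝ ∞ (mcForm (E := E) s) v₀ := by
  rw [← contMDiffAt_iff_contDiffAt]
  have h := contMDiffAt_tderiv_of_const (E := V) (M := V) (E' := E) (M' := G) (E₀ := V) (N := V)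
    (n₀ := v₀) (f := fun v w => (s v)⁻¹ * s (v + w)) (x₀ := 0) (y₀ := 1) (by
      have h1 : ContMDiffAt (𝓘(ℝ, V).prod 𝓘(ℝ, V)) 𝓘(ℝ, E) ∞ (fun q : V × V => s q.1) (v₀, 0) :=
        ContMDiffAt.comp (I' := 𝓘(ℝ, V)) _ (f := Prod.fst) hs contMDiffAt_fst
      have h2 : ContMDiffAt (𝓘(ℝ, V).prod 𝓘(ℝ, V)) 𝓘(ℝ, E) ∞
          (fun q : V × V => s (q.1 + q.2)) (v₀, 0) := by
        refine ContMDiffAt.comp (I' := 𝓘(ℝ, V)) _ (f := fun q : V × V => q.1 + q.2) ?_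
          (contMDiffAt_fst.add contMDiffAt_snd)
        simpa using hs
      exact h1.inv.mul h2) (by simp)
  refine h.congr_of_eventuallyEq ?_
  filter_upwards [eventually_mdifferentiableAt hs] with v hv
  have hadd : HasFDerivAt (fun w => v + w) (ContinuousLinearMap.id ℝ V) 0 :=
    (hasFDerivAt_id (0 : V)).const_add v
  have e1 : tderiv 𝓘(ℝ, V) 𝓘(ℝ, E) (fun w => s (v + w)) 0 = tderiv 𝓘(ℝ, V) 𝓘(ℝ, E) s v := by
    rw [tderiv_comp (I' := 𝓘(ℝ, V)) (f := fun w => v + w) (g := s) (by simpa using hv)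
      hadd.differentiableAt.mdifferentiableAt, tderiv_eq_fderiv, hadd.fderiv]
    simp
  rw [tderiv_comp (I' := 𝓘(ℝ, E)) (f := fun w => s (v + w)) (g := fun b => (s v)⁻¹ * b)
    (mdiffAt_mul_left _ _) (MDifferentiableAt.comp (I' := 𝓘(ℝ, V)) (0 : V)
      (f := fun w => v + w) (by simpa using hv) hadd.differentiableAt.mdifferentiableAt), e1]
  simp only [add_zero]
  rfl

/-- The Maurer-Cartan equation. -/
theorem fderiv_mcForm_sub {s : V → G} {v₀ : V} (hs : ContMDiffAt 𝓘(ℝ, V) 𝓘(ℝ, E) ∞ s v₀)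
    (k l : V) :
    fderiv ℝ (mcForm (E := E) s) v₀ k l - fderiv ℝ (mcForm (E := E) s) v₀ l k
      = -brk G (mcForm (E := E) s v₀ k) (mcForm (E := E) s v₀ l) := by
  set φ := extChartAt 𝓘(ℝ, E) (1 : G) with hφ
  -- The Maurer-Cartan form is left invariant, so the point `s v₀` may be moved to the identity,
  -- where the chart is centred.
  set f : V → G := fun v => (s v₀)⁻¹ * s v with hf
  have hf1 : f v₀ = 1 := by simp [hf]
  have hfs : ContMDiffAt 𝓘(ℝ, V) 𝓘(ℝ, E) ∞ f v₀ := contMDiffAt_const.mul hs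
  have hφf : ContMDiffAt 𝓘(ℝ, V) 𝓘(ℝ, E) ∞ (fun v => φ (f v)) v₀ :=
    ContMDiffAt.comp (I' := 𝓘(ℝ, E)) v₀ (by rw [hf1]; exact contMDiffAt_extChartAt) hfs
  have hφf' : ContDiffAt ℝ ∞ (fun v => φ (f v)) v₀ := contMDiffAt_iff_contDiffAt.1 hφf
  have hθf : ∀ᶠ v in 𝓝 v₀, ∀ k, leftT E (f v) (mcForm (E := E) s v k)
      = tderiv 𝓘(ℝ, V) 𝓘(ℝ, E) f v k := by
    filter_upwards [eventually_mdifferentiableAt hs] with v hv k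
    have h1 : tderiv 𝓘(ℝ, V) 𝓘(ℝ, E) f v k
        = tderiv 𝓘(ℝ, E) 𝓘(ℝ, E) (fun b => (s v₀)⁻¹ * b) (s v)
          (tderiv 𝓘(ℝ, V) 𝓘(ℝ, E) s v k) :=
      tderiv_comp_apply (mdiffAt_mul_left _ _) hv k
    rw [h1, mcForm, ContinuousLinearMap.comp_apply, ← leftTInv_mul (s v₀)⁻¹ (s v),
      leftT_leftTInv]
  have hsrc : ∀ᶠ v in 𝓝 v₀, f v ∈ φ.source := by
    refine hfs.continuousAt.eventually_mem ?_
    rw [hf1]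
    exact (isOpen_extChartAt_source (1 : G)).mem_nhds (mem_extChartAt_source 1)
  have hid : ∀ᶠ v in 𝓝 v₀, ∀ k, fderiv ℝ (chartMul (E := E) G) (φ (f v), chartOne E G)
      (0, mcForm (E := E) s v k) = fderiv ℝ (fun v => φ (f v)) v k := by
    filter_upwards [hθf, hsrc, eventually_mdifferentiableAt hfs] with v hv hv' hv'' k
    rw [fderiv_chartMul_right (φ.map_source hv'), φ.left_inv hv', hv, ← tderiv_eq_fderiv]
    exact (tderiv_comp_apply ((contMDiffAt_extChartAt_of_mem hv').mdifferentiableAt (by simp))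
      hv'' k).symm
  have hfe : φ (f v₀) = chartOne E G := by rw [hf1]; rfl
  have hθ : HasFDerivAt (mcForm (E := E) s) (fderiv ℝ (mcForm (E := E) s) v₀) v₀ :=
    ((contDiffAt_mcForm hs).differentiableAt (by simp)).hasFDerivAt
  have hφd : HasFDerivAt (fun v => φ (f v)) (fderiv ℝ (fun v => φ (f v)) v₀) v₀ :=
    (hφf'.differentiableAt (by simp)).hasFDerivAt
  have hφ2 : HasFDerivAt (fderiv ℝ (fun v => φ (f v)))
      (fderiv ℝ (fderiv ℝ (fun v => φ (f v))) v₀) v₀ :=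
    ((hφf'.fderiv_right (m := 1) (by
      rw [one_add_one_eq_two]; exact two_le_infty)).differentiableAt (by simp)).hasFDerivAt
  have hm : HasFDerivAt (fderiv ℝ (chartMul (E := E) G))
      (fderiv ℝ (fderiv ℝ (chartMul (E := E) G)) (chartOne E G, chartOne E G))
      (φ (f v₀), chartOne E G) := by
    rw [hfe]
    exact hasFDerivAt_fderiv_chartMul
  have h0 : ∀ k, fderiv ℝ (fun v => φ (f v)) v₀ k = mcForm (E := E) s v₀ k := by
    intro k
    rw [← hid.self_of_nhds k, hfe, fderiv_chartMul_one_right]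
  -- This is `hid` differentiated at `v₀` in the direction `l`. The right-hand side is symmetric in
  -- `k` and `l`; equating the two versions gives the Maurer-Cartan equation.
  have key : ∀ k l, chartMul₂ G (mcForm (E := E) s v₀ l) (mcForm (E := E) s v₀ k)
      + fderiv ℝ (mcForm (E := E) s) v₀ l k
      = fderiv ℝ (fderiv ℝ (fun v => φ (f v))) v₀ l k := by
    intro k l
    have h1 := hm.comp (f := fun v => (φ (f v), chartOne E G)) v₀
      (hφd.prodMk (hasFDerivAt_const (chartOne E G) v₀))
    have h2 := h1.clm_apply ((hasFDerivAt_const (0 : E) v₀).prodMk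
      (hθ.clm_apply (hasFDerivAt_const k v₀)))
    have h3 := hφ2.clm_apply (hasFDerivAt_const k v₀)
    have h4 := h2.unique (h3.congr_of_eventuallyEq (hid.mono fun v hv => hv k))
    have h5 := congrArg (fun L => L l) h4
    simp [h0, hfe, fderiv_chartMul_one_right] at h5
    rw [← h5, add_comm]
    rfl
  have hsym := (hφf'.isSymmSndFDerivAt (by simpa using two_le_infty)).eq k l
  have e1 := key l k
  have e2 := key k l
  rw [hsym] at e1
  rw [brk_eq]
  have e3 := e1.trans e2.symm
  rw [neg_sub, sub_eq_sub_iff_add_eq_add, add_comm, e3, add_comm, add_comm]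

end MaurerCartan

/-- If a map from a manifold becomes smooth after composition with a linear embedding of Banach
spaces, then it is smooth. -/
theorem contMDiff_of_comp_antilipschitz {E : Type*} [NormedAddCommGroup E] [NormedSpace ℝ E]
    {M : Type*} [TopologicalSpace M] [ChartedSpace E M] [IsManifold 𝓘(ℝ, E) ∞ M]
    {X Y : Type*} [NormedAddCommGroup X] [NormedSpace ℝ X] [NormedAddCommGroup Y]
    [NormedSpace ℝ Y] [CompleteSpace Y] (i : Y →L[ℝ] X) {C : ℝ} (hi : ∀ y, ‖y‖ ≤ C * ‖i y‖)
    {f : M → Y} (hf : ContMDiff 𝓘(ℝ, E) 𝓘(ℝ, X) ∞ (fun x => i (f x))) :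
    ContMDiff 𝓘(ℝ, E) 𝓘(ℝ, Y) ∞ f := by
  intro x₀
  set φ := extChartAt 𝓘(ℝ, E) x₀ with hφ
  have h1 : ContDiffOn ℝ ∞ (fun y => i (f (φ.symm y))) φ.target := by
    rw [← contMDiffOn_iff_contDiffOn]
    exact hf.comp_contMDiffOn (contMDiffOn_extChartAt_symm x₀)
  have h2 : ContDiffOn ℝ ∞ (fun y => f (φ.symm y)) φ.target :=
    contDiffOn_of_comp_antilipschitz (isOpen_extChartAt_target x₀) i hi h1
  have h3 : ContMDiffAt 𝓘(ℝ, E) 𝓘(ℝ, Y) ∞ (fun x => f (φ.symm (φ x))) x₀ :=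
    ContMDiffAt.comp (I' := 𝓘(ℝ, E)) x₀ (f := φ) (g := fun y => f (φ.symm y))
      (contMDiffAt_iff_contDiffAt.2
        (h2.contDiffAt (extChartAt_target_mem_nhds x₀))) contMDiffAt_extChartAt
  refine h3.congr_of_eventuallyEq ?_
  filter_upwards [(isOpen_extChartAt_source (I := 𝓘(ℝ, E)) x₀).mem_nhds
    (mem_extChartAt_source x₀)] with z hz
  rw [φ.left_inv hz]

/-! ### The coadjoint representation on the predual. -/

namespace InvariantPredual

set_option linter.unusedSectionVars false

variable {E : Type*} [NormedAddCommGroup E] [NormedSpace ℝ E]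
  {G : Type*} [TopologicalSpace G] [ChartedSpace E G] [Group G]
  {F : Type*} [NormedAddCommGroup F] [NormedSpace ℝ F] (Q : InvariantPredual E G F)

/-- The isomorphism of the Lie algebra with the dual of its predual, on the model space. -/
def isoE : E ≃L[ℝ] (F →L[ℝ] ℝ) := Q.iso

theorem ext_isoE {ρ σ : F} (h : ∀ x : E, Q.isoE x ρ = Q.isoE x σ) : ρ = σ := Q.ext h

theorem isoE_coAd (g : G) (ρ : F) (x : E) : Q.isoE x (Q.coAd g ρ) = Q.isoE (adMap E g x) ρ :=
  Q.pair_coAd g ρ x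

/-- By Hahn-Banach the norm on `F` is determined by its functionals, and each functional is the
pairing with a Lie algebra element of comparable norm. -/
theorem norm_le_of_isoE {ρ : F} {C : ℝ} (hC : 0 ≤ C) (h : ∀ x : E, ‖Q.isoE x ρ‖ ≤ C * ‖x‖) :
    ‖ρ‖ ≤ C * ‖(Q.isoE.symm : (F →L[ℝ] ℝ) →L[ℝ] E)‖ := by
  refine NormedSpace.norm_le_dual_bound ℝ ρ (by positivity) fun f => ?_
  have h1 := h (Q.isoE.symm f)
  rw [ContinuousLinearEquiv.apply_symm_apply] at h1
  refine h1.trans ?_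
  rw [mul_assoc]
  exact mul_le_mul_of_nonneg_left
    ((Q.isoE.symm : (F →L[ℝ] ℝ) →L[ℝ] E).le_opNorm f) hC

/-- `Ad*_g` as a continuous linear operator. -/
def coAdL (g : G) : F →L[ℝ] F :=
  LinearMap.mkContinuous
    { toFun := Q.coAd g
      map_add' := Q.coAd_add g
      map_smul' := fun c ρ => Q.ext_isoE fun x => by simp [isoE_coAd] }
    (‖(Q.isoE : E →L[ℝ] (F →L[ℝ] ℝ))‖ * ‖adMap E g‖
      * ‖(Q.isoE.symm : (F →L[ℝ] ℝ) →L[ℝ] E)‖)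
    (fun ρ => by
      have h := Q.norm_le_of_isoE (ρ := Q.coAd g ρ)
        (C := ‖(Q.isoE : E →L[ℝ] (F →L[ℝ] ℝ))‖ * ‖adMap E g‖ * ‖ρ‖) (by positivity) (fun x => by
          rw [isoE_coAd]
          calc ‖Q.isoE (adMap E g x) ρ‖ ≤ ‖Q.isoE (adMap E g x)‖ * ‖ρ‖ :=
                ContinuousLinearMap.le_opNorm _ _
            _ ≤ (‖(Q.isoE : E →L[ℝ] (F →L[ℝ] ℝ))‖ * (‖adMap E g‖ * ‖x‖)) * ‖ρ‖ := by
                gcongr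
                refine ((Q.isoE : E →L[ℝ] (F →L[ℝ] ℝ)).le_opNorm _).trans ?_
                gcongr
                exact (adMap E g).le_opNorm x
            _ = _ := by ring)
      refine h.trans (le_of_eq ?_)
      ring)

/-- The embedding of the operators on the predual into the operators on the dual. -/
def transposeL : (F →L[ℝ] F) →L[ℝ] (E →L[ℝ] (F →L[ℝ] ℝ)) :=
  ((ContinuousLinearMap.compL ℝ E (F →L[ℝ] ℝ) (F →L[ℝ] ℝ)).flip
      (Q.isoE : E →L[ℝ] (F →L[ℝ] ℝ))).comp
    (ContinuousLinearMap.compL ℝ F F ℝ).flip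

theorem transposeL_apply (T : F →L[ℝ] F) (x : E) (ρ : F) :
    Q.transposeL T x ρ = Q.isoE x (T ρ) := rfl

/-- This lower bound makes transposition a closed embedding, as `contMDiff_of_comp_antilipschitz`
requires. -/
theorem norm_le_transposeL (T : F →L[ℝ] F) :
    ‖T‖ ≤ ‖(Q.isoE.symm : (F →L[ℝ] ℝ) →L[ℝ] E)‖ * ‖Q.transposeL T‖ := by
  refine T.opNorm_le_bound (by positivity) fun ρ => ?_
  have h := Q.norm_le_of_isoE (ρ := T ρ) (C := ‖Q.transposeL T‖ * ‖ρ‖) (by positivity) (fun x => by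
    rw [← transposeL_apply]
    calc ‖Q.transposeL T x ρ‖ ≤ ‖Q.transposeL T x‖ * ‖ρ‖ := ContinuousLinearMap.le_opNorm _ _
      _ ≤ (‖Q.transposeL T‖ * ‖x‖) * ‖ρ‖ := by gcongr; exact ContinuousLinearMap.le_opNorm _ _
      _ = _ := by ring)
  exact h.trans (le_of_eq (by ring))

variable [CompleteSpace F] [LieGroup 𝓘(ℝ, E) ∞ G]

/-- The coadjoint representation on the predual is smooth for the operator norm. -/
theorem contMDiff_coAdL : ContMDiff 𝓘(ℝ, E) 𝓘(ℝ, F →L[ℝ] F) ∞ (fun g : G => Q.coAdL g) := by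
  refine contMDiff_of_comp_antilipschitz (X := E →L[ℝ] (F →L[ℝ] ℝ)) (Y := F →L[ℝ] F)
    Q.transposeL Q.norm_le_transposeL ?_
  -- After transposition only `Ad_g` remains, whose smoothness is already known.
  have h : (fun g : G => Q.transposeL (Q.coAdL g))
      = fun g : G => (Q.isoE : E →L[ℝ] (F →L[ℝ] ℝ)).comp (adMap E g) := by
    funext g
    ext x ρ
    exact Q.isoE_coAd g ρ x
  rw [h]
  exact contMDiff_const.clm_comp contMDiff_adMap

theorem mdiffAt_coAdL (g : G) :
    MDifferentiableAt 𝓘(ℝ, E) 𝓘(ℝ, F →L[ℝ] F) (fun g : G => Q.coAdL g) g :=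
  (Q.contMDiff_coAdL g).mdifferentiableAt (by simp)

/-- `ad*_x` as a continuous linear operator, depending linearly on `x`. -/
def coadL : E →L[ℝ] (F →L[ℝ] F) :=
  tderiv 𝓘(ℝ, E) 𝓘(ℝ, F →L[ℝ] F) (fun g : G => Q.coAdL g) 1

/-- The derivative at `g = 1` of `⟨Ad*_g ρ, y⟩ = ⟨ρ, Ad_g y⟩`. In particular `y ↦ ⟨ρ, [x, y]⟩` is
represented by an element of the predual, although invariance is assumed for the group only. -/
theorem isoE_coadL (x : E) (ρ : F) (y : E) :
    Q.isoE y (Q.coadL x ρ) = Q.isoE (brk G x y) ρ := by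
  have h1 := tderiv_clm_comp (I := 𝓘(ℝ, E)) (E' := F →L[ℝ] F)
    (E'' := E →L[ℝ] (F →L[ℝ] ℝ)) Q.transposeL (f := fun g : G => Q.coAdL g)
    (Q.mdiffAt_coAdL 1)
  have h2 := tderiv_clm_comp (I := 𝓘(ℝ, E)) (E' := E →L[ℝ] E)
    (E'' := E →L[ℝ] (F →L[ℝ] ℝ))
    (ContinuousLinearMap.compL ℝ E E (F →L[ℝ] ℝ) (Q.isoE : E →L[ℝ] (F →L[ℝ] ℝ)))
    (f := fun g : G => adMap E g) (mdiffAt_adMap 1)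
  have h : (fun g : G => Q.transposeL (Q.coAdL g))
      = fun g : G => ContinuousLinearMap.compL ℝ E E (F →L[ℝ] ℝ)
        (Q.isoE : E →L[ℝ] (F →L[ℝ] ℝ)) (adMap E g) := by
    funext g
    ext x ρ
    exact Q.isoE_coAd g ρ x
  rw [h, h2] at h1
  have h3 := congrArg (fun L => L x y ρ) h1
  have h4 : Q.isoE (tderiv 𝓘(ℝ, E) 𝓘(ℝ, E →L[ℝ] E) (fun g : G => adMap E g) 1 x y) ρ
      = Q.isoE y (Q.coadL x ρ) := h3
  rw [← h4, tderiv_adMap]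

/-- `coad` is a choice by `epsilon`, and `coadL` provides the element that makes the choice
meaningful. -/
theorem pair_coad (x : LieAlg E G) (ρ : F) (y : LieAlg E G) :
    Q.pair (Q.coad x ρ) y = Q.pair ρ ⁅x, y⁆ :=
  Classical.epsilon_spec (p := fun σ : F => ∀ y : LieAlg E G, Q.pair σ y = Q.pair ρ ⁅x, y⁆)
    ⟨Q.coadL x ρ, fun y => Q.isoE_coadL x ρ y⟩ y

theorem coad_eq_coadL (x : E) (ρ : F) : Q.coad (x : LieAlg E G) ρ = Q.coadL x ρ :=
  Q.ext fun y => (Q.pair_coad x ρ y).trans (Q.isoE_coadL x ρ y).symm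

end InvariantPredual

section AdBracket

variable {E : Type*} [NormedAddCommGroup E] [NormedSpace ℝ E]
  {G : Type*} [TopologicalSpace G] [ChartedSpace E G] [Group G] [LieGroup 𝓘(ℝ, E) ∞ G]

variable (E G) in
/-- The Lie bracket as a continuous bilinear map. -/
def brkL : E →L[ℝ] E →L[ℝ] E := tderiv 𝓘(ℝ, E) 𝓘(ℝ, E →L[ℝ] E) (fun g : G => adMap E g) 1

theorem brkL_apply (x y : E) : brkL E G x y = brk G x y := tderiv_adMap x y

/-- The adjoint action preserves the Lie bracket. -/
theorem adMap_brk (g : G) (x y : E) :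
    adMap E g (brk G x y) = brk G (adMap E g x) (adMap E g y) := by
  have h1 := tderiv_comp (I := 𝓘(ℝ, E)) (I' := 𝓘(ℝ, E)) (I'' := 𝓘(ℝ, E →L[ℝ] E)) (x := (1 : G))
    (f := fun a : G => g * a * g⁻¹) (g := fun g : G => adMap E g) (mdiffAt_adMap _)
    (mdiffAt_conj _ _)
  -- The homomorphism property of `Ad` along the conjugation by `g`; its derivative at `a = 1` is
  -- the claim, by `tderiv_adMap`.
  have h : (fun a : G => adMap E (g * a * g⁻¹)) = fun a : G =>
      (ContinuousLinearMap.compL ℝ E E E (adMap E g)).comp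
        ((ContinuousLinearMap.compL ℝ E E E).flip (adMap E g⁻¹)) (adMap E a) := by
    funext a
    ext x
    simp [adMap_mul]
  rw [h, tderiv_clm_comp (E' := E →L[ℝ] E) (E'' := E →L[ℝ] E) _ (mdiffAt_adMap _)] at h1
  have h2 := congrArg (fun L => L x (adMap E g y)) h1
  have h3 : g * 1 * g⁻¹ = 1 := by group
  simp only [h3] at h2
  have h4 : adMap E g (brkL E G x (adMap E g⁻¹ (adMap E g y)))
      = brkL E G (adMap E g x) (adMap E g y) := h2
  rwa [adMap_inv_adMap, brkL_apply, brkL_apply] at h4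

end AdBracket

/-- The derivative of an immersion is injective. -/
theorem tderiv_injective_of_isImmersionAt {E : Type*} [NormedAddCommGroup E] [NormedSpace ℝ E]
    {M : Type*} [TopologicalSpace M] [ChartedSpace E M] [IsManifold 𝓘(ℝ, E) ∞ M]
    {E' : Type*} [NormedAddCommGroup E'] [NormedSpace ℝ E']
    {M' : Type*} [TopologicalSpace M'] [ChartedSpace E' M'] [IsManifold 𝓘(ℝ, E') ∞ M']
    {f : M → M'} {x : M} (h : Manifold.IsImmersionAt 𝓘(ℝ, E) 𝓘(ℝ, E') ∞ f x) :
    Function.Injective (tderiv 𝓘(ℝ, E) 𝓘(ℝ, E') f x) := by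
  have hd := (contMDiffAt_of_mem_maximalAtlas h.domChart_mem_maximalAtlas
    h.mem_domChart_source).mdifferentiableAt (n := ∞) (by simp)
  have hds := (contMDiffAt_symm_of_mem_maximalAtlas h.domChart_mem_maximalAtlas
    (h.domChart.map_source h.mem_domChart_source)).mdifferentiableAt (n := ∞) (by simp)
  have hc := (contMDiffAt_of_mem_maximalAtlas h.codChart_mem_maximalAtlas
    h.mem_codChart_source).mdifferentiableAt (n := ∞) (by simp)
  have hf := h.contMDiffAt.mdifferentiableAt (n := ∞) (by simp)
  rw [injective_iff_map_eq_zero]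
  intro v hv
  have h1 := tderiv_comp_apply (I'' := 𝓘(ℝ, E')) hc hf v
  rw [hv, map_zero] at h1
  -- In charts adapted to the immersion the map is this injective linear operator.
  let L : E →L[ℝ] E' :=
    (h.equiv : E × h.complement →L[ℝ] E').comp (ContinuousLinearMap.inl ℝ E h.complement)
  have h2 : (fun y => h.codChart (f y)) =ᶠ[𝓝 x] fun y => L (h.domChart y) := by
    filter_upwards [h.domChart.open_source.mem_nhds h.mem_domChart_source] with y hy
    have h3 := h.writtenInCharts
      (show h.domChart y ∈ (h.domChart.extend 𝓘(ℝ, E)).target by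
        simpa using h.domChart.map_source hy)
    simpa [L, h.domChart.left_inv hy] using h3
  rw [tderiv_congr h2, tderiv_clm_comp L hd] at h1
  have h4 : tderiv 𝓘(ℝ, E) 𝓘(ℝ, E) h.domChart x v = 0 := by
    simpa [L] using h1
  have h5 := tderiv_comp_apply (I'' := 𝓘(ℝ, E)) hds hd v
  rw [h4, map_zero, tderiv_congr (g := fun y => y), tderiv_id] at h5
  · exact h5
  · filter_upwards [h.domChart.open_source.mem_nhds h.mem_domChart_source] with y hy
    exact h.domChart.left_inv hy

/-! ### The splitting of the Lie algebra that comes from the splitting of the predual. -/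

namespace InvariantSplitting

set_option linter.unusedSectionVars false

variable {E : Type*} [NormedAddCommGroup E] [NormedSpace ℝ E]
  {G : Type*} [TopologicalSpace G] [ChartedSpace E G] [Group G]
  {F : Type*} [NormedAddCommGroup F] [NormedSpace ℝ F] [CompleteSpace F]
  {Q : InvariantPredual E G F} {H : Subgroup G}
  {EH : Type*} [NormedAddCommGroup EH] [NormedSpace ℝ EH] [ChartedSpace EH H]
  (S : InvariantSplitting Q H EH)

/-- The inclusion of the Lie algebras, on the model spaces. -/
def embE (_S : InvariantSplitting Q H EH) : EH →L[ℝ] E :=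
  tderiv 𝓘(ℝ, EH) 𝓘(ℝ, E) (fun h : H => (h : G)) 1

theorem isTopCompl : S.sub.IsTopCompl S.perp :=
  Submodule.IsCompl.isTopCompl_of_isClosed S.isCompl S.isClosed_sub S.isClosed_perp

/-- The projection onto `𝔥_*` as a continuous linear map. -/
def subProj : F →L[ℝ] S.sub := S.sub.projectionOntoL S.perp S.isTopCompl

/-- The projection onto `𝔥_*^⊥` as a continuous linear map. -/
def perpProj : F →L[ℝ] S.perp := S.perp.projectionOntoL S.sub S.isTopCompl.symm

theorem proj_eq_subProj (ρ : F) : S.proj ρ = S.subProj ρ := rfl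

theorem subProj_sub (ρ : S.sub) : S.subProj ρ = ρ := by simp [subProj]

theorem subProj_perp (ρ : S.perp) : S.subProj ρ = 0 := by simp [subProj]

theorem perpProj_perp (ρ : S.perp) : S.perpProj ρ = ρ := by simp [perpProj]

theorem perpProj_sub (ρ : S.sub) : S.perpProj ρ = 0 := by simp [perpProj]

theorem subProj_add_perpProj (ρ : F) : (S.subProj ρ : F) + S.perpProj ρ = ρ :=
  Submodule.projection_add_projection_eq_self S.isCompl ρ

theorem mem_sub_iff (ρ : F) : ρ ∈ S.sub ↔ S.perpProj ρ = 0 := by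
  simp [perpProj]

theorem mem_perp_iff (ρ : F) : ρ ∈ S.perp ↔ S.subProj ρ = 0 := by
  simp [subProj]

theorem isoE_embE_perp (z : EH) {ρ : F} (hρ : ρ ∈ S.perp) : Q.isoE (S.embE z) ρ = 0 :=
  (S.annihilator_perp (S.embE z : E)).2 ⟨z, rfl⟩ ρ hρ

theorem exists_embE_eq {x : E} (hx : ∀ ρ ∈ S.perp, Q.isoE x ρ = 0) : ∃ z : EH, S.embE z = x :=
  (S.annihilator_perp (x : E)).1 hx

/-- The inclusion of `𝔥^⊥`, realized as the dual of `𝔥_*^⊥`. -/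
def perpE : (S.perp →L[ℝ] ℝ) →L[ℝ] E :=
  (Q.isoE.symm : (F →L[ℝ] ℝ) →L[ℝ] E).comp
    ((ContinuousLinearMap.compL ℝ F S.perp ℝ).flip S.perpProj)

theorem isoE_perpE (k : S.perp →L[ℝ] ℝ) (ρ : F) : Q.isoE (S.perpE k) ρ = k (S.perpProj ρ) := by
  simp [perpE]

theorem memPerp_perpE (k : S.perp →L[ℝ] ℝ) : S.MemPerp (S.perpE k : E) := by
  intro ρ hρ
  have h := S.isoE_perpE k ρ
  rw [(S.mem_sub_iff ρ).1 hρ, map_zero] at h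
  exact h

/-- The restriction of elements of the Lie algebra to `𝔥_*^⊥`. -/
def restrPerp : E →L[ℝ] (S.perp →L[ℝ] ℝ) :=
  ((ContinuousLinearMap.compL ℝ S.perp F ℝ).flip S.perp.subtypeL).comp
    (Q.isoE : E →L[ℝ] (F →L[ℝ] ℝ))

theorem restrPerp_apply (x : E) (ρ : S.perp) : S.restrPerp x ρ = Q.isoE x ρ := rfl

theorem restrPerp_perpE (k : S.perp →L[ℝ] ℝ) : S.restrPerp (S.perpE k) = k := by
  ext ρ
  rw [restrPerp_apply, isoE_perpE, perpProj_perp]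

theorem restrPerp_embE (z : EH) : S.restrPerp (S.embE z) = 0 := by
  ext ρ
  exact S.isoE_embE_perp z ρ.2

/-- Subtracting from `x` the extension by zero of its restriction to `𝔥_*^⊥` leaves an element that
annihilates `𝔥_*^⊥`, and such an element belongs to `𝔥`. -/
theorem exists_decomp (x : E) : ∃ z : EH, S.embE z + S.perpE (S.restrPerp x) = x := by
  obtain ⟨z, hz⟩ := S.exists_embE_eq (x := x - S.perpE (S.restrPerp x)) (fun ρ hρ => by
    have h := S.isoE_perpE (S.restrPerp x) ρ
    have h2 : S.perpProj ρ = ⟨ρ, hρ⟩ := S.perpProj_perp ⟨ρ, hρ⟩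
    rw [map_sub, sub_apply, h, h2, restrPerp_apply, sub_self])
  exact ⟨z, by rw [hz, sub_add_cancel]⟩

/-- Restriction to `𝔥_*^⊥` kills `𝔥` and recovers the component in the dual of `𝔥_*^⊥`; the other
component is then controlled by the injectivity of the inclusion. -/
theorem ker_coprod_perpE_embE (hinj : Function.Injective S.embE) :
    (S.perpE.coprod S.embE).ker = ⊥ := by
  refine LinearMap.ker_eq_bot'.2 ?_
  rintro ⟨k, z⟩ h
  have h' : S.perpE k + S.embE z = 0 := h
  have h1 := congrArg S.restrPerp h'
  rw [map_add, restrPerp_perpE, restrPerp_embE, add_zero, map_zero] at h1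
  subst h1
  rw [map_zero, zero_add] at h'
  rw [hinj (h'.trans (map_zero _).symm)]
  rfl

theorem range_coprod_perpE_embE : (S.perpE.coprod S.embE).range = ⊤ := by
  refine LinearMap.range_eq_top.2 fun x => ?_
  obtain ⟨z, hz⟩ := S.exists_decomp x
  exact ⟨(S.restrPerp x, z), (add_comm _ _).trans hz⟩

/-- The splitting `𝔤 = 𝔥^⊥ ⊕ 𝔥`. -/
def splitEquiv [CompleteSpace E] [CompleteSpace EH] (hinj : Function.Injective S.embE) :
    ((S.perp →L[ℝ] ℝ) × EH) ≃L[ℝ] E :=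
  ContinuousLinearEquiv.ofBijective (𝕜 := ℝ) (𝕜' := ℝ) (E := (S.perp →L[ℝ] ℝ) × EH) (F := E)
    (S.perpE.coprod S.embE) (S.ker_coprod_perpE_embE hinj)
    S.range_coprod_perpE_embE

theorem splitEquiv_apply [CompleteSpace E] [CompleteSpace EH]
    (hinj : Function.Injective S.embE) (k : S.perp →L[ℝ] ℝ) (z : EH) :
    S.splitEquiv hinj (k, z) = S.perpE k + S.embE z := by
  rw [splitEquiv, ContinuousLinearEquiv.coeFn_ofBijective]
  rfl

/-- `Ad*_h` on `𝔥_*^⊥` as a continuous linear operator. -/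
def coAdPerpL (h : H) : S.perp →L[ℝ] S.perp :=
  S.perpProj.comp ((Q.coAdL (h : G)).comp S.perp.subtypeL)

theorem coAdPerpL_apply (h : H) (ρ : S.perp) : S.coAdPerpL h ρ = S.coAdPerp h ρ :=
  S.perpProj_perp (S.coAdPerp h ρ)

variable [LieGroup 𝓘(ℝ, E) ∞ G] [LieGroup 𝓘(ℝ, EH) ∞ H]

/-- Along `H` the element `Ad*_h ρ` stays in `𝔥_*^⊥`, so its component in `𝔥_*` is constantly zero.
The derivative of this component at `h = 1` therefore vanishes. -/
theorem coadL_mem_perp (hι : ContMDiff 𝓘(ℝ, EH) 𝓘(ℝ, E) ∞ (fun h : H => (h : G)))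
    (z : EH) {ρ : F} (hρ : ρ ∈ S.perp) : Q.coadL (S.embE z) ρ ∈ S.perp := by
  let L : (F →L[ℝ] F) →L[ℝ] S.sub :=
    (ContinuousLinearMap.apply ℝ S.sub ρ).comp (ContinuousLinearMap.compL ℝ F F S.sub S.subProj)
  have hd : MDifferentiableAt 𝓘(ℝ, EH) 𝓘(ℝ, E) (fun h : H => (h : G)) 1 :=
    (hι 1).mdifferentiableAt (by simp)
  have h1 := tderiv_comp_apply (I := 𝓘(ℝ, EH)) (I' := 𝓘(ℝ, E)) (I'' := 𝓘(ℝ, S.sub))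
    (g := fun g : G => L (Q.coAdL g)) (f := fun h : H => (h : G)) (x := 1)
    (MDifferentiableAt.comp (I' := 𝓘(ℝ, F →L[ℝ] F)) _ L.mdifferentiableAt (Q.mdiffAt_coAdL _)) hd z
  have h2 : (fun h : H => L (Q.coAdL (h : G))) = fun _ => 0 := by
    funext h
    exact (S.mem_perp_iff _).1 (S.coAd_mem_perp h ρ hρ)
  rw [h2, tderiv_const, tderiv_clm_comp (E' := F →L[ℝ] F) L (Q.mdiffAt_coAdL _)] at h1
  exact (S.mem_perp_iff _).2 h1.symm

theorem coadL_mem_sub (hι : ContMDiff 𝓘(ℝ, EH) 𝓘(ℝ, E) ∞ (fun h : H => (h : G)))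
    (z : EH) {ρ : F} (hρ : ρ ∈ S.sub) : Q.coadL (S.embE z) ρ ∈ S.sub := by
  let L : (F →L[ℝ] F) →L[ℝ] S.perp :=
    (ContinuousLinearMap.apply ℝ S.perp ρ).comp (ContinuousLinearMap.compL ℝ F F S.perp S.perpProj)
  have hd : MDifferentiableAt 𝓘(ℝ, EH) 𝓘(ℝ, E) (fun h : H => (h : G)) 1 :=
    (hι 1).mdifferentiableAt (by simp)
  have h1 := tderiv_comp_apply (I := 𝓘(ℝ, EH)) (I' := 𝓘(ℝ, E)) (I'' := 𝓘(ℝ, S.perp))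
    (g := fun g : G => L (Q.coAdL g)) (f := fun h : H => (h : G)) (x := 1)
    (MDifferentiableAt.comp (I' := 𝓘(ℝ, F →L[ℝ] F)) _ L.mdifferentiableAt (Q.mdiffAt_coAdL _)) hd z
  have h2 : (fun h : H => L (Q.coAdL (h : G))) = fun _ => 0 := by
    funext h
    exact (S.mem_sub_iff _).1 (S.coAd_mem_sub h ρ hρ)
  rw [h2, tderiv_const, tderiv_clm_comp (E' := F →L[ℝ] F) L (Q.mdiffAt_coAdL _)] at h1
  exact (S.mem_sub_iff _).2 h1.symm

theorem contMDiff_coAdPerpL (hι : ContMDiff 𝓘(ℝ, EH) 𝓘(ℝ, E) ∞ (fun h : H => (h : G))) :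
    ContMDiff 𝓘(ℝ, EH) 𝓘(ℝ, S.perp →L[ℝ] S.perp) ∞ (fun h : H => S.coAdPerpL h) :=
  contMDiff_const.clm_comp ((Q.contMDiff_coAdL.comp hι).clm_comp contMDiff_const)

end InvariantSplitting

/-! ### Slices for a closed Lie subgroup. -/

/-- The inverse function theorem for smooth maps, with a smooth inverse on the whole target. -/
theorem exists_openPartialHomeomorph_of_contDiffOn {X Y : Type*} [NormedAddCommGroup X]
    [NormedSpace ℝ X] [CompleteSpace X] [NormedAddCommGroup Y] [NormedSpace ℝ Y] [CompleteSpace Y]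
    {f : X → Y} {O : Set X} (hO : IsOpen O) (hf : ContDiffOn ℝ ∞ f O) {a : X} (ha : a ∈ O)
    (f' : X ≃L[ℝ] Y) (hf' : HasFDerivAt f (f' : X →L[ℝ] Y) a) :
    ∃ e : OpenPartialHomeomorph X Y, a ∈ e.source ∧ e.source ⊆ O ∧ (∀ x, e x = f x) ∧
      ContDiffOn ℝ ∞ e.symm e.target := by
  have hfa : ContDiffAt ℝ ∞ f a := hf.contDiffAt (hO.mem_nhds ha)
  let e₀ := hfa.toOpenPartialHomeomorph f hf' (by simp)
  have he₀ : ∀ x, e₀ x = f x := fun x => rfl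
  have ha₀ : a ∈ e₀.source := hfa.mem_toOpenPartialHomeomorph_source hf' (by simp)
  -- Shrinking to the open set where the derivative is invertible makes the local inverse smooth on
  -- the whole target, not only near the image of `a`.
  let O' : Set X := O ∩ fderiv ℝ f ⁻¹' Set.range ((↑) : (X ≃L[ℝ] Y) → (X →L[ℝ] Y))
  have hO' : IsOpen O' := (hf.continuousOn_fderiv_of_isOpen hO (by simp)).isOpen_inter_preimage hO
    ContinuousLinearEquiv.isOpen
  have ha' : a ∈ O' := ⟨ha, f', hf'.fderiv.symm⟩
  refine ⟨e₀.restrOpen O' hO', ⟨ha₀, ha'⟩, fun x hx => hx.2.1, he₀, ?_⟩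
  intro y hy
  have hy' := (e₀.restrOpen O' hO').map_target hy
  obtain ⟨g, hg⟩ := hy'.2.2
  refine (OpenPartialHomeomorph.contDiffAt_symm (f₀' := g) _ hy ?_ ?_).contDiffWithinAt
  · rw [hg]
    exact ((hf.contDiffAt (hO.mem_nhds hy'.2.1)).differentiableAt (by simp)).hasFDerivAt
  · exact hf.contDiffAt (hO.mem_nhds hy'.2.1)

/-- A slice at the identity for the right action of a subgroup `H` on a Lie group `G`: an open
saturated set `U` in which every element is uniquely a product of an element of the slice, which
is parametrized by an open subset `V` of a Banach space, and of an element of `H`. -/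
structure Slice (E : Type*) [NormedAddCommGroup E] [NormedSpace ℝ E]
    {G : Type*} [TopologicalSpace G] [ChartedSpace E G] [Group G] (H : Subgroup G)
    (EH : Type*) [NormedAddCommGroup EH] [NormedSpace ℝ EH] [ChartedSpace EH H]
    (K : Type*) [NormedAddCommGroup K] [NormedSpace ℝ K] where
  U : Set G
  V : Set K
  κ : G → K
  η : G → H
  τ : K → G
  isOpen_U : IsOpen U
  isOpen_V : IsOpen V
  one_mem : 1 ∈ U
  mul_mem : ∀ u ∈ U, ∀ h : H, u * h ∈ U
  κ_mem : ∀ u ∈ U, κ u ∈ V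
  κ_mul : ∀ u ∈ U, ∀ h : H, κ (u * h) = κ u
  η_mul : ∀ u ∈ U, ∀ h : H, η (u * h) = η u * h
  τ_mem : ∀ v ∈ V, τ v ∈ U
  κ_τ : ∀ v ∈ V, κ (τ v) = v
  η_τ : ∀ v ∈ V, η (τ v) = 1
  τ_κ : ∀ u ∈ U, τ (κ u) * η u = u
  η_one : η 1 = 1
  contMDiffOn_κ : ContMDiffOn 𝓘(ℝ, E) 𝓘(ℝ, K) ∞ κ U
  contMDiffOn_η : ContMDiffOn 𝓘(ℝ, E) 𝓘(ℝ, EH) ∞ η U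
  contMDiffOn_τ : ContMDiffOn 𝓘(ℝ, K) 𝓘(ℝ, E) ∞ τ V

section SliceConstruction

variable {E : Type*} [NormedAddCommGroup E] [NormedSpace ℝ E]
    {G : Type*} [TopologicalSpace G] [ChartedSpace E G] [Group G] [LieGroup 𝓘(ℝ, E) ∞ G]
    {H : Subgroup G} {EH : Type*} [NormedAddCommGroup EH] [NormedSpace ℝ EH] [ChartedSpace EH H]
    [LieGroup 𝓘(ℝ, EH) ∞ H] {K : Type*} [NormedAddCommGroup K] [NormedSpace ℝ K]

/-- A slice is obtained from a local product decomposition that is injective. -/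
theorem nonempty_slice_of_local (τ : K → G) (V : Set K) (hV : IsOpen V)
    (hτ : ContMDiffOn 𝓘(ℝ, K) 𝓘(ℝ, E) ∞ τ V)
    (hinj : ∀ v ∈ V, ∀ w ∈ V, ∀ h k : H, τ v * (h : G) = τ w * (k : G) → v = w ∧ h = k)
    (U₀ : Set G) (hU₀ : IsOpen U₀) (κ₀ : G → K) (η₀ : G → H)
    (hκ₀ : ContMDiffOn 𝓘(ℝ, E) 𝓘(ℝ, K) ∞ κ₀ U₀) (hη₀ : ContMDiffOn 𝓘(ℝ, E) 𝓘(ℝ, EH) ∞ η₀ U₀)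
    (hmem : ∀ u ∈ U₀, κ₀ u ∈ V) (hdec : ∀ u ∈ U₀, τ (κ₀ u) * (η₀ u : G) = u)
    (hτU : ∀ v ∈ V, τ v ∈ U₀) (h0 : ∃ v ∈ V, τ v = 1) : Nonempty (Slice E H EH K) := by
  classical
  -- The saturated set `τ(V) H`. By `hinj` the decomposition of its elements is unique, so both
  -- components are well defined on it.
  let U : Set G := {u | ∃ q : K × H, q.1 ∈ V ∧ τ q.1 * (q.2 : G) = u}
  have hex : ∀ u : G, ∃ q : K × H, u ∈ U → q.1 ∈ V ∧ τ q.1 * (q.2 : G) = u := by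
    intro u
    by_cases hu : u ∈ U
    · obtain ⟨q, hq⟩ := hu
      exact ⟨q, fun _ => hq⟩
    -- The value outside `U` is arbitrary.
    · exact ⟨(0, 1), fun h => absurd h hu⟩
  choose q hq using hex
  have hU : ∀ v ∈ V, ∀ h : H, τ v * (h : G) ∈ U := fun v hv h => ⟨(v, h), hv, rfl⟩
  have hquniq : ∀ v ∈ V, ∀ h : H, q (τ v * (h : G)) = (v, h) := fun v hv h => by
    have h1 := hq _ (hU v hv h)
    have h2 := hinj _ h1.1 v hv _ h h1.2
    exact Prod.ext h2.1 h2.2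
  have hqτ : ∀ v ∈ V, q (τ v) = (v, 1) := fun v hv => by
    simpa using hquniq v hv 1
  have hloc : ∀ u ∈ U, ∃ k : H, u * (k : G)⁻¹ ∈ U₀ := by
    rintro u ⟨⟨v, h⟩, hv, rfl⟩
    exact ⟨h, by simpa using hτU v hv⟩
  -- Each point of `U` is carried into `U₀` by an element of `H`. There `κ₀` and `η₀` are available,
  -- and uniqueness identifies them with the two components up to right translation by `k`; openness
  -- and smoothness on `U` follow.
  have hqloc : ∀ u : G, ∀ k : H, u * (k : G)⁻¹ ∈ U₀ →
      u ∈ U ∧ q u = (κ₀ (u * (k : G)⁻¹), η₀ (u * (k : G)⁻¹) * k) := by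
    intro u k hu
    have h1 : τ (κ₀ (u * (k : G)⁻¹)) * ((η₀ (u * (k : G)⁻¹) * k : H) : G) = u := by
      rw [Subgroup.coe_mul, ← mul_assoc, hdec _ hu, inv_mul_cancel_right]
    have h2 := hU _ (hmem _ hu) (η₀ (u * (k : G)⁻¹) * k)
    have h3 := hquniq _ (hmem _ hu) (η₀ (u * (k : G)⁻¹) * k)
    rw [h1] at h2 h3
    exact ⟨h2, h3⟩
  have hpre : ∀ k : H, IsOpen {u : G | u * (k : G)⁻¹ ∈ U₀} := fun k =>
    hU₀.preimage (contMDiff_mul_right (I := 𝓘(ℝ, E)) (n := ∞) (a := (k : G)⁻¹)).continuous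
  have hone : ∃ v ∈ V, τ v = 1 := h0
  obtain ⟨v₀, hv₀, hτ₀⟩ := h0
  have hq1 : q 1 = (v₀, 1) := by rw [← hτ₀]; exact hqτ v₀ hv₀
  refine ⟨{ U := U, V := V, κ := fun u => (q u).1, η := fun u => (q u).2, τ := τ
            isOpen_U := ?_, isOpen_V := hV
            one_mem := by simpa [hτ₀] using hU v₀ hv₀ 1
            mul_mem := ?_
            κ_mem := fun u hu => (hq u hu).1
            κ_mul := ?_, η_mul := ?_
            τ_mem := fun v hv => by simpa using hU v hv 1
            κ_τ := fun v hv => by rw [hqτ v hv]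
            η_τ := fun v hv => by rw [hqτ v hv]
            τ_κ := fun u hu => (hq u hu).2
            η_one := by rw [hq1]
            contMDiffOn_κ := ?_, contMDiffOn_η := ?_
            contMDiffOn_τ := hτ }⟩
  · rw [isOpen_iff_mem_nhds]
    intro u hu
    obtain ⟨k, hk⟩ := hloc u hu
    filter_upwards [(hpre k).mem_nhds hk] with w hw using (hqloc w k hw).1
  · rintro _ ⟨⟨v, k⟩, hv, rfl⟩ h
    simpa [mul_assoc] using hU v hv (k * h)
  · rintro _ ⟨⟨v, k⟩, hv, rfl⟩ h
    have h1 := hquniq v hv (k * h)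
    rw [Subgroup.coe_mul, ← mul_assoc] at h1
    simp only
    rw [h1, hquniq v hv k]
  · rintro _ ⟨⟨v, k⟩, hv, rfl⟩ h
    have h1 := hquniq v hv (k * h)
    rw [Subgroup.coe_mul, ← mul_assoc] at h1
    simp only
    rw [h1, hquniq v hv k]
  · intro u hu
    obtain ⟨k, hk⟩ := hloc u hu
    have h1 : ContMDiffAt 𝓘(ℝ, E) 𝓘(ℝ, K) ∞ (fun w : G => κ₀ (w * (k : G)⁻¹)) u :=
      ContMDiffAt.comp (I' := 𝓘(ℝ, E)) u (hκ₀.contMDiffAt (hU₀.mem_nhds hk))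
        (contMDiff_mul_right (I := 𝓘(ℝ, E)) (n := ∞) (a := (k : G)⁻¹)).contMDiffAt
    refine (h1.congr_of_eventuallyEq ?_).contMDiffWithinAt
    filter_upwards [(hpre k).mem_nhds hk] with w hw
    rw [(hqloc w k hw).2]
  · intro u hu
    obtain ⟨k, hk⟩ := hloc u hu
    have h1 : ContMDiffAt 𝓘(ℝ, E) 𝓘(ℝ, EH) ∞ (fun w : G => η₀ (w * (k : G)⁻¹)) u :=
      ContMDiffAt.comp (I' := 𝓘(ℝ, E)) u (hη₀.contMDiffAt (hU₀.mem_nhds hk))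
        (contMDiff_mul_right (I := 𝓘(ℝ, E)) (n := ∞) (a := (k : G)⁻¹)).contMDiffAt
    have h2 : ContMDiffAt 𝓘(ℝ, E) 𝓘(ℝ, EH) ∞ (fun w : G => η₀ (w * (k : G)⁻¹) * k) u :=
      ContMDiffAt.comp (I' := 𝓘(ℝ, EH)) u
        (contMDiff_mul_right (I := 𝓘(ℝ, EH)) (n := ∞) (a := k)).contMDiffAt h1
    refine (h2.congr_of_eventuallyEq ?_).contMDiffWithinAt
    filter_upwards [(hpre k).mem_nhds hk] with w hw
    rw [(hqloc w k hw).2]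

/-- The slice theorem for a closed Lie subgroup. -/
theorem nonempty_slice [CompleteSpace E] [CompleteSpace EH] [CompleteSpace K]
    (hι : ContMDiff 𝓘(ℝ, EH) 𝓘(ℝ, E) ∞ (fun h : H => (h : G)))
    (i : K →L[ℝ] E) (e' : (K × EH) ≃L[ℝ] E)
    (he' : ∀ k z, e' (k, z) = i k + tderiv 𝓘(ℝ, EH) 𝓘(ℝ, E) (fun h : H => (h : G)) 1 z) :
    Nonempty (Slice E H EH K) := by
  let φ := extChartAt 𝓘(ℝ, E) (1 : G)
  let ψ := extChartAt 𝓘(ℝ, EH) (1 : H)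
  let c : E := chartOne E G
  let z₁ : EH := chartOne EH H
  have hcφ : φ.symm c = 1 := chartOne_symm
  have hz₁ : ψ.symm z₁ = 1 := chartOne_symm
  have hz₁t : z₁ ∈ ψ.target := chartOne_mem_target
  -- The transversal is affine in the chart, in the directions of the complement.
  let τ : K → G := fun k => φ.symm (c + i k)
  have hτ0 : τ 0 = 1 := by simp only [τ, map_zero, add_zero, hcφ]
  let O₁ : Set K := {k | c + i k ∈ φ.target}
  have hO₁ : IsOpen O₁ :=
    (isOpen_extChartAt_target (I := 𝓘(ℝ, E)) (1 : G)).preimage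
      (continuous_const.add i.continuous)
  have h0O₁ : (0 : K) ∈ O₁ := by
    show c + i 0 ∈ φ.target
    rw [map_zero, add_zero]
    exact chartOne_mem_target
  have hτs : ContMDiffOn 𝓘(ℝ, K) 𝓘(ℝ, E) ∞ τ O₁ :=
    (contMDiffOn_extChartAt_symm (I := 𝓘(ℝ, E)) (1 : G)).comp (t := φ.target)
      (contMDiff_const.add i.contMDiff).contMDiffOn (fun k hk => hk)
  have hψs : ContMDiffOn 𝓘(ℝ, EH) 𝓘(ℝ, EH) ∞ ψ.symm ψ.target := contMDiffOn_extChartAt_symm 1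
  let m : K × EH → G := fun q => τ q.1 * (ψ.symm q.2 : H)
  have hm : ContMDiffOn 𝓘(ℝ, K × EH) 𝓘(ℝ, E) ∞ m (O₁ ×ˢ ψ.target) := by
    refine ContMDiffOn.mul ?_ ?_
    · exact hτs.comp (contDiff_fst.contMDiff.contMDiffOn) (fun q hq => hq.1)
    · exact hι.comp_contMDiffOn (hψs.comp (contDiff_snd.contMDiff.contMDiffOn) (fun q hq => hq.2))
  let O : Set (K × EH) := (O₁ ×ˢ ψ.target) ∩ m ⁻¹' φ.source
  have hO₂ : IsOpen (O₁ ×ˢ ψ.target) := hO₁.prod (isOpen_extChartAt_target (I := 𝓘(ℝ, EH)) (1 : H))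
  have hO : IsOpen O := hm.continuousOn.isOpen_inter_preimage hO₂ (isOpen_extChartAt_source 1)
  let f : K × EH → E := fun q => φ (m q)
  have hf : ContDiffOn ℝ ∞ f O := by
    rw [← contMDiffOn_iff_contDiffOn]
    exact (contMDiffOn_extChartAt (I := 𝓘(ℝ, E)) (x := (1 : G))).comp
      (hm.mono Set.inter_subset_left) (fun q hq => by simpa [φ] using hq.2)
  have ha : ((0 : K), z₁) ∈ O := by
    refine ⟨⟨h0O₁, hz₁t⟩, ?_⟩
    simp only [Set.mem_preimage, m, hτ0, hz₁, Subgroup.coe_one, mul_one]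
    exact mem_extChartAt_source 1
  have hf' : HasFDerivAt f (e' : K × EH →L[ℝ] E) (0, z₁) := by
    let j : EH → E := fun z => φ (ψ.symm z : H)
    have hj1 : j z₁ = c := by simp only [j, hz₁, Subgroup.coe_one]; rfl
    have hιs : MDifferentiableAt 𝓘(ℝ, EH) 𝓘(ℝ, E) (fun h : H => (h : G)) (ψ.symm z₁) :=
      (hι _).mdifferentiableAt (by simp)
    have hψd : MDifferentiableAt 𝓘(ℝ, EH) 𝓘(ℝ, EH) ψ.symm z₁ :=
      (contMDiffAt_extChartAt_symm hz₁t).mdifferentiableAt (by simp)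
    have hφd : MDifferentiableAt 𝓘(ℝ, E) 𝓘(ℝ, E) φ ((ψ.symm z₁ : H) : G) := by
      rw [hz₁]
      exact (contMDiffAt_extChartAt_of_mem (mem_extChartAt_source 1)).mdifferentiableAt (by simp)
    have hιψ : MDifferentiableAt 𝓘(ℝ, EH) 𝓘(ℝ, E) (fun z => ((ψ.symm z : H) : G)) z₁ :=
      MDifferentiableAt.comp (I' := 𝓘(ℝ, EH)) z₁ hιs hψd
    have hjd : MDifferentiableAt 𝓘(ℝ, EH) 𝓘(ℝ, E) j z₁ :=
      MDifferentiableAt.comp (I' := 𝓘(ℝ, E)) z₁ hφd hιψ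
    have hj : HasFDerivAt j (tderiv 𝓘(ℝ, EH) 𝓘(ℝ, E) (fun h : H => (h : G)) 1) z₁ := by
      have h1 := hjd.differentiableAt.hasFDerivAt
      rw [← tderiv_eq_fderiv] at h1
      refine h1.congr_fderiv ?_
      ext z
      refine (tderiv_comp_apply (f := fun z => ((ψ.symm z : H) : G)) hφd hιψ z).trans ?_
      rw [tderiv_comp_apply hιs hψd, hz₁]
      refine (congrArg (fun T : E →L[ℝ] E => T _) (tderiv_extChartAt_self (1 : G))).trans ?_
      exact congrArg (tderiv 𝓘(ℝ, EH) 𝓘(ℝ, E) (fun h : H => (h : G)) 1)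
        (congrArg (fun T : EH →L[ℝ] EH => T z) (tderiv_extChartAt_symm_self (1 : H)))
    -- The derivative of the multiplication at the identity is addition, so `f` has the splitting
    -- `e'` as its derivative.
    have hD : HasFDerivAt (chartMul (E := E) G) (fderiv ℝ (chartMul (E := E) G) (c, c))
        (c + i (0 : K), j z₁) := by
      rw [hj1, map_zero, add_zero]
      exact (contDiffAt_chartMul_one.differentiableAt (by simp)).hasFDerivAt
    have h2 := hD.comp (f := fun q : K × EH => (c + i q.1, j q.2)) ((0 : K), z₁)
      (((i.hasFDerivAt.comp ((0 : K), z₁) hasFDerivAt_fst).const_add c).prodMk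
        (HasFDerivAt.comp (g := j) (f := Prod.snd) ((0 : K), z₁) hj hasFDerivAt_snd))
    refine (h2.congr_fderiv ?_).congr_of_eventuallyEq ?_
    · refine ContinuousLinearMap.ext fun q => ?_
      obtain ⟨k, z⟩ := q
      refine Eq.trans ?_ (he' k z).symm
      have h3 : ∀ a b : E, fderiv ℝ (chartMul (E := E) G) (c, c) (a, b) = a + b := by
        intro a b
        have h4 : ((a, b) : E × E) = (a, 0) + (0, b) := by simp
        rw [h4, map_add]
        exact congrArg₂ _ (fderiv_chartMul_one_left a) (fderiv_chartMul_one_right b)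
      exact h3 _ _
    · have hc1 : ContinuousAt (fun q : K × EH => ((ψ.symm q.2 : H) : G)) (0, z₁) :=
        ContinuousAt.comp (f := Prod.snd) (x := ((0 : K), z₁)) hιψ.continuousAt continuousAt_snd
      have hn : φ.source ∈ 𝓝 ((ψ.symm z₁ : H) : G) := by
        rw [hz₁]; exact extChartAt_source_mem_nhds (I := 𝓘(ℝ, E)) (1 : G)
      filter_upwards [hc1.preimage_mem_nhds hn] with q hq
      simp only [f, m, j, Function.comp_def, chartMul, τ]
      congr 2
      exact (φ.left_inv hq).symm
  obtain ⟨e, hae, heO, hef, hes⟩ := exists_openPartialHomeomorph_of_contDiffOn hO hf ha e' hf'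
  obtain ⟨V₁, hV₁, Z, hZ, hVZ⟩ := mem_nhds_prod_iff.1 (e.open_source.mem_nhds hae)
  obtain ⟨Z', hZ'Z, hZ'o, hz₁Z'⟩ := mem_nhds_iff.1 hZ
  have hW : IsOpen (ψ.source ∩ ψ ⁻¹' Z') :=
    (continuousOn_extChartAt (I := 𝓘(ℝ, EH)) (1 : H)).isOpen_inter_preimage
      (isOpen_extChartAt_source 1) hZ'o
  -- Here the subspace topology of `H` enters: an element of `H` that is close to `1` in `G` has
  -- coordinates in `Z'`.
  obtain ⟨N, hN, hNW⟩ := isOpen_induced_iff.1 hW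
  have h1N : (1 : G) ∈ N := by
    have : (1 : H) ∈ ψ.source ∩ ψ ⁻¹' Z' := ⟨mem_extChartAt_source 1, hz₁Z'⟩
    rw [← hNW] at this
    exact this
  have hτc : ContinuousAt τ 0 := hτs.continuousOn.continuousAt (hO₁.mem_nhds h0O₁)
  have : IsTopologicalGroup G := topologicalGroup_of_lieGroup 𝓘(ℝ, E) ∞
  have hdiv : ContinuousAt (fun q : K × K => (τ q.1)⁻¹ * τ q.2) (0, 0) :=
    (ContinuousAt.comp (f := Prod.fst) (x := ((0 : K), (0 : K))) hτc continuousAt_fst).inv.mul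
      (ContinuousAt.comp (f := Prod.snd) (x := ((0 : K), (0 : K))) hτc continuousAt_snd)
  have hdivN : (fun q : K × K => (τ q.1)⁻¹ * τ q.2) ⁻¹' N ∈ 𝓝 ((0 : K), (0 : K)) :=
    hdiv.preimage_mem_nhds (hN.mem_nhds (by simpa [hτ0] using h1N))
  obtain ⟨A, hA, B, hB, hAB⟩ := mem_nhds_prod_iff.1 hdivN
  obtain ⟨V, hVsub, hVo, h0V⟩ := mem_nhds_iff.1 (Filter.inter_mem (Filter.inter_mem hA hB) hV₁)
  have hsrc : ∀ v ∈ V, ∀ z ∈ Z', (v, z) ∈ e.source := fun v hv z hz =>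
    hVZ ⟨(hVsub hv).2, hZ'Z hz⟩
  have hVO₁ : V ⊆ O₁ := fun v hv => (heO (hsrc v hv z₁ hz₁Z')).1.1
  have hm1 : ∀ v, m (v, z₁) = τ v := fun v => by simp [m, hz₁]
  refine nonempty_slice_of_local τ V hVo (hτs.mono hVO₁) ?_
    (φ.source ∩ φ ⁻¹' (e.target ∩ e.symm ⁻¹' (V ×ˢ Z'))) ?_
    (fun u => (e.symm (φ u)).1) (fun u => ψ.symm (e.symm (φ u)).2) ?_ ?_ ?_ ?_ ?_ ⟨0, h0V, hτ0⟩
  -- If `τ v h = τ w k`, then `(τ w)⁻¹ τ v = k h⁻¹` lies in `H` and, by the choice of `V`, in `N`.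
  -- So it has a coordinate in `Z'`, and injectivity of `e` on `V × Z'` forces `v = w`.
  · intro v hv w hw h k hvw
    have h1 : (τ w)⁻¹ * τ v = ((k * h⁻¹ : H) : G) := by
      rw [Subgroup.coe_mul, Subgroup.coe_inv, eq_mul_inv_iff_mul_eq, mul_assoc, hvw,
        inv_mul_cancel_left]
    have h2 : (k * h⁻¹ : H) ∈ ψ.source ∩ ψ ⁻¹' Z' := by
      rw [← hNW]
      show ((k * h⁻¹ : H) : G) ∈ N
      rw [← h1]
      exact hAB (Set.mk_mem_prod (hVsub hw).1.1 (hVsub hv).1.2)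
    have h3 : m (v, z₁) = m (w, ψ (k * h⁻¹)) := by
      rw [hm1]
      simp only [m]
      rw [ψ.left_inv h2.1, ← h1, mul_inv_cancel_left]
    have h4 : e (v, z₁) = e (w, ψ (k * h⁻¹)) := by
      rw [hef, hef]; exact congrArg φ h3
    have h5 := e.injOn (hsrc v hv z₁ hz₁Z') (hsrc w hw _ h2.2) h4
    have h6 : v = w := congrArg Prod.fst h5
    subst h6
    exact ⟨rfl, Subtype.ext (mul_left_cancel hvw)⟩
  · exact (continuousOn_extChartAt (I := 𝓘(ℝ, E)) (1 : G)).isOpen_inter_preimage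
      (isOpen_extChartAt_source 1) (e.isOpen_inter_preimage_symm (hVo.prod hZ'o))
  · have h1 : ContMDiffOn 𝓘(ℝ, E) 𝓘(ℝ, K × EH) ∞ (fun u => e.symm (φ u))
        (φ.source ∩ φ ⁻¹' (e.target ∩ e.symm ⁻¹' (V ×ˢ Z'))) :=
      hes.contMDiffOn.comp ((contMDiffOn_extChartAt (I := 𝓘(ℝ, E)) (x := (1 : G))).mono
        (fun u hu => by simpa [φ] using hu.1)) (fun u hu => hu.2.1)
    exact contDiff_fst.contMDiff.comp_contMDiffOn h1
  · have h1 : ContMDiffOn 𝓘(ℝ, E) 𝓘(ℝ, K × EH) ∞ (fun u => e.symm (φ u))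
        (φ.source ∩ φ ⁻¹' (e.target ∩ e.symm ⁻¹' (V ×ˢ Z'))) :=
      hes.contMDiffOn.comp ((contMDiffOn_extChartAt (I := 𝓘(ℝ, E)) (x := (1 : G))).mono
        (fun u hu => by simpa [φ] using hu.1)) (fun u hu => hu.2.1)
    exact hψs.comp (contDiff_snd.contMDiff.comp_contMDiffOn h1)
      (fun u hu => (heO (e.map_target hu.2.1)).1.2)
  · exact fun u hu => hu.2.2.1
  · intro u hu
    have h1 := e.map_target hu.2.1
    have h2 : φ (m (e.symm (φ u))) = φ u := (hef _).symm.trans (e.right_inv hu.2.1)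
    exact φ.injOn (heO h1).2 hu.1 h2
  · intro v hv
    have h1 := hsrc v hv z₁ hz₁Z'
    have h2 : e (v, z₁) = φ (τ v) := by rw [hef]; exact congrArg φ (hm1 v)
    refine ⟨by rw [← hm1]; exact (heO h1).2, ?_⟩
    rw [Set.mem_preimage, ← h2]
    refine ⟨e.map_source h1, ?_⟩
    rw [Set.mem_preimage, e.left_inv h1]
    exact ⟨hv, hz₁Z'⟩

end SliceConstruction

/-! ### Smooth structures on quotients with local product structure. -/

/-- A local trivialization of a projection `π : X → Y` onto a topological space: the preimage of
the open set `W` is identified with `T × A`, where `T` is an open subset of a normed space, by the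
maps `C` and `D` with common inverse `R`, and the fibres of `π` are the fibres of `C`. -/
structure PrincipalChart {EX : Type*} [NormedAddCommGroup EX] [NormedSpace ℝ EX]
    {HX : Type*} [TopologicalSpace HX] (I : ModelWithCorners ℝ EX HX)
    {X : Type*} [TopologicalSpace X] [ChartedSpace HX X] {Y : Type*} [TopologicalSpace Y]
    (π : X → Y) (E' : Type*) [NormedAddCommGroup E'] [NormedSpace ℝ E']
    (EA : Type*) [NormedAddCommGroup EA] [NormedSpace ℝ EA]
    {A : Type*} [TopologicalSpace A] [ChartedSpace EA A] (o : A) where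
  W : Set Y
  T : Set E'
  C : X → E'
  D : X → A
  R : E' × A → X
  isOpen_W : IsOpen W
  isOpen_T : IsOpen T
  C_mem : ∀ x, π x ∈ W → C x ∈ T
  C_eq : ∀ x x', π x ∈ W → π x = π x' → C x = C x'
  π_R : ∀ v ∈ T, ∀ a, π (R (v, a)) ∈ W
  π_R_eq : ∀ v ∈ T, ∀ a, π (R (v, a)) = π (R (v, o))
  C_R : ∀ v ∈ T, ∀ a, C (R (v, a)) = v
  D_R : ∀ v ∈ T, ∀ a, D (R (v, a)) = a
  R_C_D : ∀ x, π x ∈ W → R (C x, D x) = x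
  contMDiffOn_C : ContMDiffOn I 𝓘(ℝ, E') ∞ C (π ⁻¹' W)
  contMDiffOn_D : ContMDiffOn I 𝓘(ℝ, EA) ∞ D (π ⁻¹' W)
  contMDiffOn_R : ContMDiffOn (𝓘(ℝ, E').prod 𝓘(ℝ, EA)) I ∞ R (T ×ˢ Set.univ)

namespace PrincipalChart

set_option linter.unusedSectionVars false

variable {EX : Type*} [NormedAddCommGroup EX] [NormedSpace ℝ EX]
    {HX : Type*} [TopologicalSpace HX] {I : ModelWithCorners ℝ EX HX}
    {X : Type*} [TopologicalSpace X] [ChartedSpace HX X] {Y : Type*} [TopologicalSpace Y]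
    {π : X → Y} {E' : Type*} [NormedAddCommGroup E'] [NormedSpace ℝ E']
    {EA : Type*} [NormedAddCommGroup EA] [NormedSpace ℝ EA]
    {A : Type*} [TopologicalSpace A] [ChartedSpace EA A] {o : A}

section

variable (c : PrincipalChart I π E' EA o)

/-- The section `T → X` of a local trivialization. -/
def σ (v : E') : X := c.R (v, o)

theorem contMDiffOn_σ : ContMDiffOn 𝓘(ℝ, E') I ∞ c.σ c.T :=
  c.contMDiffOn_R.comp (contMDiff_id.prodMk contMDiff_const).contMDiffOn
    (fun _ hv => ⟨hv, Set.mem_univ _⟩)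

theorem C_σ {v : E'} (hv : v ∈ c.T) : c.C (c.σ v) = v := c.C_R v hv o

theorem π_σ_mem {v : E'} (hv : v ∈ c.T) : π (c.σ v) ∈ c.W := c.π_R v hv o

theorem π_σ_C {x : X} (hx : π x ∈ c.W) : π (c.σ (c.C x)) = π x := by
  conv_rhs => rw [← c.R_C_D x hx]
  exact (c.π_R_eq _ (c.C_mem x hx) _).symm

variable (hπ : IsOpenQuotientMap π)

/-- The chart of the base that is induced by a local trivialization. -/
def baseChart : OpenPartialHomeomorph Y E' where
  -- The chosen preimage does not matter, because `C` is constant on the fibres over `W`.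
  toFun y := c.C (Function.surjInv hπ.surjective y)
  invFun v := π (c.σ v)
  source := c.W
  target := c.T
  map_source' y hy := c.C_mem _ (by rwa [Function.surjInv_eq hπ.surjective])
  map_target' v hv := c.π_σ_mem hv
  left_inv' y hy := by
    rw [c.π_σ_C (by rwa [Function.surjInv_eq hπ.surjective]), Function.surjInv_eq hπ.surjective]
  right_inv' v hv := by
    refine Eq.trans ?_ (c.C_σ hv)
    refine c.C_eq _ _ ?_ (Function.surjInv_eq hπ.surjective _)
    rw [Function.surjInv_eq hπ.surjective]
    exact c.π_σ_mem hv
  open_source := c.isOpen_W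
  open_target := c.isOpen_T
  continuousOn_toFun := by
    intro y hy
    obtain ⟨x, rfl⟩ := hπ.surjective y
    refine ContinuousAt.continuousWithinAt ?_
    -- Continuity is tested upstairs, as `π` is an open quotient map.
    rw [← hπ.continuousAt_comp_iff]
    have hW := c.isOpen_W.preimage hπ.continuous
    refine (c.contMDiffOn_C.continuousOn.continuousAt (hW.mem_nhds hy)).congr ?_
    filter_upwards [hW.mem_nhds hy] with z hz
    exact c.C_eq _ _ hz (Function.surjInv_eq hπ.surjective _).symm
  continuousOn_invFun := hπ.continuous.comp_continuousOn c.contMDiffOn_σ.continuousOn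

theorem baseChart_apply {x : X} (hx : π x ∈ c.W) : c.baseChart hπ (π x) = c.C x :=
  (c.C_eq _ _ hx (Function.surjInv_eq hπ.surjective _).symm).symm

end

section Atlas

variable (hπ : IsOpenQuotientMap π) (c : Y → PrincipalChart I π E' EA o) (hc : ∀ y, y ∈ (c y).W)

/-- The smooth structure on the base that is given by a family of local trivializations. -/
@[reducible] def chartedSpace : ChartedSpace E' Y where
  atlas := Set.range fun y => (c y).baseChart hπ
  chartAt y := (c y).baseChart hπ
  mem_chart_source := hc
  chart_mem_atlas y := ⟨y, rfl⟩

/-- On an overlap the transition map is the component `C` of one trivialization along the section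
`σ` of another. -/
theorem isManifold : @IsManifold ℝ _ E' _ _ E' _ 𝓘(ℝ, E') ∞ Y _ (chartedSpace hπ c hc) := by
  let := chartedSpace hπ c hc
  refine isManifold_of_contDiffOn 𝓘(ℝ, E') ∞ Y ?_
  rintro _ _ ⟨y, rfl⟩ ⟨y', rfl⟩
  simp only [modelWithCornersSelf_coe, modelWithCornersSelf_coe_symm, Function.id_comp,
    Function.comp_id, Set.range_id, Set.inter_univ, Set.preimage_id]
  rw [← contMDiffOn_iff_contDiffOn]
  have h1 : ContMDiffOn 𝓘(ℝ, E') 𝓘(ℝ, E') ∞ (fun v => (c y').C ((c y).σ v))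
      (((c y).baseChart hπ).symm.trans ((c y').baseChart hπ)).source := by
    refine (c y').contMDiffOn_C.comp ((c y).contMDiffOn_σ.mono fun v hv => hv.1) ?_
    exact fun v hv => hv.2
  exact h1.congr fun v hv => (c y').baseChart_apply hπ hv.2

end Atlas

section Charted

variable [ChartedSpace E' Y] [IsManifold 𝓘(ℝ, E') ∞ Y] {hπ : IsOpenQuotientMap π}
  {c : Y → PrincipalChart I π E' EA o} (hc : ∀ y, chartAt E' y = (c y).baseChart hπ)

include hc

theorem mem_W (y : Y) : y ∈ (c y).W := by
  have h := mem_chart_source E' y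
  rw [hc] at h
  exact h

theorem extChartAt_apply (y : Y) {x : X} (hx : π x ∈ (c y).W) :
    extChartAt 𝓘(ℝ, E') y (π x) = (c y).C x := by
  simp only [extChartAt, hc, mfld_simps]
  exact (c y).baseChart_apply hπ hx

theorem extChartAt_symm_apply (y : Y) (v : E') :
    (extChartAt 𝓘(ℝ, E') y).symm v = π ((c y).σ v) := by
  simp only [extChartAt, hc, mfld_simps]
  rfl

theorem extChartAt_target_eq (y : Y) : (extChartAt 𝓘(ℝ, E') y).target = (c y).T := by
  simp only [extChartAt, hc, mfld_simps]
  rfl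

theorem extChartAt_source_eq (y : Y) : (extChartAt 𝓘(ℝ, E') y).source = (c y).W := by
  simp only [extChartAt, hc, mfld_simps]
  rfl

theorem contMDiff_proj : ContMDiff I 𝓘(ℝ, E') ∞ π := by
  intro x
  rw [contMDiffAt_iff_target]
  refine ⟨hπ.continuous.continuousAt, ?_⟩
  have hW := ((c (π x)).isOpen_W.preimage hπ.continuous).mem_nhds (mem_W hc (π x))
  refine ((c (π x)).contMDiffOn_C.contMDiffAt hW).congr_of_eventuallyEq ?_
  filter_upwards [hW] with z hz
  exact extChartAt_apply hc _ hz

theorem contMDiffOn_section (y : Y) :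
    ContMDiffOn 𝓘(ℝ, E') I ∞ (fun z => (c y).σ (extChartAt 𝓘(ℝ, E') y z)) (c y).W := by
  refine (c y).contMDiffOn_σ.comp
    ((contMDiffOn_extChartAt (I := 𝓘(ℝ, E')) (x := y)).mono ?_) ?_
  · rw [← extChartAt_source (I := 𝓘(ℝ, E')), extChartAt_source_eq hc]
  · intro z hz
    have h := (extChartAt 𝓘(ℝ, E') y).map_source (by rwa [extChartAt_source_eq hc])
    rwa [extChartAt_target_eq hc] at h

theorem proj_section (y : Y) {z : Y} (hz : z ∈ (c y).W) :
    π ((c y).σ (extChartAt 𝓘(ℝ, E') y z)) = z := by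
  rw [← extChartAt_symm_apply hc]
  exact (extChartAt 𝓘(ℝ, E') y).left_inv (by rwa [extChartAt_source_eq hc])

/-- Smoothness descends to the base. -/
theorem contMDiffOn_of_comp_proj {EN : Type*} [NormedAddCommGroup EN] [NormedSpace ℝ EN]
    {HN : Type*} [TopologicalSpace HN] {J : ModelWithCorners ℝ EN HN} {N : Type*}
    [TopologicalSpace N] [ChartedSpace HN N] {f : Y → N} {s : Set Y} (hs : IsOpen s)
    (hf : ContMDiffOn I J ∞ (fun x => f (π x)) (π ⁻¹' s)) : ContMDiffOn 𝓘(ℝ, E') J ∞ f s := by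
  intro y hy
  have hn : (c y).W ∩ s ∈ 𝓝 y := ((c y).isOpen_W.inter hs).mem_nhds ⟨mem_W hc y, hy⟩
  have h1 : ContMDiffOn 𝓘(ℝ, E') J ∞ (fun z => f (π ((c y).σ (extChartAt 𝓘(ℝ, E') y z))))
      ((c y).W ∩ s) := by
    refine hf.comp ((contMDiffOn_section hc y).mono Set.inter_subset_left) ?_
    intro z hz
    rw [Set.mem_preimage, Set.mem_preimage, proj_section hc y hz.1]
    exact hz.2
  refine (ContMDiffOn.contMDiffAt (h1.congr fun z hz => ?_) hn).contMDiffWithinAt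
  rw [proj_section hc y hz.1]

theorem contMDiff_of_comp_proj {EN : Type*} [NormedAddCommGroup EN] [NormedSpace ℝ EN]
    {HN : Type*} [TopologicalSpace HN] {J : ModelWithCorners ℝ EN HN} {N : Type*}
    [TopologicalSpace N] [ChartedSpace HN N] {f : Y → N}
    (hf : ContMDiff I J ∞ (fun x => f (π x))) : ContMDiff 𝓘(ℝ, E') J ∞ f :=
  contMDiffOn_univ.1 (contMDiffOn_of_comp_proj hc isOpen_univ hf.contMDiffOn)

/-- The derivative of the projection is the derivative of the first component of a local
trivialization. -/
theorem tderiv_proj_surjective (x : X) : Function.Surjective (tderiv I 𝓘(ℝ, E') π x) := by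
  intro w
  let k := c (π x)
  have hx : π x ∈ k.W := mem_W hc (π x)
  have hv := k.C_mem x hx
  have hR : ContMDiffAt (𝓘(ℝ, E').prod 𝓘(ℝ, EA)) I ∞ k.R (k.C x, k.D x) :=
    k.contMDiffOn_R.contMDiffAt ((k.isOpen_T.prod isOpen_univ).mem_nhds ⟨hv, Set.mem_univ _⟩)
  have hRs : ContMDiffAt 𝓘(ℝ, E') I ∞ (fun v => k.R (v, k.D x)) (k.C x) :=
    hR.comp (I' := 𝓘(ℝ, E').prod 𝓘(ℝ, EA)) (k.C x)
      (contMDiffAt_id.prodMk contMDiffAt_const)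
  have hπd : MDifferentiableAt I 𝓘(ℝ, E') π (k.R (k.C x, k.D x)) :=
    ((contMDiff_proj hc) _).mdifferentiableAt (by simp)
  -- With the fibre coordinate fixed, `R` lifts the inverse chart through `x`. The derivative of
  -- this lift provides the preimages.
  have h1 : (fun v => π (k.R (v, k.D x))) =ᶠ[𝓝 (k.C x)] (extChartAt 𝓘(ℝ, E') (π x)).symm := by
    filter_upwards [k.isOpen_T.mem_nhds hv] with v hv
    rw [extChartAt_symm_apply hc]
    exact k.π_R_eq v hv _
  have h2 := tderiv_comp_apply (f := fun v => k.R (v, k.D x)) (g := π) hπd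
    (hRs.mdifferentiableAt (by simp)) w
  have h3 : k.C x = extChartAt 𝓘(ℝ, E') (π x) (π x) := (extChartAt_apply hc _ hx).symm
  rw [tderiv_congr h1, h3, tderiv_extChartAt_symm_self, ← h3, k.R_C_D x hx] at h2
  exact ⟨_, h2.symm⟩

/-- The kernel of the derivative of the projection consists of the tangent vectors of the
fibres. -/
theorem exists_of_tderiv_proj_eq_zero {x : X} {u : EX} (hu : tderiv I 𝓘(ℝ, E') π x u = 0) :
    ∃ w : EA, u = tderiv 𝓘(ℝ, EA) I (fun a => (c (π x)).R ((c (π x)).C x, a))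
      ((c (π x)).D x) w := by
  let k := c (π x)
  have hx : π x ∈ k.W := mem_W hc (π x)
  have hv := k.C_mem x hx
  have hW := (k.isOpen_W.preimage hπ.continuous).mem_nhds hx
  have hR : MDifferentiableAt (𝓘(ℝ, E').prod 𝓘(ℝ, EA)) I k.R (k.C x, k.D x) :=
    (k.contMDiffOn_R.contMDiffAt ((k.isOpen_T.prod isOpen_univ).mem_nhds
      ⟨hv, Set.mem_univ _⟩)).mdifferentiableAt (by simp)
  have hC : MDifferentiableAt I 𝓘(ℝ, E') k.C x :=
    (k.contMDiffOn_C.contMDiffAt hW).mdifferentiableAt (by simp)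
  have hD : MDifferentiableAt I 𝓘(ℝ, EA) k.D x :=
    (k.contMDiffOn_D.contMDiffAt hW).mdifferentiableAt (by simp)
  have hπd : MDifferentiableAt I 𝓘(ℝ, E') π x :=
    ((contMDiff_proj hc) _).mdifferentiableAt (by simp)
  -- Differentiating `R(C, D) = id` splits a tangent vector into a part through `C` and a part along
  -- the fibre. Since `C` is the chart after `π`, the first part vanishes on the kernel.
  have h1 : (fun z => k.R (k.C z, k.D z)) =ᶠ[𝓝 x] fun z => z := by
    filter_upwards [hW] with z hz using k.R_C_D z hz
  have h2 := tderiv_comp₂ hR hC hD u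
  rw [tderiv_congr h1, tderiv_id] at h2
  have h3 : (fun z => extChartAt 𝓘(ℝ, E') (π x) (π z)) =ᶠ[𝓝 x] k.C := by
    filter_upwards [hW] with z hz using extChartAt_apply hc _ hz
  have h4 := tderiv_comp_apply (f := π) (g := extChartAt 𝓘(ℝ, E') (π x))
    ((contMDiffAt_extChartAt (n := ∞)).mdifferentiableAt (by simp)) hπd u
  rw [tderiv_congr h3, hu, map_zero] at h4
  rw [h4, map_zero, zero_add] at h2
  exact ⟨_, h2⟩

/-- The projection is a submersion. -/
theorem isSubmersion [IsManifold I ∞ X] [I.Boundaryless] [IsManifold 𝓘(ℝ, EA) ∞ A]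
    (e : EX ≃L[ℝ] E' × EA) : Manifold.IsSubmersion I 𝓘(ℝ, E') ∞ π := by
  have key : ∀ x, Manifold.IsSubmersionAtOfComplement EA I 𝓘(ℝ, E') ∞ π x := by
    intro x
    let k := c (π x)
    have hx : π x ∈ k.W := mem_W hc (π x)
    let ψ := chartAt EA (k.D x)
    have hW := k.isOpen_W.preimage hπ.continuous
    have hψ : ContMDiffOn 𝓘(ℝ, EA) 𝓘(ℝ, EA) ∞ ψ ψ.source := contMDiffOn_chart
    have hψs : ContMDiffOn 𝓘(ℝ, EA) 𝓘(ℝ, EA) ∞ ψ.symm ψ.target := contMDiffOn_chart_symm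
    -- The chart of `X` with coordinates `(C, D)`, carried to the model space by `e`; in it `π`
    -- becomes the first projection.
    let f : X → HX := fun z => I.symm (e.symm (k.C z, ψ (k.D z)))
    let g : HX → X := fun z => k.R ((e (I z)).1, ψ.symm (e (I z)).2)
    have hIi : ∀ z, I (I.symm z) = z := fun z => I.right_inv (by simp [I.range_eq_univ])
    have hs : IsOpen (π ⁻¹' k.W ∩ k.D ⁻¹' ψ.source) :=
      k.contMDiffOn_D.continuousOn.isOpen_inter_preimage hW ψ.open_source
    have ht : IsOpen ((fun z : HX => e (I z)) ⁻¹' (k.T ×ˢ ψ.target)) :=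
      (k.isOpen_T.prod ψ.open_target).preimage (e.continuous.comp I.continuous)
    have hIs : ContMDiff 𝓘(ℝ, EX) I ∞ I.symm := by
      have := I.contMDiffOn_symm (n := ∞)
      rwa [I.range_eq_univ, contMDiffOn_univ] at this
    have hf : ContMDiffOn I I ∞ f (π ⁻¹' k.W ∩ k.D ⁻¹' ψ.source) := by
      refine hIs.comp_contMDiffOn (ContMDiff.comp_contMDiffOn (I' := 𝓘(ℝ, E' × EA))
        e.symm.contDiff.contMDiff ?_)
      exact (k.contMDiffOn_C.mono Set.inter_subset_left).prodMk_space
        (hψ.comp (k.contMDiffOn_D.mono Set.inter_subset_left) (fun z hz => hz.2))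
    have hg : ContMDiffOn I I ∞ g ((fun z : HX => e (I z)) ⁻¹' (k.T ×ˢ ψ.target)) := by
      have h1 : ContMDiff I 𝓘(ℝ, E' × EA) ∞ (fun z : HX => e (I z)) :=
        ContMDiff.comp (I' := 𝓘(ℝ, EX)) e.contDiff.contMDiff I.contMDiff
      refine k.contMDiffOn_R.comp (ContMDiffOn.prodMk ?_ ?_) (fun z hz => ⟨hz.1, Set.mem_univ _⟩)
      · exact (contDiff_fst.contMDiff.comp h1).contMDiffOn
      · exact hψs.comp (contDiff_snd.contMDiff.comp h1).contMDiffOn (fun z hz => hz.2)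
    let Φ : OpenPartialHomeomorph X HX :=
      { toFun := f
        invFun := g
        source := π ⁻¹' k.W ∩ k.D ⁻¹' ψ.source
        target := (fun z : HX => e (I z)) ⁻¹' (k.T ×ˢ ψ.target)
        map_source' := fun z hz => by
          simp only [f, Set.mem_preimage, hIi, e.apply_symm_apply]
          exact ⟨k.C_mem z hz.1, ψ.map_source hz.2⟩
        map_target' := fun z hz => by
          refine ⟨k.π_R _ hz.1 _, ?_⟩
          simp only [g, Set.mem_preimage]
          rw [k.D_R _ hz.1]
          exact ψ.map_target hz.2
        left_inv' := fun z hz => by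
          simp only [f, g, hIi, e.apply_symm_apply]
          rw [ψ.left_inv hz.2, k.R_C_D z hz.1]
        right_inv' := fun z hz => by
          simp only [f, g]
          rw [k.C_R _ hz.1, k.D_R _ hz.1, ψ.right_inv hz.2, Prod.mk.eta, e.symm_apply_apply,
            I.left_inv]
        open_source := hs
        open_target := ht
        continuousOn_toFun := hf.continuousOn
        continuousOn_invFun := hg.continuousOn }
    refine Manifold.IsSubmersionAtOfComplement.mk_of_charts e Φ (chartAt E' (π x))
      ⟨hx, mem_chart_source EA (k.D x)⟩ (mem_chart_source E' (π x))
      (Φ.mem_maximalAtlas_of_contMDiffOn hf hg) (IsManifold.chart_mem_maximalAtlas _) ?_ ?_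
    · intro z hz
      rw [Set.mem_preimage, hc]
      exact hz.1
    · intro z hz
      have hz' : I.symm z ∈ (fun z : HX => e (I z)) ⁻¹' (k.T ×ˢ ψ.target) := by
        have hz2 := hz
        simp only [OpenPartialHomeomorph.extend, PartialEquiv.trans_target] at hz2
        exact hz2.2
      rw [Set.mem_preimage, hIi] at hz'
      have h1 : (Φ.extend I).symm z = k.R ((e z).1, ψ.symm (e z).2) := by
        show k.R ((e (I (I.symm z))).1, ψ.symm (e (I (I.symm z))).2) = _
        rw [hIi]
      simp only [Function.comp_apply, h1]
      refine (extChartAt_apply hc (π x) (k.π_R _ hz'.1 _)).trans ?_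
      exact k.C_R _ hz'.1 _
  exact Manifold.IsSubmersionOfComplement.isSubmersion key

end Charted

end PrincipalChart

/-! ### The homogeneous space. -/

section Homogeneous

set_option linter.unusedSectionVars false

variable {E : Type*} [NormedAddCommGroup E] [NormedSpace ℝ E]
    {G : Type*} [TopologicalSpace G] [ChartedSpace E G] [Group G] [LieGroup 𝓘(ℝ, E) ∞ G]
    {H : Subgroup G} {EH : Type*} [NormedAddCommGroup EH] [NormedSpace ℝ EH] [ChartedSpace EH H]
    {K : Type*} [NormedAddCommGroup K] [NormedSpace ℝ K]

namespace Slice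

variable (sl : Slice E H EH K) (g : G)

/-- The translated saturated neighbourhood `g U`. -/
def nhd : Set G := {x | g⁻¹ * x ∈ sl.U}

theorem isOpen_nhd : IsOpen (sl.nhd g) :=
  sl.isOpen_U.preimage (contMDiff_mul_left (I := 𝓘(ℝ, E)) (n := ∞) (a := g⁻¹)).continuous

theorem self_mem_nhd : g ∈ sl.nhd g := by
  simpa [nhd] using sl.one_mem

variable {g} in
theorem mul_mem_nhd {x : G} (hx : x ∈ sl.nhd g) (h : H) : x * h ∈ sl.nhd g := by
  have := sl.mul_mem _ hx h
  rwa [mul_assoc] at this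

theorem mul_τ_mem_nhd {v : K} (hv : v ∈ sl.V) : g * sl.τ v ∈ sl.nhd g := by
  simpa [nhd] using sl.τ_mem v hv

/-- The coordinates of the base in the neighbourhood `g U`. -/
def coord (x : G) : K := sl.κ (g⁻¹ * x)

/-- The component in `H` of an element of the neighbourhood `g U`. -/
def fib (x : G) : H := sl.η (g⁻¹ * x)

theorem contMDiffOn_coord : ContMDiffOn 𝓘(ℝ, E) 𝓘(ℝ, K) ∞ (sl.coord g) (sl.nhd g) :=
  sl.contMDiffOn_κ.comp (contMDiff_mul_left (I := 𝓘(ℝ, E)) (n := ∞) (a := g⁻¹)).contMDiffOn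
    (fun _ hx => hx)

theorem contMDiffOn_fib : ContMDiffOn 𝓘(ℝ, E) 𝓘(ℝ, EH) ∞ (sl.fib g) (sl.nhd g) :=
  sl.contMDiffOn_η.comp (contMDiff_mul_left (I := 𝓘(ℝ, E)) (n := ∞) (a := g⁻¹)).contMDiffOn
    (fun _ hx => hx)

theorem contMDiffOn_mul_τ : ContMDiffOn 𝓘(ℝ, K) 𝓘(ℝ, E) ∞ (fun v => g * sl.τ v) sl.V :=
  (contMDiff_mul_left (I := 𝓘(ℝ, E)) (n := ∞) (a := g)).comp_contMDiffOn sl.contMDiffOn_τ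

variable {g}

theorem coord_mem {x : G} (hx : x ∈ sl.nhd g) : sl.coord g x ∈ sl.V := sl.κ_mem _ hx

theorem coord_mul {x : G} (hx : x ∈ sl.nhd g) (h : H) : sl.coord g (x * h) = sl.coord g x := by
  rw [coord, ← mul_assoc, sl.κ_mul _ hx, coord]

theorem fib_mul {x : G} (hx : x ∈ sl.nhd g) (h : H) : sl.fib g (x * h) = sl.fib g x * h := by
  rw [fib, ← mul_assoc, sl.η_mul _ hx, fib]

theorem coord_mul_τ {v : K} (hv : v ∈ sl.V) : sl.coord g (g * sl.τ v) = v := by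
  rw [coord, inv_mul_cancel_left, sl.κ_τ v hv]

theorem fib_mul_τ {v : K} (hv : v ∈ sl.V) : sl.fib g (g * sl.τ v) = 1 := by
  rw [fib, inv_mul_cancel_left, sl.η_τ v hv]

theorem mul_τ_coord_mul_fib {x : G} (hx : x ∈ sl.nhd g) :
    g * sl.τ (sl.coord g x) * sl.fib g x = x := by
  rw [coord, fib, mul_assoc, sl.τ_κ _ hx, mul_inv_cancel_left]

theorem fib_self : sl.fib g g = 1 := by
  rw [fib, inv_mul_cancel, sl.η_one]

variable (g) in
theorem mk_mem_image_nhd {x : G} :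
    (x : G ⧸ H) ∈ ((↑) : G → G ⧸ H) '' sl.nhd g ↔ x ∈ sl.nhd g := by
  refine ⟨?_, fun hx => ⟨x, hx, rfl⟩⟩
  rintro ⟨y, hy, hxy⟩
  have h := sl.mul_mem_nhd hy ⟨_, QuotientGroup.eq.1 hxy⟩
  simpa using h

end Slice

variable (E) in
include E in
theorem isOpenQuotientMap_mk (H : Subgroup G) : IsOpenQuotientMap ((↑) : G → G ⧸ H) := by
  have := topologicalGroup_of_lieGroup 𝓘(ℝ, E) (G := G) ∞
  exact QuotientGroup.isOpenQuotientMap_mk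

variable [LieGroup 𝓘(ℝ, EH) ∞ H]

/-- The local trivialization of `G → G ⧸ H` that is given by a slice, translated by `g`. -/
def homogeneousChart (hι : ContMDiff 𝓘(ℝ, EH) 𝓘(ℝ, E) ∞ (fun h : H => (h : G)))
    (sl : Slice E H EH K) (g : G) :
    PrincipalChart 𝓘(ℝ, E) ((↑) : G → G ⧸ H) K EH (1 : H) where
  W := ((↑) : G → G ⧸ H) '' sl.nhd g
  T := sl.V
  C := sl.coord g
  D := sl.fib g
  R := fun q => g * sl.τ q.1 * q.2
  isOpen_W := (isOpenQuotientMap_mk E H).isOpenMap _ (sl.isOpen_nhd g)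
  isOpen_T := sl.isOpen_V
  C_mem x hx := sl.coord_mem ((sl.mk_mem_image_nhd g).1 hx)
  C_eq x y hx hxy := by
    have h := sl.coord_mul ((sl.mk_mem_image_nhd g).1 hx) ⟨_, QuotientGroup.eq.1 hxy⟩
    simpa using h.symm
  π_R v hv a := (sl.mk_mem_image_nhd g).2 (sl.mul_mem_nhd (sl.mul_τ_mem_nhd g hv) a)
  π_R_eq v hv a := by
    rw [QuotientGroup.eq]
    simp [mul_assoc]
  C_R v hv a := by rw [sl.coord_mul (sl.mul_τ_mem_nhd g hv), sl.coord_mul_τ hv]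
  D_R v hv a := by rw [sl.fib_mul (sl.mul_τ_mem_nhd g hv), sl.fib_mul_τ hv, one_mul]
  R_C_D x hx := sl.mul_τ_coord_mul_fib ((sl.mk_mem_image_nhd g).1 hx)
  contMDiffOn_C := (sl.contMDiffOn_coord g).mono fun _ hx => (sl.mk_mem_image_nhd g).1 hx
  contMDiffOn_D := (sl.contMDiffOn_fib g).mono fun _ hx => (sl.mk_mem_image_nhd g).1 hx
  contMDiffOn_R := ContMDiffOn.mul
    ((sl.contMDiffOn_mul_τ g).comp contMDiff_fst.contMDiffOn fun _ hq => hq.1)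
    (hι.comp contMDiff_snd).contMDiffOn

end Homogeneous

/-! ### The action of `H` on the total space and the charts of the induced space. -/

namespace InvariantSplitting

set_option linter.unusedSectionVars false

variable {E : Type*} [NormedAddCommGroup E] [NormedSpace ℝ E]
  {G : Type*} [TopologicalSpace G] [ChartedSpace E G] [Group G]
  {F : Type*} [NormedAddCommGroup F] [NormedSpace ℝ F] [CompleteSpace F]
  {Q : InvariantPredual E G F} {H : Subgroup G}
  {EH : Type*} [NormedAddCommGroup EH] [NormedSpace ℝ EH] [ChartedSpace EH H]
  (S : InvariantSplitting Q H EH)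
  {EP : Type*} [NormedAddCommGroup EP] [NormedSpace ℝ EP]
  {P : Type*} [TopologicalSpace P] [ChartedSpace EP P] [MulAction H P]
  [LieGroup 𝓘(ℝ, E) ∞ G] [LieGroup 𝓘(ℝ, EH) ∞ H]

variable (EP) in
/-- The model of `G × P × 𝔥_*^⊥`. -/
abbrev totalModel (_S : InvariantSplitting Q H EH) :
    ModelWithCorners ℝ (E × EP × _S.perp) (ModelProd E (ModelProd EP _S.perp)) :=
  𝓘(ℝ, E).prod (𝓘(ℝ, EP).prod 𝓘(ℝ, _S.perp))

theorem coAdPerp_mul (h k : H) (ρ : S.perp) :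
    S.coAdPerp (h * k) ρ = S.coAdPerp k (S.coAdPerp h ρ) :=
  Subtype.ext (Q.coAd_mul _ _ _)

theorem coAdPerp_one (ρ : S.perp) : S.coAdPerp 1 ρ = ρ :=
  Subtype.ext (Q.coAd_one _)

variable (hι : ContMDiff 𝓘(ℝ, EH) 𝓘(ℝ, E) ∞ (fun h : H => (h : G)))

include hι in
theorem contMDiff_coAdPerp :
    ContMDiff (𝓘(ℝ, EH).prod 𝓘(ℝ, S.perp)) 𝓘(ℝ, S.perp) ∞
      (fun q : H × S.perp => S.coAdPerp q.1 q.2) := by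
  have h1 : ContMDiff (𝓘(ℝ, EH).prod 𝓘(ℝ, S.perp)) 𝓘(ℝ, S.perp) ∞
      (fun q : H × S.perp => S.coAdPerpL q.1 q.2) :=
    ContMDiff.clm_apply ((S.contMDiff_coAdPerpL hι).comp contMDiff_fst) contMDiff_snd
  simpa only [coAdPerpL_apply] using h1

variable [ContMDiffSMul 𝓘(ℝ, EH) 𝓘(ℝ, EP) ∞ H P]

include hι in
theorem contMDiff_act :
    ContMDiff (𝓘(ℝ, EH).prod (S.totalModel EP)) (S.totalModel EP) ∞
      (fun q : H × G × P × S.perp => S.act q.1 q.2) := by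
  refine ContMDiff.prodMk ?_ (ContMDiff.prodMk ?_ ?_)
  · exact ContMDiff.mul (contMDiff_fst.comp contMDiff_snd) (hι.comp contMDiff_fst).inv
  · exact (contMDiff_smul (I := 𝓘(ℝ, EH)) (I' := 𝓘(ℝ, EP)) (G := H) (M := P)).comp
      (contMDiff_fst.prodMk (contMDiff_fst.comp (contMDiff_snd.comp contMDiff_snd)))
  · have h1 : ContMDiff (𝓘(ℝ, EH).prod (S.totalModel EP)) 𝓘(ℝ, EH) ∞
        (fun q : H × G × P × S.perp => q.1⁻¹) := contMDiff_fst.inv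
    have h2 : ContMDiff (𝓘(ℝ, EH).prod (S.totalModel EP)) 𝓘(ℝ, S.perp) ∞
        (fun q : H × G × P × S.perp => q.2.2.2) :=
      contMDiff_snd.comp (contMDiff_snd.comp contMDiff_snd)
    exact ContMDiff.comp (g := fun q : H × S.perp => S.coAdPerp q.1 q.2)
      (f := fun q : H × G × P × S.perp => (q.1⁻¹, q.2.2.2)) (S.contMDiff_coAdPerp hι)
      (h1.prodMk h2)

include hι in
theorem contMDiff_act_right (h : H) :
    ContMDiff (S.totalModel EP) (S.totalModel EP) ∞ (fun q : G × P × S.perp => S.act h q) :=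
  (S.contMDiff_act hι).comp (contMDiff_const.prodMk contMDiff_id)

include hι in
theorem contMDiff_act_left (q : G × P × S.perp) :
    ContMDiff 𝓘(ℝ, EH) (S.totalModel EP) ∞ (fun h : H => S.act h q) :=
  (S.contMDiff_act hι).comp (contMDiff_id.prodMk contMDiff_const)

theorem proj₀_eq_iff {q r : G × P × S.perp} :
    S.proj₀ q = S.proj₀ r ↔ ∃ h : H, S.act h q = r :=
  Quotient.eq (r := S.inducedSetoid P)

theorem proj₀_act (h : H) (q : G × P × S.perp) : S.proj₀ (S.act h q) = S.proj₀ q :=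
  (S.proj₀_eq_iff.2 ⟨h, rfl⟩).symm

-- The saturation of an open set is the union of its translates, each of which is open.
include hι EP in
theorem isOpenQuotientMap_proj₀ :
    IsOpenQuotientMap (fun q : G × P × S.perp => S.proj₀ q) := by
  refine ⟨Quotient.mk_surjective, continuous_quotient_mk', ?_⟩
  intro U hU
  refine isOpen_coinduced.2 ?_
  have h1 : (Quotient.mk (S.inducedSetoid P) ⁻¹' ((fun q : G × P × S.perp => S.proj₀ q) '' U))
      = ⋃ h : H, (fun q : G × P × S.perp => S.act h q) ⁻¹' U := by
    ext q
    simp only [Set.mem_preimage, Set.mem_iUnion]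
    constructor
    · rintro ⟨r, hr, hqr⟩
      obtain ⟨h, rfl⟩ := S.proj₀_eq_iff.1 hqr.symm
      exact ⟨h, hr⟩
    · rintro ⟨h, hh⟩
      exact ⟨_, hh, S.proj₀_act h q⟩
  exact h1 ▸ isOpen_iUnion fun h => hU.preimage (S.contMDiff_act_right (EP := EP) hι h).continuous

section Chart

variable (sl : Slice E H EH (S.perp →L[ℝ] ℝ)) (g : G) [IsManifold 𝓘(ℝ, EP) ∞ P]

/-- The representative of a point of the induced space over the neighbourhood `g U` whose first
component lies on the slice through `g`. -/
def fibre (q : G × P × S.perp) : P × S.perp :=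
  (sl.fib g q.1 • q.2.1, S.coAdPerp (sl.fib g q.1)⁻¹ q.2.2)

-- Acting with `h` multiplies the `H`-component of the slice decomposition by `h⁻¹` on the right,
-- and this cancels the action of `h` on the other two factors. Hence the fibre coordinate descends
-- to the quotient.
variable {g} in
theorem fibre_act {q : G × P × S.perp} (hq : q.1 ∈ sl.nhd g) (h : H) :
    S.fibre sl g (S.act h q) = S.fibre sl g q := by
  have h1 : sl.fib g (q.1 * (h : G)⁻¹) = sl.fib g q.1 * h⁻¹ := by
    simpa using sl.fib_mul hq h⁻¹
  simp only [fibre, act, h1, mul_inv_rev, inv_inv]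
  rw [smul_smul, inv_mul_cancel_right, ← S.coAdPerp_mul, inv_mul_cancel_left]

theorem fibre_mul_τ {v : S.perp →L[ℝ] ℝ} (hv : v ∈ sl.V) (f : P × S.perp) :
    S.fibre sl g (g * sl.τ v, f) = f := by
  simp [fibre, sl.fib_mul_τ hv, S.coAdPerp_one]

variable {g} in
theorem act_mul_τ_fibre {q : G × P × S.perp} (hq : q.1 ∈ sl.nhd g) :
    S.act (sl.fib g q.1)⁻¹ (g * sl.τ (sl.coord g q.1), S.fibre sl g q) = q := by
  have h1 := sl.mul_τ_coord_mul_fib hq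
  simp only [act, fibre, Subgroup.coe_inv, inv_inv, h1, inv_smul_smul]
  rw [← S.coAdPerp_mul, inv_mul_cancel, S.coAdPerp_one]

include hι in
theorem contMDiffOn_fibre :
    ContMDiffOn (S.totalModel EP) (𝓘(ℝ, EP).prod 𝓘(ℝ, S.perp)) ∞
      (fun q : G × P × S.perp => S.fibre sl g q) (Prod.fst ⁻¹' sl.nhd g) := by
  have h1 : ContMDiffOn (S.totalModel EP) 𝓘(ℝ, EH) ∞
      (fun q : G × P × S.perp => sl.fib g q.1) (Prod.fst ⁻¹' sl.nhd g) :=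
    (sl.contMDiffOn_fib g).comp contMDiff_fst.contMDiffOn (fun _ hq => hq)
  refine ContMDiffOn.prodMk ?_ ?_
  · exact (contMDiff_smul (I := 𝓘(ℝ, EH)) (I' := 𝓘(ℝ, EP)) (G := H) (M := P)).comp_contMDiffOn
      (h1.prodMk (contMDiff_fst.comp contMDiff_snd).contMDiffOn)
  · have h2 : ContMDiffOn (S.totalModel EP) 𝓘(ℝ, EH) ∞
        (fun q : G × P × S.perp => (sl.fib g q.1)⁻¹) (Prod.fst ⁻¹' sl.nhd g) := h1.inv
    have h3 : ContMDiff (S.totalModel EP) 𝓘(ℝ, S.perp) ∞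
        (fun q : G × P × S.perp => q.2.2) := contMDiff_snd.comp contMDiff_snd
    exact ContMDiff.comp_contMDiffOn (g := fun q : H × S.perp => S.coAdPerp q.1 q.2)
      (f := fun q : G × P × S.perp => ((sl.fib g q.1)⁻¹, q.2.2)) (S.contMDiff_coAdPerp hι)
      (h2.prodMk h3.contMDiffOn)

theorem mem_nhd_act {q : G × P × S.perp} (hq : q.1 ∈ sl.nhd g) (h : H) :
    (S.act h q).1 ∈ sl.nhd g := by
  simpa [act] using sl.mul_mem_nhd hq h⁻¹

/-- The domain of a chart of the induced space, in the total space. -/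
def chartDomain (p : P) : Set (G × P × S.perp) :=
  {q | q.1 ∈ sl.nhd g ∧ (S.fibre sl g q).1 ∈ (extChartAt 𝓘(ℝ, EP) p).source}

theorem proj₀_mem_image_chartDomain (p : P) {q : G × P × S.perp} :
    S.proj₀ q ∈ (fun q : G × P × S.perp => S.proj₀ q) '' S.chartDomain (EP := EP) sl g p ↔
      q ∈ S.chartDomain (EP := EP) sl g p := by
  refine ⟨?_, fun h => ⟨q, h, rfl⟩⟩
  rintro ⟨r, hr, hrq⟩
  obtain ⟨h, rfl⟩ := S.proj₀_eq_iff.1 hrq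
  exact ⟨S.mem_nhd_act sl g hr.1 h, by rw [S.fibre_act sl hr.1]; exact hr.2⟩

include hι in
theorem isOpen_chartDomain (p : P) : IsOpen (S.chartDomain (EP := EP) sl g p) :=
  (continuous_fst.comp_continuousOn (S.contMDiffOn_fibre (EP := EP) hι sl g).continuousOn
    ).isOpen_inter_preimage ((sl.isOpen_nhd g).preimage continuous_fst)
    (isOpen_extChartAt_source p)

/-- The section over a chart of the induced space. -/
def chartSection (p : P) (w : S.Model EP) : G × P × S.perp :=
  (g * sl.τ w.1, (extChartAt 𝓘(ℝ, EP) p).symm w.2.1, w.2.2)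

theorem contMDiffOn_chartSection (p : P) :
    ContMDiffOn 𝓘(ℝ, S.Model EP) (S.totalModel EP) ∞ (S.chartSection (EP := EP) sl g p)
      (sl.V ×ˢ (extChartAt 𝓘(ℝ, EP) p).target ×ˢ Set.univ) := by
  refine ContMDiffOn.prodMk ?_ (ContMDiffOn.prodMk ?_ ?_)
  · exact (sl.contMDiffOn_mul_τ g).comp contDiff_fst.contMDiff.contMDiffOn (fun _ hw => hw.1)
  · exact (contMDiffOn_extChartAt_symm (I := 𝓘(ℝ, EP)) p).comp
      (contDiff_fst.comp contDiff_snd).contMDiff.contMDiffOn (fun _ hw => hw.2.1)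
  · exact (contDiff_snd.comp contDiff_snd).contMDiff.contMDiffOn

/-- The local trivialization of `G × P × 𝔥_*^⊥` over the induced space that is given by a slice
and a chart of `P`. -/
def inducedChart (p : P) :
    PrincipalChart (S.totalModel EP) (fun q : G × P × S.perp => S.proj₀ q) (S.Model EP) EH
      (1 : H) where
  W := (fun q : G × P × S.perp => S.proj₀ q) '' S.chartDomain (EP := EP) sl g p
  T := sl.V ×ˢ (extChartAt 𝓘(ℝ, EP) p).target ×ˢ Set.univ
  C q := (sl.coord g q.1, extChartAt 𝓘(ℝ, EP) p (S.fibre sl g q).1, (S.fibre sl g q).2)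
  -- The inverse appears because `h` acts on `G` by right multiplication with `h⁻¹`.
  D q := (sl.fib g q.1)⁻¹
  R w := S.act w.2 (S.chartSection sl g p w.1)
  isOpen_W := (S.isOpenQuotientMap_proj₀ (EP := EP) hι).isOpenMap _
    (S.isOpen_chartDomain (EP := EP) hι sl g p)
  isOpen_T := sl.isOpen_V.prod ((isOpen_extChartAt_target p).prod isOpen_univ)
  C_mem q hq := by
    have h := (S.proj₀_mem_image_chartDomain (EP := EP) sl g p).1 hq
    exact ⟨sl.coord_mem h.1, (extChartAt 𝓘(ℝ, EP) p).map_source h.2, Set.mem_univ _⟩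
  C_eq q r hq hqr := by
    have h := (S.proj₀_mem_image_chartDomain (EP := EP) sl g p).1 hq
    obtain ⟨a, rfl⟩ := S.proj₀_eq_iff.1 hqr
    rw [S.fibre_act sl h.1]
    have h1 := sl.coord_mul h.1 a⁻¹
    rw [Subgroup.coe_inv] at h1
    exact congrArg (fun k => (k, _)) h1.symm
  π_R w hw a := by
    rw [S.proj₀_act, S.proj₀_mem_image_chartDomain (EP := EP) sl g p]
    refine ⟨sl.mul_τ_mem_nhd g hw.1, ?_⟩
    rw [chartSection, S.fibre_mul_τ sl g hw.1]
    exact (extChartAt 𝓘(ℝ, EP) p).map_target hw.2.1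
  π_R_eq w hw a := by rw [S.proj₀_act, S.proj₀_act]
  C_R w hw a := by
    have h1 : (S.chartSection (EP := EP) sl g p w).1 ∈ sl.nhd g := sl.mul_τ_mem_nhd g hw.1
    have h2 := sl.coord_mul h1 a⁻¹
    rw [Subgroup.coe_inv] at h2
    rw [S.fibre_act sl h1]
    refine Prod.ext (h2.trans (sl.coord_mul_τ hw.1)) ?_
    rw [chartSection, S.fibre_mul_τ sl g hw.1]
    exact Prod.ext ((extChartAt 𝓘(ℝ, EP) p).right_inv hw.2.1) rfl
  D_R w hw a := by
    have h1 : (S.chartSection (EP := EP) sl g p w).1 ∈ sl.nhd g := sl.mul_τ_mem_nhd g hw.1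
    have h2 := sl.fib_mul h1 a⁻¹
    rw [Subgroup.coe_inv, chartSection, sl.fib_mul_τ hw.1, one_mul] at h2
    simp only [act, chartSection]
    rw [h2, inv_inv]
  R_C_D q hq := by
    have h := (S.proj₀_mem_image_chartDomain (EP := EP) sl g p).1 hq
    refine Eq.trans ?_ (S.act_mul_τ_fibre sl h.1)
    simp only [chartSection]
    rw [(extChartAt 𝓘(ℝ, EP) p).left_inv h.2]
  contMDiffOn_C := by
    have hm : ∀ q ∈ (fun q : G × P × S.perp => S.proj₀ q) ⁻¹'
        ((fun q : G × P × S.perp => S.proj₀ q) '' S.chartDomain (EP := EP) sl g p),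
        q ∈ S.chartDomain (EP := EP) sl g p := fun q hq =>
      (S.proj₀_mem_image_chartDomain (EP := EP) sl g p).1 hq
    have hf := (S.contMDiffOn_fibre (EP := EP) hι sl g).mono (fun q hq => (hm q hq).1)
    refine ContMDiffOn.prodMk_space ?_ (ContMDiffOn.prodMk_space ?_ ?_)
    · exact (sl.contMDiffOn_coord g).comp contMDiff_fst.contMDiffOn (fun q hq => (hm q hq).1)
    · exact (contMDiffOn_extChartAt (I := 𝓘(ℝ, EP)) (x := p)).comp
        (contMDiff_fst.comp_contMDiffOn hf) (fun q hq => by simpa using (hm q hq).2)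
    · exact contMDiff_snd.comp_contMDiffOn hf
  contMDiffOn_D := by
    refine ContMDiffOn.inv ((sl.contMDiffOn_fib g).comp contMDiff_fst.contMDiffOn ?_)
    exact fun q hq => ((S.proj₀_mem_image_chartDomain (EP := EP) sl g p).1 hq).1
  contMDiffOn_R := (S.contMDiff_act hι).comp_contMDiffOn
    (contMDiff_snd.contMDiffOn.prodMk ((S.contMDiffOn_chartSection sl g p).comp
      contMDiff_fst.contMDiffOn (fun _ hq => hq.1)))

end Chart

end InvariantSplitting

/-! ### The Hausdorff property, the reduced space and the bundle over the homogeneous space. -/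

namespace InvariantSplitting

set_option linter.unusedSectionVars false

variable {E : Type*} [NormedAddCommGroup E] [NormedSpace ℝ E]
  {G : Type*} [TopologicalSpace G] [ChartedSpace E G] [Group G]
  {F : Type*} [NormedAddCommGroup F] [NormedSpace ℝ F] [CompleteSpace F]
  {Q : InvariantPredual E G F} {H : Subgroup G}
  {EH : Type*} [NormedAddCommGroup EH] [NormedSpace ℝ EH] [ChartedSpace EH H]
  (S : InvariantSplitting Q H EH)
  {EP : Type*} [NormedAddCommGroup EP] [NormedSpace ℝ EP]
  {P : Type*} [TopologicalSpace P] [ChartedSpace EP P] [MulAction H P]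
  [LieGroup 𝓘(ℝ, E) ∞ G] [LieGroup 𝓘(ℝ, EH) ∞ H]

/-- A representative of a point of the induced space. -/
def rep (m : S.InducedSpace P) : G × P × S.perp := Quotient.out m

theorem proj₀_rep (m : S.InducedSpace P) : S.proj₀ (S.rep m) = m := Quotient.out_eq m

theorem toBase_proj₀ (q : G × P × S.perp) : S.toBase (S.proj₀ q) = (q.1 : G ⧸ H) := rfl

theorem smul_proj₀ (g : G) (q : G × P × S.perp) : g • S.proj₀ q = S.proj₀ (g * q.1, q.2) := rfl

variable (hι : ContMDiff 𝓘(ℝ, EH) 𝓘(ℝ, E) ∞ (fun h : H => (h : G)))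
  [ContMDiffSMul 𝓘(ℝ, EH) 𝓘(ℝ, EP) ∞ H P]

-- For an open quotient map the Hausdorff property means that the relation is closed. Equivalent
-- pairs lie in the closed set where `g₂⁻¹ g₁ ∈ H`. On it the element that carries one point to the
-- other is determined and continuous, so equivalence becomes an equation between continuous maps
-- into Hausdorff spaces.
include hι EP in
theorem t2Space_inducedSpace (hH : IsClosed (H : Set G)) [T2Space P] :
    T2Space (S.InducedSpace P) := by
  have := topologicalGroup_of_lieGroup 𝓘(ℝ, E) (G := G) ∞
  have hsm : Continuous (fun q : H × P => q.1 • q.2) :=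
    (contMDiff_smul (I := 𝓘(ℝ, EH)) (I' := 𝓘(ℝ, EP)) (n := ∞) (G := H) (M := P)).continuous
  have hco := (S.contMDiff_coAdPerp hι).continuous
  rw [t2Space_iff_of_isOpenQuotientMap (S.isOpenQuotientMap_proj₀ (EP := EP) hι)]
  let Z : Set ((G × P × S.perp) × (G × P × S.perp)) := {r | r.2.1⁻¹ * r.1.1 ∈ H}
  have hZ : IsClosed Z := hH.preimage (by fun_prop)
  let a : Z → H := fun r => ⟨r.1.2.1⁻¹ * r.1.1.1, r.2⟩
  have ha : Continuous a := Continuous.subtype_mk (by fun_prop) _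
  have h1 : IsClosed {r : Z | a r • r.1.1.2.1 = r.1.2.2.1 ∧
      S.coAdPerp (a r)⁻¹ r.1.1.2.2 = r.1.2.2.2} := by
    have h2 : Continuous fun r : Z => r.1.1.2.1 := by fun_prop
    have h3 : Continuous fun r : Z => r.1.1.2.2 := by fun_prop
    have h4 : Continuous fun r : Z => a r • r.1.1.2.1 :=
      Continuous.comp (g := fun q : H × P => q.1 • q.2) hsm (ha.prodMk h2)
    have hai : Continuous fun r : Z => (a r)⁻¹ := ha.inv
    have h5 : Continuous ((fun q : H × S.perp => S.coAdPerp q.1 q.2) ∘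
        fun r : Z => ((a r)⁻¹, r.1.1.2.2)) := hco.comp (hai.prodMk h3)
    exact IsClosed.inter (isClosed_eq h4 (by fun_prop)) (isClosed_eq h5 (by fun_prop))
  convert hZ.isClosedMap_subtype_val _ h1 using 1
  ext ⟨q, r⟩
  simp only [Set.mem_ofPred_eq, Set.mem_image]
  rw [S.proj₀_eq_iff]
  constructor
  · rintro ⟨h, rfl⟩
    have h2 : (S.act h q).1⁻¹ * q.1 = h := by simp [act]
    have h3 : (S.act h q).1⁻¹ * q.1 ∈ H := h2 ▸ h.2
    refine ⟨⟨(q, S.act h q), h3⟩, ?_, rfl⟩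
    have h4 : a ⟨(q, S.act h q), h3⟩ = h := Subtype.ext h2
    rw [h4]
    exact ⟨rfl, rfl⟩
  · rintro ⟨⟨r', hr⟩, ⟨h2, h3⟩, rfl⟩
    refine ⟨a ⟨(q, r), hr⟩, ?_⟩
    refine Prod.ext ?_ (Prod.ext h2 h3)
    simp [act, a]

/-- The induced space is homeomorphic to the reduced space. -/
theorem exists_homeomorph_reducedSpace (J : P → S.sub) (hJ : Continuous J)
    (hJe : ∀ (h : H) (p : P), J (h • p) = S.coAdSub h⁻¹ (J p)) :
    ∃ Θ : S.InducedSpace P ≃ₜ S.ReducedSpace J, ∀ (g : G) (p : P) (ρ : S.perp),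
        ∃ hq : (p, g, (J p : F) + (ρ : F)) ∈ S.zeroLevel J,
          Θ (S.proj₀ (g, p, ρ)) = Quotient.mk (S.reducedSetoid J) ⟨_, hq⟩ := by
  have hmem : ∀ (g : G) (p : P) (ρ : S.perp), (p, g, (J p : F) + (ρ : F)) ∈ S.zeroLevel J := by
    intro g p ρ
    simp only [zeroLevel, Set.mem_ofPred_eq, proj_eq_subProj, map_add, subProj_sub, subProj_perp,
      add_zero, sub_self]
  let f : G × P × S.perp → S.zeroLevel J := fun q => ⟨(q.2.1, q.1, (J q.2.1 : F) + (q.2.2 : F)),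
    hmem q.1 q.2.1 q.2.2⟩
  -- On the zero level set the component in `𝔥_*` is `J p`, so only the component in `𝔥_*^⊥` has to
  -- be remembered.
  let k : S.zeroLevel J → G × P × S.perp := fun r => (r.1.2.1, r.1.1, S.perpProj r.1.2.2)
  have hf : Continuous f := by
    refine Continuous.subtype_mk ?_ _
    fun_prop
  have hk : Continuous k := by fun_prop
  have hkf : ∀ q, k (f q) = q := by
    rintro ⟨g, p, ρ⟩
    simp only [k, f, map_add, perpProj_sub, perpProj_perp, zero_add]
  have hfk : ∀ r, f (k r) = r := by
    rintro ⟨⟨p, g, ρ⟩, hr⟩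
    have h1 : J p - S.subProj ρ = 0 := hr
    refine Subtype.ext ?_
    simp only [k, f]
    rw [sub_eq_zero.1 h1, S.subProj_add_perpProj]
  have hfeq : ∀ (h : H) (q : G × P × S.perp), (f (S.act h q)).1 = S.bigAct h (f q).1 := by
    rintro h ⟨g, p, ρ⟩
    simp only [f, act, bigAct, Q.coAd_add, hJe, coAdSub, coAdPerp, Subgroup.coe_inv]
  let f' : S.InducedSpace P → S.ReducedSpace J :=
    Quotient.map (sa := S.inducedSetoid P) (sb := S.reducedSetoid J) f (by
      rintro q _ ⟨h, rfl⟩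
      exact ⟨h, (hfeq h q).symm⟩)
  let k' : S.ReducedSpace J → S.InducedSpace P :=
    Quotient.map (sa := S.reducedSetoid J) (sb := S.inducedSetoid P) k (by
      rintro r r' ⟨h, hr⟩
      refine ⟨h, ?_⟩
      have h1 : f (S.act h (k r)) = r' := Subtype.ext (by rw [hfeq, hfk, hr])
      rw [← h1, hkf])
  refine ⟨{ toFun := f', invFun := k', left_inv := ?_, right_inv := ?_,
            continuous_toFun := ?_, continuous_invFun := ?_ },
    fun g p ρ => ⟨hmem g p ρ, rfl⟩⟩
  · intro m
    induction m using Quotient.inductionOn with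
    | h q => exact congrArg (Quotient.mk (S.inducedSetoid P)) (hkf q)
  · intro m
    induction m using Quotient.inductionOn with
    | h r => exact congrArg (Quotient.mk (S.reducedSetoid J)) (hfk r)
  · exact Continuous.quotient_map' hf _
  · exact Continuous.quotient_map' hk _

variable [IsManifold 𝓘(ℝ, EP) ∞ P] (sl : Slice E H EH (S.perp →L[ℝ] ℝ))

/-- The local trivializations that define the smooth structure of the induced space. -/
def inducedAtlas (m : S.InducedSpace P) :
    PrincipalChart (S.totalModel EP) (fun q : G × P × S.perp => S.proj₀ q) (S.Model EP) EH
      (1 : H) :=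
  S.inducedChart hι sl (S.rep m).1 (S.rep m).2.1

theorem mem_inducedAtlas (m : S.InducedSpace P) : m ∈ (S.inducedAtlas (EP := EP) hι sl m).W := by
  have h : S.proj₀ (S.rep m) ∈ (S.inducedAtlas (EP := EP) hι sl m).W := by
    refine (S.proj₀_mem_image_chartDomain (EP := EP) sl _ _).2 ⟨sl.self_mem_nhd _, ?_⟩
    rw [fibre, sl.fib_self, one_smul]
    exact mem_extChartAt_source _
  rwa [S.proj₀_rep] at h

variable [ChartedSpace (S.perp →L[ℝ] ℝ) (G ⧸ H)] [IsManifold 𝓘(ℝ, S.perp →L[ℝ] ℝ) ∞ (G ⧸ H)]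
  [ChartedSpace (S.Model EP) (S.InducedSpace P)]
  [IsManifold 𝓘(ℝ, S.Model EP) ∞ (S.InducedSpace P)]

/-- The local trivializations of the induced space over `G ⧸ H`. -/
theorem exists_trivialization
    (hB : ∀ b : G ⧸ H, chartAt (S.perp →L[ℝ] ℝ) b
      = (homogeneousChart hι sl b.out).baseChart (isOpenQuotientMap_mk E H))
    (hM : ∀ m : S.InducedSpace P, chartAt (S.Model EP) m
      = (S.inducedAtlas hι sl m).baseChart (S.isOpenQuotientMap_proj₀ (EP := EP) hι))
    (b : G ⧸ H) : ∃ (s : G ⧸ H → G)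
        (t : Bundle.Trivialization (P × S.perp) (S.toBase : S.InducedSpace P → G ⧸ H)),
        b ∈ t.baseSet ∧
        ContMDiffOn 𝓘(ℝ, S.perp →L[ℝ] ℝ) 𝓘(ℝ, E) ∞ s t.baseSet ∧
        (∀ u ∈ t.baseSet, (s u : G ⧸ H) = u) ∧
        (∀ u ∈ t.baseSet, ∀ f : P × S.perp,
          t.toOpenPartialHomeomorph.symm (u, f) = S.proj₀ (s u, f)) ∧
        ContMDiffOn 𝓘(ℝ, S.Model EP)
          (𝓘(ℝ, S.perp →L[ℝ] ℝ).prod (𝓘(ℝ, EP).prod 𝓘(ℝ, S.perp))) ∞ t t.source ∧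
        ContMDiffOn (𝓘(ℝ, S.perp →L[ℝ] ℝ).prod (𝓘(ℝ, EP).prod 𝓘(ℝ, S.perp)))
          𝓘(ℝ, S.Model EP) ∞ t.toOpenPartialHomeomorph.symm t.target := by
  let c := homogeneousChart hι sl b.out
  let s : G ⧸ H → G := fun u => c.σ (extChartAt 𝓘(ℝ, S.perp →L[ℝ] ℝ) b u)
  have hs : ContMDiffOn 𝓘(ℝ, S.perp →L[ℝ] ℝ) 𝓘(ℝ, E) ∞ s c.W :=
    PrincipalChart.contMDiffOn_section
      (c := fun b : G ⧸ H => homogeneousChart hι sl b.out) hB b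
  have hsu : ∀ u ∈ c.W, (s u : G ⧸ H) = u := fun u hu => PrincipalChart.proj_section
    (c := fun b : G ⧸ H => homogeneousChart hι sl b.out) hB b hu
  have hbW : b ∈ c.W := PrincipalChart.mem_W
    (c := fun b : G ⧸ H => homogeneousChart hι sl b.out) hB b
  have hW : ∀ x : G, (x : G ⧸ H) ∈ c.W ↔ x ∈ sl.nhd b.out := fun x => sl.mk_mem_image_nhd _
  have hsx : ∀ x : G, x ∈ sl.nhd b.out → s x = b.out * sl.τ (sl.coord b.out x) := by
    intro x hx
    have h1 := PrincipalChart.extChartAt_apply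
      (c := fun b : G ⧸ H => homogeneousChart hι sl b.out) hB b ((hW x).2 hx)
    simp only [s, h1]
    exact mul_one _
  have hfibs : ∀ u ∈ c.W, sl.fib b.out (s u) = 1 := by
    intro u hu
    obtain ⟨x, rfl⟩ := (isOpenQuotientMap_mk E H).surjective u
    rw [hsx x ((hW x).1 hu)]
    exact sl.fib_mul_τ (sl.coord_mem ((hW x).1 hu))
  -- The choice of representative is harmless over the neighbourhood, where the fibre coordinate is
  -- `H`-invariant.
  let k : S.InducedSpace P → P × S.perp := fun m => S.fibre sl b.out (S.rep m)
  have hk : ∀ q : G × P × S.perp, q.1 ∈ sl.nhd b.out →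
      k (S.proj₀ q) = S.fibre sl b.out q := by
    intro q hq
    obtain ⟨h, hh⟩ := S.proj₀_eq_iff.1 (S.proj₀_rep (S.proj₀ q)).symm
    simp only [k]
    rw [← hh, S.fibre_act sl hq]
  have hπ := S.isOpenQuotientMap_proj₀ (EP := EP) (P := P) hι
  have hbase : ContMDiff 𝓘(ℝ, S.Model EP) 𝓘(ℝ, S.perp →L[ℝ] ℝ) ∞
      (S.toBase : S.InducedSpace P → G ⧸ H) := by
    refine PrincipalChart.contMDiff_of_comp_proj hM ?_
    exact (PrincipalChart.contMDiff_proj (I := 𝓘(ℝ, E))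
      (c := fun b : G ⧸ H => homogeneousChart hι sl b.out) hB).comp contMDiff_fst
  have hto : ContMDiffOn 𝓘(ℝ, S.Model EP)
      (𝓘(ℝ, S.perp →L[ℝ] ℝ).prod (𝓘(ℝ, EP).prod 𝓘(ℝ, S.perp))) ∞
      (fun m : S.InducedSpace P => (S.toBase m, k m)) (S.toBase ⁻¹' c.W) := by
    refine hbase.contMDiffOn.prodMk ?_
    refine PrincipalChart.contMDiffOn_of_comp_proj hM (c.isOpen_W.preimage hbase.continuous) ?_
    refine ((S.contMDiffOn_fibre (EP := EP) hι sl b.out).mono fun q hq => ?_).congr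
      fun q hq => hk q ((hW _).1 hq)
    exact (hW _).1 hq
  have hinv : ContMDiffOn (𝓘(ℝ, S.perp →L[ℝ] ℝ).prod (𝓘(ℝ, EP).prod 𝓘(ℝ, S.perp)))
      𝓘(ℝ, S.Model EP) ∞ (fun r : (G ⧸ H) × P × S.perp => S.proj₀ (s r.1, r.2))
      (c.W ×ˢ Set.univ) := by
    refine (PrincipalChart.contMDiff_proj hM).comp_contMDiffOn
      (f := fun r : (G ⧸ H) × P × S.perp => (s r.1, r.2)) ?_
    exact (hs.comp contMDiff_fst.contMDiffOn (fun _ hr => hr.1)).prodMk contMDiff_snd.contMDiffOn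
  let t : Bundle.Trivialization (P × S.perp) (S.toBase : S.InducedSpace P → G ⧸ H) :=
    { toFun := fun m => (S.toBase m, k m)
      invFun := fun r => S.proj₀ (s r.1, r.2)
      source := S.toBase ⁻¹' c.W
      target := c.W ×ˢ Set.univ
      map_source' := fun m hm => ⟨hm, Set.mem_univ _⟩
      map_target' := fun r hr => by
        rw [Set.mem_preimage, S.toBase_proj₀, hsu _ hr.1]
        exact hr.1
      left_inv' := fun m hm => by
        obtain ⟨q, rfl⟩ := hπ.surjective m
        have hq : q.1 ∈ sl.nhd b.out := (hW _).1 hm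
        show S.proj₀ (s (q.1 : G ⧸ H), k (S.proj₀ q)) = S.proj₀ q
        rw [hk q hq, hsx _ hq, S.proj₀_eq_iff]
        exact ⟨_, S.act_mul_τ_fibre sl hq⟩
      right_inv' := fun r hr => by
        have h1 : s r.1 ∈ sl.nhd b.out := (hW _).1 (by rw [hsu _ hr.1]; exact hr.1)
        rw [hk _ h1, S.toBase_proj₀, fibre, hfibs _ hr.1]
        refine Prod.ext (hsu _ hr.1) ?_
        simp [S.coAdPerp_one]
      open_source := c.isOpen_W.preimage hbase.continuous
      open_target := c.isOpen_W.prod isOpen_univ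
      continuousOn_toFun := hto.continuousOn
      continuousOn_invFun := hinv.continuousOn
      baseSet := c.W
      open_baseSet := c.isOpen_W
      source_eq := rfl
      target_eq := rfl
      proj_toFun := fun m _ => rfl }
  exact ⟨s, t, hbW, hs, hsu, fun u _ f => rfl, hto, hinv⟩

end InvariantSplitting

/-! ### Alternating forms of degree two and the form on the zero level set. -/

section AlternatingForms

variable {X : Type*} [NormedAddCommGroup X] [NormedSpace ℝ X]

/-- The alternating form `(u, w) ↦ β u w - β w u`. -/
def altOf (β : X →L[ℝ] X →L[ℝ] ℝ) : X [⋀^Fin 2]→L[ℝ] ℝ :=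
  ContinuousAlternatingMap.alternatizeUncurryFin
    (((ContinuousAlternatingMap.ofSubsingletonLIE (𝕜 := ℝ) (E := X) (F := ℝ) (i := (0 : Fin 1))).toContinuousLinearEquiv :
      (X →L[ℝ] ℝ) →L[ℝ] (X [⋀^Fin 1]→L[ℝ] ℝ)).comp β)

theorem altOf_apply (β : X →L[ℝ] X →L[ℝ] ℝ) (u w : X) :
    altOf β ![u, w] = β u w - β w u := by
  rw [altOf, ContinuousAlternatingMap.alternatizeUncurryFin_apply, Fin.sum_univ_two]
  simp [Fin.removeNth, sub_eq_add_neg]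

theorem form_add_left (f : X [⋀^Fin 2]→L[ℝ] ℝ) (u u' w : X) :
    f ![u + u', w] = f ![u, w] + f ![u', w] := by
  have h := f.map_update_add ![u, w] 0 u u'
  have e : ∀ x : X, Function.update ![u, w] 0 x = ![x, w] := fun x => by
    funext i
    fin_cases i <;> rfl
  rwa [e, e, e] at h

theorem form_swap (f : X [⋀^Fin 2]→L[ℝ] ℝ) (u w : X) : f ![u, w] = -f ![w, u] := by
  have h := f.map_swap ![w, u] (i := 0) (j := 1) (by decide)
  have e : ![w, u] ∘ (Equiv.swap 0 1 : Equiv.Perm (Fin 2)) = ![u, w] := by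
    funext i
    fin_cases i <;> rfl
  rwa [e] at h

theorem form_add_right (f : X [⋀^Fin 2]→L[ℝ] ℝ) (u w w' : X) :
    f ![u, w + w'] = f ![u, w] + f ![u, w'] := by
  rw [form_swap, form_add_left, form_swap f w, form_swap f w']
  ring

theorem form_comp {Y : Type*} [NormedAddCommGroup Y] [NormedSpace ℝ Y]
    (f : X [⋀^Fin 2]→L[ℝ] ℝ) (L : Y →L[ℝ] X) (u w : Y) :
    f.compContinuousLinearMap L ![u, w] = f ![L u, L w] := by
  rw [ContinuousAlternatingMap.compContinuousLinearMap_apply]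
  congr 1
  funext i
  fin_cases i <;> rfl

end AlternatingForms

namespace InvariantSplitting

set_option linter.unusedSectionVars false

variable {E : Type*} [NormedAddCommGroup E] [NormedSpace ℝ E]
  {G : Type*} [TopologicalSpace G] [ChartedSpace E G] [Group G]
  {F : Type*} [NormedAddCommGroup F] [NormedSpace ℝ F] [CompleteSpace F]
  {Q : InvariantPredual E G F} {H : Subgroup G}
  {EH : Type*} [NormedAddCommGroup EH] [NormedSpace ℝ EH] [ChartedSpace EH H]
  (S : InvariantSplitting Q H EH)
  {EP : Type*} [NormedAddCommGroup EP] [NormedSpace ℝ EP]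
  {P : Type*} [TopologicalSpace P] [ChartedSpace EP P] [MulAction H P]

/-- The derivative of a map into `𝔥_*`, on the model space. -/
def tJ (J : P → S.sub) (p : P) : EP →L[ℝ] F :=
  S.sub.subtypeL.comp (tderiv 𝓘(ℝ, EP) 𝓘(ℝ, S.sub) J p)

theorem tJ_mem_sub (J : P → S.sub) (p : P) (a : EP) : S.tJ J p a ∈ S.sub :=
  (tderiv 𝓘(ℝ, EP) 𝓘(ℝ, S.sub) J p a).2

variable (H) in
/-- The infinitesimal generator, on the model space. -/
def gen (EH : Type*) [NormedAddCommGroup EH] [NormedSpace ℝ EH] [ChartedSpace EH H]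
    {EP : Type*} [NormedAddCommGroup EP] [NormedSpace ℝ EP]
    {P : Type*} [TopologicalSpace P] [ChartedSpace EP P] [MulAction H P] (p : P) : EH →L[ℝ] EP :=
  tderiv 𝓘(ℝ, EH) 𝓘(ℝ, EP) (fun h : H => h • p) 1

/-- A two-form on `P`, on the model space. -/
def formAt (ωP : TwoForm EP P) (p : P) : EP [⋀^Fin 2]→L[ℝ] ℝ := ωP p

/-- The left trivialization of the first component. -/
def trivL (_S : InvariantSplitting Q H EH) (EP : Type*) [NormedAddCommGroup EP] [NormedSpace ℝ EP]
    (g : G) : (E × EP × _S.perp) →L[ℝ] E :=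
  (leftTInv E g).comp (ContinuousLinearMap.fst ℝ E (EP × _S.perp))

/-- The derivative of `(g, p, ρ) ↦ J p + ρ`. -/
def momL (J : P → S.sub) (p : P) : (E × EP × S.perp) →L[ℝ] F :=
  ((S.tJ J p).comp (ContinuousLinearMap.fst ℝ EP S.perp)
    + S.perp.subtypeL.comp (ContinuousLinearMap.snd ℝ EP S.perp)).comp
      (ContinuousLinearMap.snd ℝ E (EP × S.perp))

variable [LieGroup 𝓘(ℝ, E) ∞ G]

variable (Q) in
/-- The bilinear form `(x, y) ↦ ⟨ρ, [x, y]⟩`. -/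
def brkPair (ρ : F) : E →L[ℝ] E →L[ℝ] ℝ :=
  (ContinuousLinearMap.compL ℝ E E ℝ
    ((ContinuousLinearMap.apply ℝ ℝ ρ).comp (Q.isoE : E →L[ℝ] (F →L[ℝ] ℝ)))).comp (brkL E G)

theorem brkPair_apply (ρ : F) (x y : E) : brkPair Q ρ x y = Q.isoE (brk G x y) ρ := by
  rw [← brkL_apply]; rfl

/-- Half of the bilinear form whose antisymmetrization is the canonical part of the form
`ω ⊕ ω_L`. -/
def halfForm (J : P → S.sub) (q : G × P × S.perp) :
    (E × EP × S.perp) →L[ℝ] (E × EP × S.perp) →L[ℝ] ℝ :=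
  ((ContinuousLinearMap.compL ℝ (E × EP × S.perp) F ℝ).flip (S.momL J q.2.1)).comp
      ((Q.isoE : E →L[ℝ] (F →L[ℝ] ℝ)).comp (S.trivL EP q.1))
    -- The bracket term is already antisymmetric and would be doubled by antisymmetrization.
    + (2⁻¹ : ℝ) • (brkPair Q ((J q.2.1 : F) + q.2.2)).bilinearComp (S.trivL EP q.1)
        (S.trivL EP q.1)

theorem halfForm_apply (J : P → S.sub) (q : G × P × S.perp) (u w : E × EP × S.perp) :
    S.halfForm J q u w = Q.isoE (leftTInv E q.1 u.1) (S.tJ J q.2.1 w.2.1 + w.2.2)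
      + 2⁻¹ * Q.isoE (brk G (leftTInv E q.1 u.1) (leftTInv E q.1 w.1)) ((J q.2.1 : F) + q.2.2) := by
  rw [← brkPair_apply]
  rfl

/-- The restriction of the form `ω ⊕ ω_L` to the zero level set, on the model space. -/
def bigForm (ωP : TwoForm EP P) (J : P → S.sub) (q : G × P × S.perp) :
    (E × EP × S.perp) [⋀^Fin 2]→L[ℝ] ℝ :=
  (formAt ωP q.2.1).compContinuousLinearMap
    ((ContinuousLinearMap.fst ℝ EP S.perp).comp (ContinuousLinearMap.snd ℝ E (EP × S.perp)))
  + altOf (S.halfForm J q)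

theorem bigForm_apply (ωP : TwoForm EP P) (J : P → S.sub) (q : G × P × S.perp)
    (u w : E × EP × S.perp) :
    S.bigForm ωP J q ![u, w] = formAt ωP q.2.1 ![u.2.1, w.2.1]
      + Q.isoE (leftTInv E q.1 u.1) (S.tJ J q.2.1 w.2.1 + w.2.2)
      - Q.isoE (leftTInv E q.1 w.1) (S.tJ J q.2.1 u.2.1 + u.2.2)
      + Q.isoE (brk G (leftTInv E q.1 u.1) (leftTInv E q.1 w.1)) ((J q.2.1 : F) + q.2.2) := by
  rw [bigForm, ContinuousAlternatingMap.add_apply, altOf_apply, halfForm_apply, halfForm_apply,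
    form_comp, brk_swap (leftTInv E q.1 w.1) (leftTInv E q.1 u.1), map_neg, neg_apply]
  simp only [ContinuousLinearMap.comp_apply, ContinuousLinearMap.coe_fst',
    ContinuousLinearMap.coe_snd']
  ring

/-- In the left trivialization, the form is the one of the statement. -/
theorem bigForm_eq_sumForm (ωP : TwoForm EP P) (J : P → S.sub) (g : G) (p : P) (ρ : S.perp)
    (x y : E) (a b : EP) (μ ν : S.perp) :
    S.bigForm ωP J (g, p, ρ) ![(leftT E g x, a, μ), (leftT E g y, b, ν)]
      = S.sumForm ωP p (J p + ρ) (a : TangentSpace 𝓘(ℝ, EP) p) (x : LieAlg E G)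
          (S.tJ J p a + μ) (b : TangentSpace 𝓘(ℝ, EP) p) (y : LieAlg E G) (S.tJ J p b + ν) := by
  rw [bigForm_apply]
  simp only [leftTInv_leftT]
  rfl

end InvariantSplitting

/-! ### The infinitesimal action of `H` and the equivariance of the momentum map on `P`. -/

/-- The derivative of the inversion at the identity. -/
theorem tderiv_inv_one {E : Type*} [NormedAddCommGroup E] [NormedSpace ℝ E]
    {G : Type*} [TopologicalSpace G] [ChartedSpace E G] [Group G] [LieGroup 𝓘(ℝ, E) ∞ G] (x : E) :
    tderiv 𝓘(ℝ, E) 𝓘(ℝ, E) (fun g : G => g⁻¹) 1 x = -x := by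
  have hi : MDifferentiableAt 𝓘(ℝ, E) 𝓘(ℝ, E) (fun g : G => g⁻¹) 1 :=
    ((contMDiff_inv 𝓘(ℝ, E) ∞) 1).mdifferentiableAt (by simp)
  have hm : MDifferentiableAt (𝓘(ℝ, E).prod 𝓘(ℝ, E)) 𝓘(ℝ, E) (fun q : G × G => q.1 * q.2)
      (1, 1⁻¹) := ((contMDiff_mul 𝓘(ℝ, E) ∞) _).mdifferentiableAt (by simp)
  -- This differentiates `g g⁻¹ = 1`.
  have h := tderiv_comp₂ (F := fun q : G × G => q.1 * q.2) (f := fun g : G => g)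
    (g := fun g : G => g⁻¹) (x := (1 : G)) hm mdifferentiableAt_id hi x
  simp only [mul_inv_cancel, inv_one, mul_one, one_mul, tderiv_id, tderiv_const] at h
  exact eq_neg_of_add_eq_zero_right h.symm

namespace InvariantSplitting

set_option linter.unusedSectionVars false

variable {E : Type*} [NormedAddCommGroup E] [NormedSpace ℝ E]
  {G : Type*} [TopologicalSpace G] [ChartedSpace E G] [Group G]
  {F : Type*} [NormedAddCommGroup F] [NormedSpace ℝ F] [CompleteSpace F]
  {Q : InvariantPredual E G F} {H : Subgroup G}
  {EH : Type*} [NormedAddCommGroup EH] [NormedSpace ℝ EH] [ChartedSpace EH H]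
  (S : InvariantSplitting Q H EH)
  {EP : Type*} [NormedAddCommGroup EP] [NormedSpace ℝ EP]
  {P : Type*} [TopologicalSpace P] [ChartedSpace EP P] [MulAction H P]
  [LieGroup 𝓘(ℝ, E) ∞ G] [LieGroup 𝓘(ℝ, EH) ∞ H]
  (hι : ContMDiff 𝓘(ℝ, EH) 𝓘(ℝ, E) ∞ (fun h : H => (h : G)))

include hι

theorem mdiffAt_inv_coe (h₀ : H) :
    MDifferentiableAt 𝓘(ℝ, EH) 𝓘(ℝ, E) (fun h : H => (h : G)⁻¹) h₀ :=
  (hι.inv h₀).mdifferentiableAt (by simp)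

theorem tderiv_inv_coe (z : EH) :
    tderiv 𝓘(ℝ, EH) 𝓘(ℝ, E) (fun h : H => (h : G)⁻¹) 1 z = -S.embE z := by
  have h1 := tderiv_comp_apply (g := fun g : G => g⁻¹) (f := fun h : H => (h : G)) (x := (1 : H))
    (((contMDiff_inv 𝓘(ℝ, E) ∞) _).mdifferentiableAt (by simp))
    ((hι 1).mdifferentiableAt (by simp)) z
  refine h1.trans ?_
  rw [Subgroup.coe_one, tderiv_inv_one]
  rfl

theorem tderiv_coAd_inv (ρ : F) (z : EH) :
    tderiv 𝓘(ℝ, EH) 𝓘(ℝ, F) (fun h : H => Q.coAd (h : G)⁻¹ ρ) 1 z = -Q.coadL (S.embE z) ρ := by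
  have h1 := tderiv_clm_comp (I := 𝓘(ℝ, E)) (E' := F →L[ℝ] F) (E'' := F)
    (ContinuousLinearMap.apply ℝ F ρ) (f := fun g : G => Q.coAdL g)
    (Q.mdiffAt_coAdL ((1 : H) : G)⁻¹)
  have h2 := tderiv_comp_apply (I' := 𝓘(ℝ, E))
    (g := fun g : G => ContinuousLinearMap.apply ℝ F ρ (Q.coAdL g))
    (f := fun h : H => (h : G)⁻¹) (x := (1 : H))
    (MDifferentiableAt.comp (I' := 𝓘(ℝ, F →L[ℝ] F)) _
      (ContinuousLinearMap.apply ℝ F ρ).mdifferentiableAt (Q.mdiffAt_coAdL _))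
    (mdiffAt_inv_coe hι 1) z
  refine h2.trans ?_
  rw [h1, S.tderiv_inv_coe hι, Subgroup.coe_one, inv_one, map_neg]
  rfl

variable [ContMDiffSMul 𝓘(ℝ, EH) 𝓘(ℝ, EP) ∞ H P]

omit hι in
theorem mdiffAt_smul_left (h₀ : H) (p : P) :
    MDifferentiableAt 𝓘(ℝ, EH) 𝓘(ℝ, EP) (fun h : H => h • p) h₀ :=
  MDifferentiableAt.comp (I' := 𝓘(ℝ, EH).prod 𝓘(ℝ, EP)) h₀
    (((contMDiff_smul (I := 𝓘(ℝ, EH)) (I' := 𝓘(ℝ, EP)) (n := ∞) (G := H) (M := P))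
      (h₀, p)).mdifferentiableAt (by simp))
    (mdifferentiableAt_id.prodMk mdifferentiableAt_const)

omit hι in
variable (EH) in
include EH in
theorem mdiffAt_smul_right (h : H) (p : P) :
    MDifferentiableAt 𝓘(ℝ, EP) 𝓘(ℝ, EP) (fun p : P => h • p) p :=
  MDifferentiableAt.comp (I' := 𝓘(ℝ, EH).prod 𝓘(ℝ, EP)) p (f := fun p : P => (h, p))
    (g := fun q : H × P => q.1 • q.2) (((contMDiff_smul (I := 𝓘(ℝ, EH)) (I' := 𝓘(ℝ, EP)) (n := ∞) (G := H) (M := P))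
      (h, p)).mdifferentiableAt (by simp))
    (mdifferentiableAt_const.prodMk mdifferentiableAt_id)

theorem mdiffAt_coAdPerp_inv (h₀ : H) (ρ : S.perp) :
    MDifferentiableAt 𝓘(ℝ, EH) 𝓘(ℝ, S.perp) (fun h : H => S.coAdPerp h⁻¹ ρ) h₀ := by
  have h1 : ContMDiff 𝓘(ℝ, EH) 𝓘(ℝ, EH) ∞ (fun h : H => h⁻¹) := contMDiff_inv 𝓘(ℝ, EH) ∞
  exact (ContMDiff.comp (g := fun q : H × S.perp => S.coAdPerp q.1 q.2)
    (f := fun h : H => (h⁻¹, ρ)) (S.contMDiff_coAdPerp hι)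
    (h1.prodMk contMDiff_const) h₀).mdifferentiableAt (by simp)

/-- The tangent vectors of the orbits. -/
theorem tderiv_act_left (q : G × P × S.perp) (z : EH) :
    ∃ κ : S.perp, (κ : F) = -Q.coadL (S.embE z) q.2.2 ∧
      tderiv 𝓘(ℝ, EH) (S.totalModel EP) (fun h : H => S.act h q) 1 z
        = (leftT E q.1 (-S.embE z), gen H EH q.2.1 z, κ) := by
  obtain ⟨g, p, ρ⟩ := q
  have hc := S.mdiffAt_coAdPerp_inv hι 1 ρ
  refine ⟨tderiv 𝓘(ℝ, EH) 𝓘(ℝ, S.perp) (fun h : H => S.coAdPerp h⁻¹ ρ) 1 z, ?_, ?_⟩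
  · have h1 := tderiv_clm_comp (I := 𝓘(ℝ, EH)) S.perp.subtypeL hc
    have h2 := congrArg (fun T : EH →L[ℝ] F => T z) h1
    exact h2.symm.trans (S.tderiv_coAd_inv hι ρ z)
  · have hg : MDifferentiableAt 𝓘(ℝ, EH) 𝓘(ℝ, E) (fun h : H => g * (h : G)⁻¹) 1 :=
      MDifferentiableAt.comp (I' := 𝓘(ℝ, E)) 1 (mdiffAt_mul_left g _) (mdiffAt_inv_coe hι 1)
    have hp := mdiffAt_smul_left (EH := EH) (EP := EP) (1 : H) p
    have h1 : tderiv 𝓘(ℝ, EH) (S.totalModel EP) (fun h : H => S.act h (g, p, ρ)) 1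
        = (tderiv 𝓘(ℝ, EH) 𝓘(ℝ, E) (fun h : H => g * (h : G)⁻¹) 1).prod
          ((gen H EH p).prod
            (tderiv 𝓘(ℝ, EH) 𝓘(ℝ, S.perp) (fun h : H => S.coAdPerp h⁻¹ ρ) 1)) :=
      (tderiv_prodMk hg (hp.prodMk hc)).trans (congrArg _ (tderiv_prodMk hp hc))
    have h2 := tderiv_comp_apply (g := fun a : G => g * a) (f := fun h : H => (h : G)⁻¹)
      (x := (1 : H)) (mdiffAt_mul_left g _) (mdiffAt_inv_coe hι 1) z
    rw [S.tderiv_inv_coe hι, Subgroup.coe_one, inv_one] at h2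
    rw [h1]
    exact Prod.ext h2 rfl

/-- The derivative of the action of an element of `H`. -/
theorem tderiv_act_right (h : H) (g : G) (p : P) (ρ μ : S.perp) (x : E) (a : EP) :
    tderiv (S.totalModel EP) (S.totalModel EP) (fun q : G × P × S.perp => S.act h q) (g, p, ρ)
        (leftT E g x, a, μ)
      = (leftT E (g * (h : G)⁻¹) (adMap E (h : G) x),
          tderiv 𝓘(ℝ, EP) 𝓘(ℝ, EP) (fun p : P => h • p) p a, S.coAdPerp h⁻¹ μ) := by
  have h1 : MDifferentiableAt (S.totalModel EP) 𝓘(ℝ, E)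
      (fun q : G × P × S.perp => q.1 * (h : G)⁻¹) (g, p, ρ) :=
    MDifferentiableAt.comp (I' := 𝓘(ℝ, E)) (g, p, ρ) (mdiffAt_mul_right _ _) mdifferentiableAt_fst
  have e2 : MDifferentiableAt (S.totalModel EP) 𝓘(ℝ, EP) (fun q : G × P × S.perp => q.2.1)
      (g, p, ρ) :=
    MDifferentiableAt.comp (I' := 𝓘(ℝ, EP).prod 𝓘(ℝ, S.perp)) (g, p, ρ)
      (g := Prod.fst) (f := Prod.snd) mdifferentiableAt_fst mdifferentiableAt_snd
  have e3 : MDifferentiableAt (S.totalModel EP) 𝓘(ℝ, S.perp) (fun q : G × P × S.perp => q.2.2)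
      (g, p, ρ) :=
    MDifferentiableAt.comp (I' := 𝓘(ℝ, EP).prod 𝓘(ℝ, S.perp)) (g, p, ρ)
      (g := Prod.snd) (f := Prod.snd) mdifferentiableAt_snd mdifferentiableAt_snd
  have t2 : tderiv (S.totalModel EP) 𝓘(ℝ, EP) (fun q : G × P × S.perp => q.2.1) (g, p, ρ)
      (leftT E g x, a, μ) = a := by
    refine (tderiv_comp_apply (I' := 𝓘(ℝ, EP).prod 𝓘(ℝ, S.perp)) (g := Prod.fst)
      (f := Prod.snd) (x := (g, p, ρ)) mdifferentiableAt_fst mdifferentiableAt_snd _).trans ?_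
    rw [tderiv_snd, tderiv_fst]; rfl
  have t3 : tderiv (S.totalModel EP) 𝓘(ℝ, S.perp) (fun q : G × P × S.perp => q.2.2) (g, p, ρ)
      (leftT E g x, a, μ) = μ := by
    refine (tderiv_comp_apply (I' := 𝓘(ℝ, EP).prod 𝓘(ℝ, S.perp)) (g := Prod.snd)
      (f := Prod.snd) (x := (g, p, ρ)) mdifferentiableAt_snd mdifferentiableAt_snd _).trans ?_
    rw [tderiv_snd, tderiv_snd]; rfl
  have h2 : MDifferentiableAt (S.totalModel EP) 𝓘(ℝ, EP)
      (fun q : G × P × S.perp => h • q.2.1) (g, p, ρ) :=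
    MDifferentiableAt.comp (I' := 𝓘(ℝ, EP)) (g, p, ρ) (g := fun p : P => h • p)
      (mdiffAt_smul_right EH h p) e2
  have hL : (fun q : G × P × S.perp => S.coAdPerp h⁻¹ q.2.2)
      = fun q : G × P × S.perp => S.coAdPerpL h⁻¹ q.2.2 := by
    funext q; rw [coAdPerpL_apply]
  have h3 : MDifferentiableAt (S.totalModel EP) 𝓘(ℝ, S.perp)
      (fun q : G × P × S.perp => S.coAdPerp h⁻¹ q.2.2) (g, p, ρ) := by
    rw [hL]
    exact MDifferentiableAt.comp (I' := 𝓘(ℝ, S.perp)) (g, p, ρ)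
      (S.coAdPerpL h⁻¹).mdifferentiableAt e3
  have key : tderiv (S.totalModel EP) (S.totalModel EP)
      (fun q : G × P × S.perp => S.act h q) (g, p, ρ)
      = (tderiv (S.totalModel EP) 𝓘(ℝ, E) (fun q : G × P × S.perp => q.1 * (h : G)⁻¹)
          (g, p, ρ)).prod
        ((tderiv (S.totalModel EP) 𝓘(ℝ, EP) (fun q : G × P × S.perp => h • q.2.1) (g, p, ρ)).prod
        (tderiv (S.totalModel EP) 𝓘(ℝ, S.perp)
          (fun q : G × P × S.perp => S.coAdPerp h⁻¹ q.2.2) (g, p, ρ))) :=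
    (tderiv_prodMk h1 (h2.prodMk h3)).trans (congrArg _ (tderiv_prodMk h2 h3))
  rw [key]
  refine Prod.ext ?_ (Prod.ext ?_ ?_)
  · refine (tderiv_comp_apply (I' := 𝓘(ℝ, E)) (g := fun a : G => a * (h : G)⁻¹) (f := Prod.fst)
      (x := (g, p, ρ)) (mdiffAt_mul_right _ _) mdifferentiableAt_fst _).trans ?_
    rw [tderiv_fst]
    refine (rightT_leftT g (h : G)⁻¹ x).trans ?_
    rw [inv_inv]
  · refine (tderiv_comp_apply (I' := 𝓘(ℝ, EP)) (g := fun p : P => h • p)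
      (x := (g, p, ρ)) (mdiffAt_smul_right EH h p) e2 _).trans ?_
    rw [t2]
  · refine Eq.trans ?_ (S.coAdPerpL_apply h⁻¹ μ)
    have h5 := tderiv_clm_comp (S.coAdPerpL h⁻¹) e3
    rw [← hL] at h5
    have h6 := congrArg (fun T : (E × EP × S.perp) →L[ℝ] S.perp => T (leftT E g x, a, μ)) h5
    refine h6.trans ?_
    exact congrArg (S.coAdPerpL h⁻¹) t3

section Momentum

variable [IsManifold 𝓘(ℝ, EP) ∞ P] {J : P → S.sub}
  (hJs : ContMDiff 𝓘(ℝ, EP) 𝓘(ℝ, S.sub) ∞ J)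
  (hJe : ∀ (h : H) (p : P), J (h • p) = S.coAdSub h⁻¹ (J p))

include hJs hJe

omit [IsManifold 𝓘(ℝ, EP) ∞ P] in
/-- The infinitesimal equivariance of the momentum map. -/
theorem tJ_gen (p : P) (z : EH) :
    S.tJ J p (gen H EH (EP := EP) p z) = -Q.coadL (S.embE z) (J p) := by
  have hp := mdiffAt_smul_left (EH := EH) (EP := EP) (1 : H) p
  have hJd : MDifferentiableAt 𝓘(ℝ, EP) 𝓘(ℝ, S.sub) J ((1 : H) • p) :=
    (hJs _).mdifferentiableAt (by simp)
  have hJp : MDifferentiableAt 𝓘(ℝ, EH) 𝓘(ℝ, S.sub) (fun h : H => J (h • p)) 1 :=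
    MDifferentiableAt.comp (I' := 𝓘(ℝ, EP)) 1 hJd hp
  have h1 := tderiv_comp_apply (g := J) (f := fun h : H => h • p) (x := (1 : H)) hJd hp z
  have h2 := tderiv_clm_comp (I := 𝓘(ℝ, EH)) S.sub.subtypeL hJp
  have h3 : (fun h : H => S.sub.subtypeL (J (h • p))) = fun h : H => Q.coAd (h : G)⁻¹ (J p) := by
    funext h
    rw [hJe]
    rfl
  rw [h3] at h2
  have h4 := congrArg (fun T : EH →L[ℝ] F => T z) h2
  refine Eq.trans ?_ (h4.symm.trans (S.tderiv_coAd_inv hι (J p) z))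
  rw [one_smul] at h1
  exact congrArg S.sub.subtypeL h1.symm

omit hι [IsManifold 𝓘(ℝ, EP) ∞ P] in
theorem tJ_smul (h : H) (p : P) (a : EP) :
    S.tJ J (h • p) (tderiv 𝓘(ℝ, EP) 𝓘(ℝ, EP) (fun p : P => h • p) p a)
      = Q.coAd (h : G)⁻¹ (S.tJ J p a) := by
  have hJd : ∀ p, MDifferentiableAt 𝓘(ℝ, EP) 𝓘(ℝ, S.sub) J p := fun p =>
    (hJs _).mdifferentiableAt (by simp)
  have hp := mdiffAt_smul_right (EP := EP) EH h p
  have hJp : MDifferentiableAt 𝓘(ℝ, EP) 𝓘(ℝ, S.sub) (fun p : P => J (h • p)) p :=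
    MDifferentiableAt.comp (I' := 𝓘(ℝ, EP)) p (hJd _) hp
  have h1 := tderiv_comp_apply (g := J) (f := fun p : P => h • p) (x := p) (hJd _) hp a
  have h2 := tderiv_clm_comp (I := 𝓘(ℝ, EP)) S.sub.subtypeL hJp
  have h3 := tderiv_clm_comp (I := 𝓘(ℝ, EP)) ((Q.coAdL (h : G)⁻¹).comp S.sub.subtypeL) (hJd p)
  have h4 : (fun p : P => S.sub.subtypeL (J (h • p)))
      = fun p => ((Q.coAdL (h : G)⁻¹).comp S.sub.subtypeL) (J p) := by
    funext p
    rw [hJe]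
    rfl
  rw [h4] at h2
  have h5 := congrArg (fun T : EP →L[ℝ] F => T a) (h2.symm.trans h3)
  exact (congrArg S.sub.subtypeL h1.symm).trans h5

end Momentum

end InvariantSplitting

/-! ### Invariance and kernel of the form on the zero level set. -/

namespace InvariantSplitting

set_option linter.unusedSectionVars false

variable {E : Type*} [NormedAddCommGroup E] [NormedSpace ℝ E]
  {G : Type*} [TopologicalSpace G] [ChartedSpace E G] [Group G]
  {F : Type*} [NormedAddCommGroup F] [NormedSpace ℝ F] [CompleteSpace F]
  {Q : InvariantPredual E G F} {H : Subgroup G}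
  {EH : Type*} [NormedAddCommGroup EH] [NormedSpace ℝ EH] [ChartedSpace EH H]
  (S : InvariantSplitting Q H EH)
  {EP : Type*} [NormedAddCommGroup EP] [NormedSpace ℝ EP]
  {P : Type*} [TopologicalSpace P] [ChartedSpace EP P] [MulAction H P]
  [IsManifold 𝓘(ℝ, EP) ∞ P]
  [LieGroup 𝓘(ℝ, E) ∞ G] [LieGroup 𝓘(ℝ, EH) ∞ H]
  (hι : ContMDiff 𝓘(ℝ, EH) 𝓘(ℝ, E) ∞ (fun h : H => (h : G)))
  {ωP : TwoForm EP P} {J : P → S.sub} (hJ : IsHamiltonianAction ωP S.pairSub S.coAdSub J)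

include hJ

omit [CompleteSpace F] [LieGroup 𝓘(ℝ, E) ∞ G] [LieGroup 𝓘(ℝ, EH) ∞ H] in
/-- The defining property of the momentum map on `P`. -/
theorem formAt_gen (p : P) (z : EH) (b : EP) :
    formAt ωP p ![gen H EH p z, b] = Q.isoE (S.embE z) (S.tJ J p b) := by
  have h1 := (hJ.hamiltonian z).eq p (Set.mem_univ _) b
  have h2 := tderiv_clm_comp (I := 𝓘(ℝ, EP)) ((Q.isoE (S.embE z)).comp S.sub.subtypeL)
    ((hJ.smooth p).mdifferentiableAt (by simp))
  exact h1.symm.trans (congrArg (fun T : EP →L[ℝ] ℝ => T b) h2)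

omit [CompleteSpace F] [LieGroup 𝓘(ℝ, E) ∞ G] [LieGroup 𝓘(ℝ, EH) ∞ H] in
theorem formAt_smul (h : H) (p : P) (a b : EP) :
    formAt ωP (h • p) ![tderiv 𝓘(ℝ, EP) 𝓘(ℝ, EP) (fun p : P => h • p) p a,
      tderiv 𝓘(ℝ, EP) 𝓘(ℝ, EP) (fun p : P => h • p) p b] = formAt ωP p ![a, b] :=
  hJ.symplectic h p a b

include hι

/-- The form `ω ⊕ ω_L` on the zero level set is invariant. -/
theorem bigForm_act (h : H) (q : G × P × S.perp) (u w : E × EP × S.perp) :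
    S.bigForm ωP J (S.act h q)
      ![tderiv (S.totalModel EP) (S.totalModel EP) (fun q : G × P × S.perp => S.act h q) q u,
        tderiv (S.totalModel EP) (S.totalModel EP) (fun q : G × P × S.perp => S.act h q) q w]
      = S.bigForm ωP J q ![u, w] := by
  have := hJ.smooth_action
  obtain ⟨g, p, ρ⟩ := q
  obtain ⟨u₁, a, μ⟩ := u
  obtain ⟨w₁, b, ν⟩ := w
  obtain ⟨x, rfl⟩ : ∃ x, leftT E g x = u₁ := ⟨_, leftT_leftTInv g u₁⟩
  obtain ⟨y, rfl⟩ : ∃ y, leftT E g y = w₁ := ⟨_, leftT_leftTInv g w₁⟩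
  rw [S.tderiv_act_right hι, S.tderiv_act_right hι, bigForm_apply, bigForm_apply]
  simp only [act, leftTInv_leftT]
  rw [S.formAt_smul hJ, S.tJ_smul hJ.smooth hJ.equivariant, S.tJ_smul hJ.smooth hJ.equivariant,
    hJ.equivariant]
  simp only [coAdPerp, coAdSub, Subgroup.coe_inv, ← Q.coAd_add]
  -- In the left trivialization `h` acts by `Ad_h` on `𝔤` and by `Ad*_{h⁻¹}` on the predual, and
  -- these cancel in every pairing.
  rw [← adMap_brk, Q.isoE_coAd, Q.isoE_coAd, Q.isoE_coAd, adMap_inv_adMap, adMap_inv_adMap,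
    adMap_inv_adMap]

/-- The tangent vectors of the orbits are in the kernel of the form on the zero level set. -/
theorem bigForm_orbit (q : G × P × S.perp) (z : EH) (w : E × EP × S.perp) :
    S.bigForm ωP J q ![tderiv 𝓘(ℝ, EH) (S.totalModel EP) (fun h : H => S.act h q) 1 z, w] = 0 := by
  have := hJ.smooth_action
  obtain ⟨κ, hκ, h1⟩ := S.tderiv_act_left (EP := EP) hι q z
  rw [h1, bigForm_apply]
  simp only [leftTInv_leftT]
  -- The term `ω(z_P, b)` cancels `⟨TJ(b), z⟩`, elements of `𝔥_*^⊥` pair to zero with `z`, and the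
  -- two coadjoint terms, from `J` and from `ρ`, cancel the bracket term.
  rw [S.formAt_gen hJ, S.tJ_gen hι hJ.smooth hJ.equivariant, hκ, map_neg, neg_apply, map_add,
    S.isoE_embE_perp z w.2.2.2, map_add, map_neg, map_neg, Q.isoE_coadL, Q.isoE_coadL,
    ← brkL_apply, ← brkL_apply, map_neg, neg_apply, map_neg, neg_apply, map_add]
  ring

/-- The kernel of the form on the zero level set consists of the tangent vectors of the orbits. -/
theorem exists_orbit_of_bigForm_eq_zero (hω : IsWeakSymplectic ωP) (q : G × P × S.perp)
    (u : E × EP × S.perp) (hu : ∀ w, S.bigForm ωP J q ![u, w] = 0) :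
    ∃ z : EH, u = tderiv 𝓘(ℝ, EH) (S.totalModel EP) (fun h : H => S.act h q) 1 z := by
  have := hJ.smooth_action
  obtain ⟨g, p, ρ⟩ := q
  obtain ⟨u₁, a, μ⟩ := u
  obtain ⟨x, rfl⟩ : ∃ x, leftT E g x = u₁ := ⟨_, leftT_leftTInv g u₁⟩
  simp only [bigForm_apply, leftTInv_leftT] at hu
  -- Test vectors in the direction of `𝔥_*^⊥` show that the component in `𝔤` annihilates `𝔥_*^⊥`, so
  -- it lies in `𝔥`.
  obtain ⟨z, hz⟩ := S.exists_embE_eq (x := x) (fun ν hν => by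
    have h := hu (0, 0, ⟨ν, hν⟩)
    have h0 : formAt ωP p ![a, 0] = 0 :=
      (formAt ωP p).map_coord_zero (m := ![a, 0]) 1 rfl
    simpa [h0, ← brkL_apply] using h)
  subst hz
  -- Test vectors along `P` determine the second component, by the nondegeneracy of `ω` and the
  -- defining property of `J`. The sign reflects that the orbit vector of `z` has component `-z` in
  -- `𝔤`.
  have ha : a = gen H EH p (-z) := by
    have h1 : a + gen H EH p z = 0 := by
      refine hω.nondegenerate p _ fun (b : EP) => ?_
      have h := hu (0, b, 0)
      refine (form_add_left (formAt ωP p) a (gen H EH p z) b).trans ?_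
      rw [S.formAt_gen hJ]
      simpa [← brkL_apply] using h
    rw [map_neg]
    exact eq_neg_of_add_eq_zero_left h1
  -- Test vectors along `G` determine the third component; infinitesimal equivariance cancels the
  -- contribution of `J p`.
  have hμ : (μ : F) = -Q.coadL (S.embE (-z)) ρ := by
    refine Q.ext_isoE fun y => ?_
    have h := hu (leftT E g y, 0, 0)
    have h0 : formAt ωP p ![a, 0] = 0 :=
      (formAt ωP p).map_coord_zero (m := ![a, 0]) 1 rfl
    have h3 := S.tJ_gen hι hJ.smooth hJ.equivariant p (-z)
    rw [← ha] at h3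
    simp only [leftTInv_leftT, h0, h3, map_neg, map_zero, neg_apply, map_add,
      Q.isoE_coadL, neg_neg, Submodule.coe_zero, add_zero] at h
    simp only [map_neg, neg_apply, neg_neg, Q.isoE_coadL]
    linarith
  obtain ⟨κ, hκ, h1⟩ := S.tderiv_act_left (EP := EP) hι (g, p, ρ) (-z)
  refine ⟨-z, ?_⟩
  rw [h1, ← ha, map_neg S.embE, neg_neg]
  have h2 : μ = κ := Subtype.ext (hμ.trans hκ.symm)
  rw [h2]

end InvariantSplitting

theorem form_ext {X : Type*} [NormedAddCommGroup X] [NormedSpace ℝ X]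
    {f f' : X [⋀^Fin 2]→L[ℝ] ℝ} (h : ∀ u w, f ![u, w] = f' ![u, w]) : f = f' := by
  refine ContinuousAlternatingMap.ext fun v => ?_
  have e : v = ![v 0, v 1] := by
    funext i
    fin_cases i <;> rfl
  rw [e]
  exact h _ _

/-! ### The reduced form on the induced space. -/

namespace InvariantSplitting

set_option linter.unusedSectionVars false

variable {E : Type*} [NormedAddCommGroup E] [NormedSpace ℝ E]
  {G : Type*} [TopologicalSpace G] [ChartedSpace E G] [Group G]
  {F : Type*} [NormedAddCommGroup F] [NormedSpace ℝ F] [CompleteSpace F]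
  {Q : InvariantPredual E G F} {H : Subgroup G}
  {EH : Type*} [NormedAddCommGroup EH] [NormedSpace ℝ EH] [ChartedSpace EH H]
  (S : InvariantSplitting Q H EH)
  {EP : Type*} [NormedAddCommGroup EP] [NormedSpace ℝ EP]
  {P : Type*} [TopologicalSpace P] [ChartedSpace EP P] [MulAction H P]
  [IsManifold 𝓘(ℝ, EP) ∞ P]
  [LieGroup 𝓘(ℝ, E) ∞ G] [LieGroup 𝓘(ℝ, EH) ∞ H]
  (hι : ContMDiff 𝓘(ℝ, EH) 𝓘(ℝ, E) ∞ (fun h : H => (h : G)))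
  [ContMDiffSMul 𝓘(ℝ, EH) 𝓘(ℝ, EP) ∞ H P] {sl : Slice E H EH (S.perp →L[ℝ] ℝ)}

theorem inducedAtlas_σ (m : S.InducedSpace P) (w : S.Model EP) :
    (S.inducedAtlas hι sl m).σ w = S.chartSection sl (S.rep m).1 (S.rep m).2.1 w :=
  S.act_one _

theorem inducedAtlas_R (m : S.InducedSpace P) (w : S.Model EP) (h : H) :
    (S.inducedAtlas hι sl m).R (w, h)
      = S.act h (S.chartSection sl (S.rep m).1 (S.rep m).2.1 w) := rfl

theorem inducedAtlas_σ_C_rep (m : S.InducedSpace P) :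
    (S.inducedAtlas (EP := EP) hι sl m).σ ((S.inducedAtlas hι sl m).C (S.rep m)) = S.rep m := by
  have h1 : (S.inducedAtlas (EP := EP) hι sl m).D (S.rep m) = 1 := by
    show (sl.fib (S.rep m).1 (S.rep m).1)⁻¹ = 1
    rw [sl.fib_self, inv_one]
  have h2 := (S.inducedAtlas (EP := EP) hι sl m).R_C_D (S.rep m) (by
    simp only [S.proj₀_rep]; exact S.mem_inducedAtlas hι sl m)
  rw [h1] at h2
  exact h2

include hι in
/-- The tangent vectors of an orbit curve are tangent vectors of the orbit at the given point. -/
theorem exists_tderiv_act (q : G × P × S.perp) (h₀ : H) (w : EH) :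
    ∃ z : EH, tderiv 𝓘(ℝ, EH) (S.totalModel EP) (fun h : H => S.act h q) h₀ w
      = tderiv 𝓘(ℝ, EH) (S.totalModel EP) (fun h : H => S.act h (S.act h₀ q)) 1 z := by
  have e : (fun h : H => S.act h q) = fun h : H => S.act (h * h₀⁻¹) (S.act h₀ q) := by
    funext h
    rw [← S.act_mul, inv_mul_cancel_right]
  have h1 : MDifferentiableAt 𝓘(ℝ, EH) (S.totalModel EP) (fun h : H => S.act h (S.act h₀ q))
      (h₀ * h₀⁻¹) := (S.contMDiff_act_left (EP := EP) hι _ _).mdifferentiableAt (by simp)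
  have h2 := tderiv_comp_apply (g := fun h : H => S.act h (S.act h₀ q))
    (f := fun h : H => h * h₀⁻¹) (x := h₀) h1 (mdiffAt_mul_right _ _) w
  rw [mul_inv_cancel] at h2
  rw [e]
  exact ⟨_, h2⟩

variable [ChartedSpace (S.Model EP) (S.InducedSpace P)]
  [IsManifold 𝓘(ℝ, S.Model EP) ∞ (S.InducedSpace P)]

variable (EP) in
/-- The derivative of the projection onto the induced space, on the model spaces. -/
def tProj (q : G × P × S.perp) : (E × EP × S.perp) →L[ℝ] S.Model EP :=
  tderiv (S.totalModel EP) 𝓘(ℝ, S.Model EP) (fun q : G × P × S.perp => S.proj₀ q) q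

variable (hM : ∀ m : S.InducedSpace P, chartAt (S.Model EP) m
      = (S.inducedAtlas hι sl m).baseChart (S.isOpenQuotientMap_proj₀ (EP := EP) hι))

include hM

theorem mdiffAt_proj₀ (q : G × P × S.perp) :
    MDifferentiableAt (S.totalModel EP) 𝓘(ℝ, S.Model EP)
      (fun q : G × P × S.perp => S.proj₀ q) q :=
  ((PrincipalChart.contMDiff_proj hM) q).mdifferentiableAt (by simp)

theorem tProj_surjective (q : G × P × S.perp) : Function.Surjective (S.tProj EP q) :=
  PrincipalChart.tderiv_proj_surjective hM q

theorem tProj_act (h : H) (q : G × P × S.perp) (u : E × EP × S.perp) :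
    S.tProj EP (S.act h q) (tderiv (S.totalModel EP) (S.totalModel EP)
      (fun q : G × P × S.perp => S.act h q) q u) = S.tProj EP q u := by
  have h1 := tderiv_comp_apply (g := fun q : G × P × S.perp => S.proj₀ q)
    (f := fun q : G × P × S.perp => S.act h q) (S.mdiffAt_proj₀ hι hM (S.act h q))
    ((S.contMDiff_act_right (EP := EP) hι h q).mdifferentiableAt (by simp)) u
  simp only [S.proj₀_act] at h1
  exact h1.symm

theorem tProj_orbit (q : G × P × S.perp) (z : EH) :
    S.tProj EP q (tderiv 𝓘(ℝ, EH) (S.totalModel EP) (fun h : H => S.act h q) 1 z) = 0 := by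
  have h1 := tderiv_comp_apply (g := fun q : G × P × S.perp => S.proj₀ q)
    (f := fun h : H => S.act h q) (x := (1 : H)) (S.mdiffAt_proj₀ hι hM _)
    ((S.contMDiff_act_left (EP := EP) hι q 1).mdifferentiableAt (by simp)) z
  simp only [S.proj₀_act, tderiv_const] at h1
  rw [S.act_one] at h1
  exact h1.symm

/-- The fibre coordinate of a local trivialization moves a point of the section by the action of
`H`, so vectors tangent to the fibre are vectors tangent to an orbit; `exists_tderiv_act` transports
the base point to `q`. -/
theorem exists_orbit_of_tProj_eq_zero {q : G × P × S.perp} {u : E × EP × S.perp}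
    (hu : S.tProj EP q u = 0) :
    ∃ z : EH, u = tderiv 𝓘(ℝ, EH) (S.totalModel EP) (fun h : H => S.act h q) 1 z := by
  obtain ⟨w, hw⟩ := PrincipalChart.exists_of_tderiv_proj_eq_zero hM hu
  have h1 := (S.inducedAtlas (EP := EP) hι sl (S.proj₀ q)).R_C_D q (PrincipalChart.mem_W hM _)
  simp only [inducedAtlas_R] at hw h1
  obtain ⟨z, hz⟩ := S.exists_tderiv_act (EP := EP) hι
    (S.chartSection sl (S.rep (S.proj₀ q)).1 (S.rep (S.proj₀ q)).2.1
      ((S.inducedAtlas (EP := EP) hι sl (S.proj₀ q)).C q))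
    ((S.inducedAtlas (EP := EP) hι sl (S.proj₀ q)).D q) w
  rw [h1] at hz
  exact ⟨z, hw.trans hz⟩

omit hM

variable {ωP : TwoForm EP P} {J : P → S.sub}

/-- The reduced form on the induced space. -/
def inducedForm (sl : Slice E H EH (S.perp →L[ℝ] ℝ)) (ωP : TwoForm EP P) (J : P → S.sub) :
    TwoForm (S.Model EP) (S.InducedSpace P) := fun m =>
  (S.bigForm ωP J (S.rep m)).compContinuousLinearMap
    (tderiv 𝓘(ℝ, S.Model EP) (S.totalModel EP)
      (S.chartSection (EP := EP) sl (S.rep m).1 (S.rep m).2.1) (extChartAt 𝓘(ℝ, S.Model EP) m m))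

variable (hJ : IsHamiltonianAction ωP S.pairSub S.coAdSub J)

include hM hJ

/-- This is the well-definedness of the reduced form: neither the representative of a point nor the
lifts of tangent vectors matter, by the invariance of `bigForm` and because orbit vectors lie in its
kernel. -/
theorem bigForm_eq_of_tProj_eq {q₀ q : G × P × S.perp} (hq : S.proj₀ q₀ = S.proj₀ q)
    {u₀ w₀ u w : E × EP × S.perp} (hu : S.tProj EP q₀ u₀ = S.tProj EP q u)
    (hw : S.tProj EP q₀ w₀ = S.tProj EP q w) :
    S.bigForm ωP J q₀ ![u₀, w₀] = S.bigForm ωP J q ![u, w] := by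
  obtain ⟨h, rfl⟩ := S.proj₀_eq_iff.1 hq
  set T := tderiv (S.totalModel EP) (S.totalModel EP) (fun q : G × P × S.perp => S.act h q) q₀
    with hT
  have key : ∀ {v₀ v : E × EP × S.perp}, S.tProj EP q₀ v₀ = S.tProj EP (S.act h q₀) v →
      ∃ z : EH, v = T v₀
        + tderiv 𝓘(ℝ, EH) (S.totalModel EP) (fun k : H => S.act k (S.act h q₀)) 1 z := by
    intro v₀ v hv
    -- The second lift and the transported first lift have the same projection, so their difference
    -- is an orbit vector.
    obtain ⟨z, hz⟩ := S.exists_orbit_of_tProj_eq_zero hι hM (q := S.act h q₀) (u := v - T v₀)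
      (by rw [map_sub, S.tProj_act hι hM, hv, sub_self])
    exact ⟨z, by rw [← hz, add_sub_cancel]⟩
  obtain ⟨y, rfl⟩ := key hu
  obtain ⟨z, rfl⟩ := key hw
  rw [form_add_left, S.bigForm_orbit hι hJ, add_zero, form_add_right,
    form_swap (S.bigForm ωP J (S.act h q₀)) (T u₀)
      (tderiv 𝓘(ℝ, EH) (S.totalModel EP) (fun k : H => S.act k (S.act h q₀)) 1 z),
    S.bigForm_orbit hι hJ, neg_zero, add_zero, S.bigForm_act hι hJ]

omit hJ in
-- The inverse chart is the projection after the section, so the chart expression of the reduced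
-- form can be computed upstairs.
theorem tProj_tderiv_chartSection (m : S.InducedSpace P) {v : S.Model EP}
    (hv : v ∈ (extChartAt 𝓘(ℝ, S.Model EP) m).target) (u : S.Model EP) :
    S.tProj EP (S.chartSection sl (S.rep m).1 (S.rep m).2.1 v)
      (tderiv 𝓘(ℝ, S.Model EP) (S.totalModel EP)
        (S.chartSection (EP := EP) sl (S.rep m).1 (S.rep m).2.1) v u)
      = tderiv 𝓘(ℝ, S.Model EP) 𝓘(ℝ, S.Model EP) (extChartAt 𝓘(ℝ, S.Model EP) m).symm v u := by
  have e : ∀ v, (extChartAt 𝓘(ℝ, S.Model EP) m).symm v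
      = S.proj₀ (S.chartSection sl (S.rep m).1 (S.rep m).2.1 v) := by
    intro v
    rw [PrincipalChart.extChartAt_symm_apply hM, inducedAtlas_σ]
  rw [PrincipalChart.extChartAt_target_eq hM] at hv
  have hσ : ContMDiffAt 𝓘(ℝ, S.Model EP) (S.totalModel EP) ∞
      (S.chartSection (EP := EP) sl (S.rep m).1 (S.rep m).2.1) v :=
    (S.contMDiffOn_chartSection sl _ _).contMDiffAt
      ((S.inducedAtlas (EP := EP) hι sl m).isOpen_T.mem_nhds hv)
  have h1 := tderiv_comp_apply (g := fun q : G × P × S.perp => S.proj₀ q)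
    (S.mdiffAt_proj₀ hι hM _) (hσ.mdifferentiableAt (by simp)) u
  refine h1.symm.trans ?_
  congr 1
  exact tderiv_congr (Filter.Eventually.of_forall fun v => (e v).symm)

omit hJ in
theorem chartSection_extChartAt_self (m : S.InducedSpace P) :
    S.chartSection sl (S.rep m).1 (S.rep m).2.1 (extChartAt 𝓘(ℝ, S.Model EP) m m) = S.rep m := by
  have h1 := PrincipalChart.extChartAt_apply (π := fun q : G × P × S.perp => S.proj₀ q)
    (c := S.inducedAtlas (EP := EP) hι sl) hM m (x := S.rep m) (by
    simp only [S.proj₀_rep]; exact S.mem_inducedAtlas (EP := EP) hι sl m)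
  simp only [S.proj₀_rep] at h1
  rw [h1, ← S.inducedAtlas_σ hι, inducedAtlas_σ_C_rep]

/-- The reduced form pulls back to the form on the zero level set. -/
theorem inducedForm_tProj (q : G × P × S.perp) (u w : E × EP × S.perp) :
    formAt (S.inducedForm sl ωP J) (S.proj₀ q) ![S.tProj EP q u, S.tProj EP q w]
      = S.bigForm ωP J q ![u, w] := by
  have h1 : ∀ v, S.tProj EP (S.rep (S.proj₀ q))
      (tderiv 𝓘(ℝ, S.Model EP) (S.totalModel EP)
        (S.chartSection (EP := EP) sl (S.rep (S.proj₀ q)).1 (S.rep (S.proj₀ q)).2.1)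
        (extChartAt 𝓘(ℝ, S.Model EP) (S.proj₀ q) (S.proj₀ q)) v) = v := by
    intro v
    have h2 := S.tProj_tderiv_chartSection hι hM (S.proj₀ q)
      (mem_extChartAt_target (I := 𝓘(ℝ, S.Model EP)) (S.proj₀ q)) v
    rw [S.chartSection_extChartAt_self hι hM, tderiv_extChartAt_symm_self] at h2
    exact h2
  refine (form_comp (X := E × EP × S.perp) (Y := S.Model EP) _ _ _ _).trans ?_
  exact S.bigForm_eq_of_tProj_eq hι hM hJ (S.proj₀_rep _) (h1 _) (h1 _)

/-- The reduced form in a chart. -/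
theorem inducedForm_inChart (m : S.InducedSpace P) {v : S.Model EP}
    (hv : v ∈ (extChartAt 𝓘(ℝ, S.Model EP) m).target) :
    (S.inducedForm sl ωP J).inChart m v
      = (S.bigForm ωP J (S.chartSection sl (S.rep m).1 (S.rep m).2.1 v)).compContinuousLinearMap
        (tderiv 𝓘(ℝ, S.Model EP) (S.totalModel EP)
          (S.chartSection (EP := EP) sl (S.rep m).1 (S.rep m).2.1) v) := by
  refine form_ext fun u w => ?_
  have h1 : (S.inducedForm sl ωP J).inChart m v ![u, w]
      = formAt (S.inducedForm sl ωP J) ((extChartAt 𝓘(ℝ, S.Model EP) m).symm v)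
        ![tderiv 𝓘(ℝ, S.Model EP) 𝓘(ℝ, S.Model EP) (extChartAt 𝓘(ℝ, S.Model EP) m).symm v u,
          tderiv 𝓘(ℝ, S.Model EP) 𝓘(ℝ, S.Model EP) (extChartAt 𝓘(ℝ, S.Model EP) m).symm v w] :=
    form_comp (Y := S.Model EP) (X := S.Model EP) _ _ _ _
  rw [h1, form_comp, ← S.tProj_tderiv_chartSection hι hM m hv,
    ← S.tProj_tderiv_chartSection hι hM m hv, PrincipalChart.extChartAt_symm_apply hM,
    inducedAtlas_σ, S.inducedForm_tProj hι hM hJ]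

/-- The reduced form is nondegenerate. -/
theorem inducedForm_nondegenerate (hω : IsWeakSymplectic ωP) (m : S.InducedSpace P)
    (v : S.Model EP) (hv : ∀ w, formAt (S.inducedForm sl ωP J) m ![v, w] = 0) : v = 0 := by
  obtain ⟨q, rfl⟩ := (S.isOpenQuotientMap_proj₀ (EP := EP) hι).surjective m
  obtain ⟨u, rfl⟩ := S.tProj_surjective hι hM q v
  obtain ⟨z, rfl⟩ := S.exists_orbit_of_bigForm_eq_zero hι hJ hω q u fun w => by
    rw [← S.inducedForm_tProj hι hM hJ]
    exact hv _
  exact S.tProj_orbit hι hM q z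

end InvariantSplitting

/-! ### Criteria for smoothness and closedness of forms in coordinates. -/

section OneForms

variable {X : Type*} [NormedAddCommGroup X] [NormedSpace ℝ X]

/-- A family of functionals as a differential form of degree one. -/
def oneForm (a : X → (X →L[ℝ] ℝ)) (w : X) : X [⋀^Fin 1]→L[ℝ] ℝ :=
  (ContinuousAlternatingMap.ofSubsingletonLIE (𝕜 := ℝ) (E := X) (F := ℝ) (i := (0 : Fin 1))) (a w)

theorem contDiffAt_oneForm {a : X → (X →L[ℝ] ℝ)} {w : X} (ha : ContDiffAt ℝ ∞ a w) :
    ContDiffAt ℝ ∞ (oneForm a) w :=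
  ((ContinuousAlternatingMap.ofSubsingletonLIE (𝕜 := ℝ) (E := X) (F := ℝ)
    (i := (0 : Fin 1))).contDiff.contDiffAt).comp w ha

theorem extDeriv_oneForm {a : X → (X →L[ℝ] ℝ)} {w : X} (ha : ContDiffAt ℝ ∞ a w) :
    extDeriv (oneForm a) w = altOf (fderiv ℝ a w) := by
  have h : HasFDerivAt (oneForm a)
      ((((ContinuousAlternatingMap.ofSubsingletonLIE (𝕜 := ℝ) (E := X) (F := ℝ)
        (i := (0 : Fin 1))).toContinuousLinearEquiv :
        (X →L[ℝ] ℝ) →L[ℝ] (X [⋀^Fin 1]→L[ℝ] ℝ))).comp (fderiv ℝ a w)) w :=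
    ((((ContinuousAlternatingMap.ofSubsingletonLIE (𝕜 := ℝ) (E := X) (F := ℝ)
        (i := (0 : Fin 1))).toContinuousLinearEquiv :
        (X →L[ℝ] ℝ) →L[ℝ] (X [⋀^Fin 1]→L[ℝ] ℝ))).hasFDerivAt).comp w
      (ha.differentiableAt (by simp)).hasFDerivAt
  rw [extDeriv, h.fderiv, altOf]

theorem contDiffAt_extDeriv {n : ℕ} {η : X → X [⋀^Fin n]→L[ℝ] ℝ} {w : X}
    (hη : ContDiffAt ℝ ∞ η w) : ContDiffAt ℝ ∞ (extDeriv η) w :=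
  ((ContinuousAlternatingMap.alternatizeUncurryFinCLM ℝ X ℝ (n := n)).contDiff.contDiffAt).comp w
    (hη.fderiv_right (by simp))

theorem minSmoothness_two_le_infty : minSmoothness ℝ 2 ≤ (∞ : WithTop ℕ∞) := by
  rw [minSmoothness_of_isRCLikeNormedField]
  exact two_le_infty

/-- A form of degree two on an open set of a normed space is smooth and closed at a point. -/
def IsSmoothClosedAt (f : X → X [⋀^Fin 2]→L[ℝ] ℝ) (w : X) : Prop :=
  ContDiffAt ℝ ∞ f w ∧ extDeriv f w = 0

theorem IsSmoothClosedAt.congr {f f' : X → X [⋀^Fin 2]→L[ℝ] ℝ} {w : X}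
    (hf : IsSmoothClosedAt f w) (h : f' =ᶠ[𝓝 w] f) : IsSmoothClosedAt f' w :=
  ⟨hf.1.congr_of_eventuallyEq h, h.extDeriv_eq.trans hf.2⟩

theorem isWeakSymplectic_of_isSmoothClosedAt {M : Type*} [TopologicalSpace M] [ChartedSpace X M]
    {Ω : TwoForm X M}
    (h : ∀ m : M, ∀ v ∈ (extChartAt 𝓘(ℝ, X) m).target, IsSmoothClosedAt (Ω.inChart m) v)
    (hn : ∀ (p : M) (v : TangentSpace 𝓘(ℝ, X) p),
      (∀ w : TangentSpace 𝓘(ℝ, X) p, Ω p ![v, w] = 0) → v = 0) : IsWeakSymplectic Ω :=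
  ⟨fun m v hv => (h m v hv).1.contDiffWithinAt, fun m v hv => (h m v hv).2, hn⟩

/-- The pull-back of a family of bilinear forms. -/
def pullForm {Y : Type*} [NormedAddCommGroup Y] [NormedSpace ℝ Y] {HN : Type*} [TopologicalSpace HN]
    (I : ModelWithCorners ℝ Y HN) {N : Type*} [TopologicalSpace N] [ChartedSpace HN N]
    (B : N → Y [⋀^Fin 2]→L[ℝ] ℝ) (σ : X → N) (w : X) : X [⋀^Fin 2]→L[ℝ] ℝ :=
  (B (σ w)).compContinuousLinearMap (tderiv 𝓘(ℝ, X) I σ w)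

/-- A form that is locally the sum of a pull-back of a smooth closed form along a linear map and
of an exact form is smooth and closed. -/
theorem isSmoothClosedAt_of_eventuallyEq {Y : Type*} [NormedAddCommGroup Y] [NormedSpace ℝ Y]
    {η : Y → Y [⋀^Fin 2]→L[ℝ] ℝ} {L : X →L[ℝ] Y} {a : X → (X →L[ℝ] ℝ)} {w : X}
    {f : X → X [⋀^Fin 2]→L[ℝ] ℝ} (hη : ContDiffAt ℝ ∞ η (L w)) (hη0 : extDeriv η (L w) = 0)
    (ha : ContDiffAt ℝ ∞ a w)
    (hf : ∀ᶠ w in 𝓝 w, ∀ u u', f w ![u, u'] = η (L w) ![L u, L u']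
      - extDeriv (oneForm a) w ![u, u']) :
    IsSmoothClosedAt f w := by
  replace hf : f =ᶠ[𝓝 w] fun w => (η (L w)).compContinuousLinearMap L
      + (-1 : ℝ) • extDeriv (oneForm a) w := by
    filter_upwards [hf] with w hw
    refine form_ext fun u u' => ?_
    rw [hw, ContinuousAlternatingMap.add_apply, ContinuousAlternatingMap.smul_apply, form_comp]
    simp [sub_eq_add_neg]
  have h2 : ContDiffAt ℝ ∞ (fun w => (η (L w)).compContinuousLinearMap L) w :=
    ((ContinuousAlternatingMap.compContinuousLinearMapCLM (ι := Fin 2) (F := ℝ)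
      L).contDiff.contDiffAt).comp w (hη.comp w L.contDiff.contDiffAt)
  have h3 : ContDiffAt ℝ ∞ (fun w => (-1 : ℝ) • extDeriv (oneForm a) w) w :=
    (contDiffAt_extDeriv (contDiffAt_oneForm ha)).const_smul (-1 : ℝ)
  refine ⟨(h2.add h3).congr_of_eventuallyEq hf, ?_⟩
  -- The exterior derivative commutes with the pull-back along `L`.
  have h4 : extDeriv (fun w => (η (L w)).compContinuousLinearMap L) w = 0 := by
    have h := extDeriv_pullback (f := L) (x := w) (hη.differentiableAt (by simp))
      L.contDiff.contDiffAt minSmoothness_two_le_infty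
    simp only [L.fderiv] at h
    rw [h, hη0]
    exact ContinuousAlternatingMap.ext fun v => rfl
  rw [hf.extDeriv_eq, extDeriv_fun_add (h2.differentiableAt (by simp))
    (h3.differentiableAt (by simp)), h4, zero_add]
  refine (extDeriv_fun_smul (-1 : ℝ) (extDeriv (oneForm a))).trans ?_
  rw [extDeriv_extDeriv_apply (contDiffAt_oneForm ha) minSmoothness_two_le_infty, smul_zero]

end OneForms

section Potential

variable {E F K Y : Type*} [NormedAddCommGroup E] [NormedSpace ℝ E]
  [NormedAddCommGroup F] [NormedSpace ℝ F] [NormedAddCommGroup K] [NormedSpace ℝ K]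
  [NormedAddCommGroup Y] [NormedSpace ℝ Y]
  {B : E →L[ℝ] (F →L[ℝ] ℝ)} {θ : K → (K →L[ℝ] E)} {m : K × Y → F} {w : K × Y}

/-- The one-form `⟨m, θ⟩` of a function `m` and a form `θ` on the first factor. -/
def pairingForm (B : E →L[ℝ] (F →L[ℝ] ℝ)) (θ : K → (K →L[ℝ] E)) (m : K × Y → F) (w : K × Y) :
    K × Y →L[ℝ] ℝ :=
  (B.flip (m w)).comp ((θ w.1).comp (ContinuousLinearMap.fst ℝ K Y))

theorem contDiffAt_pairingForm (hθ : ContDiffAt ℝ ∞ θ w.1) (hm : ContDiffAt ℝ ∞ m w) :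
    ContDiffAt ℝ ∞ (pairingForm B θ m) w :=
  (B.flip.contDiff.contDiffAt.comp w hm).clm_comp
    ((hθ.comp w contDiffAt_fst).clm_comp contDiffAt_const)

theorem fderiv_pairingForm (hθ : ContDiffAt ℝ ∞ θ w.1) (hm : ContDiffAt ℝ ∞ m w) (u u' : K × Y) :
    fderiv ℝ (pairingForm B θ m) w u u'
      = B (fderiv ℝ θ w.1 u.1 u'.1) (m w) + B (θ w.1 u'.1) (fderiv ℝ m w u) := by
  have h1 : HasFDerivAt (fun w : K × Y => θ w.1)
      ((fderiv ℝ θ w.1).comp (ContinuousLinearMap.fst ℝ K Y)) w :=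
    (hθ.differentiableAt (by simp)).hasFDerivAt.comp w hasFDerivAt_fst
  have h2 := h1.clm_apply (hasFDerivAt_const u'.1 w)
  have h3 := (hm.differentiableAt (by simp)).hasFDerivAt
  have h4 := (B.hasFDerivAt.comp w h2).clm_apply h3
  have h5 := ((contDiffAt_pairingForm (B := B) hθ hm).differentiableAt (by simp)).hasFDerivAt
  have h6 := h5.clm_apply (hasFDerivAt_const u' w)
  have h7 := congrArg (fun T : K × Y →L[ℝ] ℝ => T u) (h6.unique h4)
  simp only [ContinuousLinearMap.comp_zero, zero_add, ContinuousLinearMap.flip_apply] at h7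
  refine h7.trans ?_
  simp only [add_apply, ContinuousLinearMap.comp_apply, ContinuousLinearMap.flip_apply,
    ContinuousLinearMap.coe_fst', Function.comp_apply]
  exact add_comm _ _

/-- The antisymmetrized product rule. The last term contains the exterior derivative of `θ`, to
which the Maurer-Cartan equation applies. -/
theorem extDeriv_pairingForm (hθ : ContDiffAt ℝ ∞ θ w.1) (hm : ContDiffAt ℝ ∞ m w)
    (u u' : K × Y) :
    extDeriv (oneForm (pairingForm B θ m)) w ![u, u']
      = B (θ w.1 u'.1) (fderiv ℝ m w u) - B (θ w.1 u.1) (fderiv ℝ m w u')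
        + B (fderiv ℝ θ w.1 u.1 u'.1 - fderiv ℝ θ w.1 u'.1 u.1) (m w) := by
  rw [extDeriv_oneForm (contDiffAt_pairingForm hθ hm), altOf_apply, fderiv_pairingForm hθ hm,
    fderiv_pairingForm hθ hm, map_sub, sub_apply]
  ring

end Potential


theorem tderiv_prodMap_prodMap_id {K EP R E : Type*} [NormedAddCommGroup K] [NormedSpace ℝ K]
    [NormedAddCommGroup EP] [NormedSpace ℝ EP] [NormedAddCommGroup R] [NormedSpace ℝ R]
    [NormedAddCommGroup E] [NormedSpace ℝ E] {G P : Type*} [TopologicalSpace G] [ChartedSpace E G]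
    [TopologicalSpace P] [ChartedSpace EP P] {a : K → G} {b : EP → P} {w : K × EP × R}
    (d1 : MDifferentiableAt 𝓘(ℝ, K) 𝓘(ℝ, E) a w.1)
    (d2 : MDifferentiableAt 𝓘(ℝ, EP) 𝓘(ℝ, EP) b w.2.1) (u : K × EP × R) :
    tderiv 𝓘(ℝ, K × EP × R) (𝓘(ℝ, E).prod (𝓘(ℝ, EP).prod 𝓘(ℝ, R)))
        (fun w : K × EP × R => (a w.1, b w.2.1, w.2.2)) w u
      = (tderiv 𝓘(ℝ, K) 𝓘(ℝ, E) a w.1 u.1, tderiv 𝓘(ℝ, EP) 𝓘(ℝ, EP) b w.2.1 u.2.1, u.2.2) := by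
  let L₁ := ContinuousLinearMap.fst ℝ K (EP × R)
  let L₂ := (ContinuousLinearMap.fst ℝ EP R).comp (ContinuousLinearMap.snd ℝ K (EP × R))
  let L₃ := (ContinuousLinearMap.snd ℝ EP R).comp (ContinuousLinearMap.snd ℝ K (EP × R))
  have e1 : MDifferentiableAt 𝓘(ℝ, K × EP × R) 𝓘(ℝ, E) (fun w => a (L₁ w)) w :=
    MDifferentiableAt.comp (I' := 𝓘(ℝ, K)) (g := a) (f := L₁) w d1 L₁.mdifferentiableAt
  have e2 : MDifferentiableAt 𝓘(ℝ, K × EP × R) 𝓘(ℝ, EP) (fun w => b (L₂ w)) w :=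
    MDifferentiableAt.comp (I' := 𝓘(ℝ, EP)) (g := b) (f := L₂) w d2 L₂.mdifferentiableAt
  have e3 : MDifferentiableAt 𝓘(ℝ, K × EP × R) 𝓘(ℝ, R) (fun w => L₃ w) w :=
    L₃.mdifferentiableAt
  have key : tderiv 𝓘(ℝ, K × EP × R) (𝓘(ℝ, E).prod (𝓘(ℝ, EP).prod 𝓘(ℝ, R)))
        (fun w : K × EP × R => (a w.1, b w.2.1, w.2.2)) w
      = (tderiv 𝓘(ℝ, K × EP × R) 𝓘(ℝ, E) (fun w => a (L₁ w)) w).prod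
        ((tderiv 𝓘(ℝ, K × EP × R) 𝓘(ℝ, EP) (fun w => b (L₂ w)) w).prod
        (tderiv 𝓘(ℝ, K × EP × R) 𝓘(ℝ, R) (fun w => L₃ w) w)) :=
    (tderiv_prodMk e1 (e2.prodMk e3)).trans (congrArg _ (tderiv_prodMk e2 e3))
  rw [key]
  refine Prod.ext ?_ (Prod.ext ?_ ?_)
  · refine (tderiv_comp_apply (g := a) (f := L₁) d1 L₁.mdifferentiableAt u).trans ?_
    rw [tderiv_clm]; rfl
  · refine (tderiv_comp_apply (g := b) (f := L₂) d2 L₂.mdifferentiableAt u).trans ?_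
    rw [tderiv_clm]; rfl
  · exact congrArg (fun T : K × EP × R →L[ℝ] R => T u) (tderiv_clm L₃ w)

/-! ### A potential for the canonical part of the reduced form in coordinates. -/

namespace InvariantSplitting

set_option linter.unusedSectionVars false

variable {E : Type*} [NormedAddCommGroup E] [NormedSpace ℝ E]
  {G : Type*} [TopologicalSpace G] [ChartedSpace E G] [Group G]
  {F : Type*} [NormedAddCommGroup F] [NormedSpace ℝ F] [CompleteSpace F]
  {Q : InvariantPredual E G F} {H : Subgroup G}
  {EH : Type*} [NormedAddCommGroup EH] [NormedSpace ℝ EH] [ChartedSpace EH H]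
  (S : InvariantSplitting Q H EH)
  {EP : Type*} [NormedAddCommGroup EP] [NormedSpace ℝ EP]
  {P : Type*} [TopologicalSpace P] [ChartedSpace EP P] [MulAction H P]
  [IsManifold 𝓘(ℝ, EP) ∞ P]
  [LieGroup 𝓘(ℝ, E) ∞ G] [LieGroup 𝓘(ℝ, EH) ∞ H]
  (sl : Slice E H EH (S.perp →L[ℝ] ℝ)) (g : G) (p : P)

/-- The domain of the coordinates `(v, y, ρ) ↦ [g τ(v), φ⁻¹(y), ρ]`. -/
def coordDomain (EP : Type*) [NormedAddCommGroup EP] [NormedSpace ℝ EP] {P : Type*}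
    [TopologicalSpace P] [ChartedSpace EP P] (p : P) : Set (S.Model EP) :=
  sl.V ×ˢ (extChartAt 𝓘(ℝ, EP) p).target ×ˢ Set.univ

omit [MulAction H P] [IsManifold 𝓘(ℝ, EP) ∞ P] [LieGroup 𝓘(ℝ, E) ∞ G]
  [LieGroup 𝓘(ℝ, EH) ∞ H] [CompleteSpace F] in
theorem isOpen_coordDomain : IsOpen (S.coordDomain sl EP p) :=
  sl.isOpen_V.prod ((isOpen_extChartAt_target p).prod isOpen_univ)

/-- The map `(g, p, ρ) ↦ J p + ρ` in coordinates. -/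
def momCoord (J : P → S.sub) (w : S.Model EP) : F :=
  (J ((extChartAt 𝓘(ℝ, EP) p).symm w.2.1) : F) + w.2.2

/-- The potential of the canonical part of the reduced form in coordinates. -/
abbrev potential (J : P → S.sub) :=
  pairingForm (K := S.perp →L[ℝ] ℝ) (Y := EP × S.perp) (Q.isoE : E →L[ℝ] (F →L[ℝ] ℝ))
    (mcForm (E := E) (fun v => g * sl.τ v)) (S.momCoord p J)

theorem contDiffAt_mcForm_mul_τ {v : S.perp →L[ℝ] ℝ} (hv : v ∈ sl.V) :
    ContDiffAt ℝ ∞ (mcForm (E := E) (fun v => g * sl.τ v)) v :=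
  contDiffAt_mcForm ((sl.contMDiffOn_mul_τ g).contMDiffAt (sl.isOpen_V.mem_nhds hv))

variable {J : P → S.sub} (hJ : ContMDiff 𝓘(ℝ, EP) 𝓘(ℝ, S.sub) ∞ J)

include hJ

theorem contDiffAt_momCoord {w : S.Model EP} (hw : w ∈ S.coordDomain sl EP p) :
    ContDiffAt ℝ ∞ (S.momCoord p J) w := by
  have h1 : ContDiffAt ℝ ∞ (fun y => J ((extChartAt 𝓘(ℝ, EP) p).symm y)) w.2.1 := by
    rw [← contMDiffAt_iff_contDiffAt]
    exact hJ.contMDiffAt.comp w.2.1 (contMDiffAt_extChartAt_symm hw.2.1)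
  have h2 : ContDiffAt ℝ ∞ (fun w : S.Model EP => w.2.1) w :=
    contDiffAt_fst.comp w contDiffAt_snd
  have h3 : ContDiffAt ℝ ∞ (fun w : S.Model EP => w.2.2) w :=
    contDiffAt_snd.comp w contDiffAt_snd
  exact (S.sub.subtypeL.contDiff.contDiffAt.comp w (ContDiffAt.comp w h1 h2)).add
    (S.perp.subtypeL.contDiff.contDiffAt.comp w h3)

theorem fderiv_momCoord {w : S.Model EP} (hw : w ∈ S.coordDomain sl EP p) (u : S.Model EP) :
    fderiv ℝ (S.momCoord p J) w u
      = S.tJ J ((extChartAt 𝓘(ℝ, EP) p).symm w.2.1)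
        (tderiv 𝓘(ℝ, EP) 𝓘(ℝ, EP) (extChartAt 𝓘(ℝ, EP) p).symm w.2.1 u.2.1) + u.2.2 := by
  have hd : MDifferentiableAt 𝓘(ℝ, EP) 𝓘(ℝ, EP) (extChartAt 𝓘(ℝ, EP) p).symm w.2.1 :=
    (contMDiffAt_extChartAt_symm hw.2.1).mdifferentiableAt (by simp)
  have hJd : MDifferentiableAt 𝓘(ℝ, EP) 𝓘(ℝ, S.sub) J ((extChartAt 𝓘(ℝ, EP) p).symm w.2.1) :=
    (hJ _).mdifferentiableAt (by simp)
  have h0 := tderiv_comp (g := J) (f := (extChartAt 𝓘(ℝ, EP) p).symm) hJd hd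
  have hc : MDifferentiableAt 𝓘(ℝ, EP) 𝓘(ℝ, S.sub)
      (fun y => J ((extChartAt 𝓘(ℝ, EP) p).symm y)) w.2.1 :=
    MDifferentiableAt.comp (I' := 𝓘(ℝ, EP)) w.2.1 hJd hd
  have h1 := hc.differentiableAt.hasFDerivAt
  rw [← tderiv_eq_fderiv, h0] at h1
  let L₂ : S.Model EP →L[ℝ] EP := (ContinuousLinearMap.fst ℝ EP S.perp).comp
      (ContinuousLinearMap.snd ℝ (S.perp →L[ℝ] ℝ) (EP × S.perp))
  let L₃ : S.Model EP →L[ℝ] S.perp := (ContinuousLinearMap.snd ℝ EP S.perp).comp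
      (ContinuousLinearMap.snd ℝ (S.perp →L[ℝ] ℝ) (EP × S.perp))
  have h2 : HasFDerivAt (fun w : S.Model EP => w.2.1) L₂ w := L₂.hasFDerivAt
  have h3 : HasFDerivAt (fun w : S.Model EP => w.2.2) L₃ w := L₃.hasFDerivAt
  have h4 := (S.sub.subtypeL.hasFDerivAt.comp w (HasFDerivAt.comp w h1 h2)).add
    (S.perp.subtypeL.hasFDerivAt.comp w h3)
  have h5 : HasFDerivAt (S.momCoord p J) _ w := h4
  rw [h5.fderiv]
  rfl

/-- The exterior derivative of the potential, by the Maurer-Cartan equation. -/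
theorem extDeriv_potential {w : S.Model EP} (hw : w ∈ S.coordDomain sl EP p) (u u' : S.Model EP) :
    extDeriv (oneForm (S.potential sl g p J)) w ![u, u']
      = Q.isoE (mcForm (E := E) (fun v => g * sl.τ v) w.1 u'.1) (fderiv ℝ (S.momCoord p J) w u)
        - Q.isoE (mcForm (E := E) (fun v => g * sl.τ v) w.1 u.1) (fderiv ℝ (S.momCoord p J) w u')
        - Q.isoE (brk G (mcForm (E := E) (fun v => g * sl.τ v) w.1 u.1)
          (mcForm (E := E) (fun v => g * sl.τ v) w.1 u'.1)) (S.momCoord p J w) := by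
  refine (extDeriv_pairingForm (B := (Q.isoE : E →L[ℝ] (F →L[ℝ] ℝ)))
    (S.contDiffAt_mcForm_mul_τ sl g hw.1) (S.contDiffAt_momCoord sl p hJ hw) u u').trans ?_
  have h1 := fderiv_mcForm_sub (E := E) (s := fun v => g * sl.τ v) (v₀ := w.1)
    ((sl.contMDiffOn_mul_τ g).contMDiffAt (sl.isOpen_V.mem_nhds hw.1)) u.1 u'.1
  rw [h1, map_neg, neg_apply, ← sub_eq_add_neg]
  rfl

variable (ωP : TwoForm EP P)

theorem tderiv_chartSection {w : S.Model EP} (hw : w ∈ S.coordDomain sl EP p) (u : S.Model EP) :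
    tderiv 𝓘(ℝ, S.Model EP) (S.totalModel EP) (S.chartSection (EP := EP) sl g p) w u
      = (tderiv 𝓘(ℝ, S.perp →L[ℝ] ℝ) 𝓘(ℝ, E) (fun v => g * sl.τ v) w.1 u.1,
          tderiv 𝓘(ℝ, EP) 𝓘(ℝ, EP) (extChartAt 𝓘(ℝ, EP) p).symm w.2.1 u.2.1, u.2.2) :=
  tderiv_prodMap_prodMap_id
    (((sl.contMDiffOn_mul_τ g).contMDiffAt (sl.isOpen_V.mem_nhds hw.1)).mdifferentiableAt (by simp))
    ((contMDiffAt_extChartAt_symm hw.2.1).mdifferentiableAt (by simp)) u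

/-- The form on the zero level set, pulled back by the section over a chart. -/
theorem pullForm_chartSection {w : S.Model EP} (hw : w ∈ S.coordDomain sl EP p)
    (u u' : S.Model EP) :
    pullForm (X := S.Model EP) (S.totalModel EP) (S.bigForm ωP J) (S.chartSection sl g p) w ![u, u']
      = ωP.inChart p w.2.1 ![u.2.1, u'.2.1]
        - extDeriv (oneForm (S.potential sl g p J)) w ![u, u'] := by
  have h1 : ∀ b b' : EP, ωP.inChart p w.2.1 ![b, b']
      = formAt ωP ((extChartAt 𝓘(ℝ, EP) p).symm w.2.1)
        ![tderiv 𝓘(ℝ, EP) 𝓘(ℝ, EP) (extChartAt 𝓘(ℝ, EP) p).symm w.2.1 b,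
          tderiv 𝓘(ℝ, EP) 𝓘(ℝ, EP) (extChartAt 𝓘(ℝ, EP) p).symm w.2.1 b'] := fun b b' =>
    form_comp (Y := EP) (X := EP) _ _ _ _
  rw [pullForm, form_comp, S.tderiv_chartSection sl g p hJ hw, S.tderiv_chartSection sl g p hJ hw,
    bigForm_apply, h1, S.extDeriv_potential sl g p hJ hw, S.fderiv_momCoord sl p hJ hw,
    S.fderiv_momCoord sl p hJ hw]
  simp only [chartSection, mcForm, ContinuousLinearMap.comp_apply, momCoord]
  ring

variable {ωP} (hω : IsWeakSymplectic ωP)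

-- In these coordinates the canonical part is exact, and what remains is the chart expression of
-- `ω`, pulled back by the linear projection onto the model space of `P`.
include hω in
theorem isSmoothClosedAt_pullForm_chartSection {w : S.Model EP}
    (hw : w ∈ S.coordDomain sl EP p) :
    IsSmoothClosedAt (X := S.Model EP)
      (pullForm (S.totalModel EP) (S.bigForm ωP J) (S.chartSection sl g p)) w := by
  let L₂ := (ContinuousLinearMap.fst ℝ EP S.perp).comp
      (ContinuousLinearMap.snd ℝ (S.perp →L[ℝ] ℝ) (EP × S.perp))
  refine isSmoothClosedAt_of_eventuallyEq (X := S.Model EP) (Y := EP) (η := ωP.inChart p) (L := L₂)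
    (a := S.potential sl g p J)
    ((hω.smooth p).contDiffAt ((isOpen_extChartAt_target p).mem_nhds hw.2.1))
    (hω.closed p _ hw.2.1) (contDiffAt_pairingForm (S.contDiffAt_mcForm_mul_τ sl g hw.1)
      (S.contDiffAt_momCoord sl p hJ hw)) ?_
  filter_upwards [(S.isOpen_coordDomain sl p).mem_nhds hw] with w hw u u'
  exact S.pullForm_chartSection sl g p hJ ωP hw u u'

section Symplectic

variable [ContMDiffSMul 𝓘(ℝ, EH) 𝓘(ℝ, EP) ∞ H P]
  (hι : ContMDiff 𝓘(ℝ, EH) 𝓘(ℝ, E) ∞ (fun h : H => (h : G)))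
  [ChartedSpace (S.Model EP) (S.InducedSpace P)]
  [IsManifold 𝓘(ℝ, S.Model EP) ∞ (S.InducedSpace P)]
  (hM : ∀ m : S.InducedSpace P, chartAt (S.Model EP) m
      = (S.inducedAtlas hι sl m).baseChart (S.isOpenQuotientMap_proj₀ (EP := EP) hι))

include hM in
omit hJ in
/-- The reduced form is a weak symplectic form. -/
theorem isWeakSymplectic_inducedForm (hJ : IsHamiltonianAction ωP S.pairSub S.coAdSub J)
    (hω : IsWeakSymplectic ωP) : IsWeakSymplectic (S.inducedForm sl ωP J) := by
  have key : ∀ (m : S.InducedSpace P) (v : S.Model EP),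
      v ∈ (extChartAt 𝓘(ℝ, S.Model EP) m).target →
      IsSmoothClosedAt (X := S.Model EP) ((S.inducedForm sl ωP J).inChart m) v := by
    intro m v hv
    have h1 := S.isSmoothClosedAt_pullForm_chartSection sl (S.rep m).1 (S.rep m).2.1 hJ.smooth hω
      (w := v) (by rw [PrincipalChart.extChartAt_target_eq hM] at hv; exact hv)
    have h2 : (S.inducedForm sl ωP J).inChart m =ᶠ[𝓝 v] pullForm (X := S.Model EP)
        (S.totalModel EP) (S.bigForm ωP J) (S.chartSection sl (S.rep m).1 (S.rep m).2.1) := by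
      filter_upwards [(isOpen_extChartAt_target m).mem_nhds hv] with w hw
      exact S.inducedForm_inChart hι hM hJ m hw
    exact h1.congr h2
  exact isWeakSymplectic_of_isSmoothClosedAt key
    fun m v hv => S.inducedForm_nondegenerate hι hM hJ hω m v hv

end Symplectic

end InvariantSplitting

/-! ### The explicit formulas and the transversal tangent vectors. -/

namespace InvariantSplitting

set_option linter.unusedSectionVars false

variable {E : Type*} [NormedAddCommGroup E] [NormedSpace ℝ E]
  {G : Type*} [TopologicalSpace G] [ChartedSpace E G] [Group G]
  {F : Type*} [NormedAddCommGroup F] [NormedSpace ℝ F] [CompleteSpace F]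
  {Q : InvariantPredual E G F} {H : Subgroup G}
  {EH : Type*} [NormedAddCommGroup EH] [NormedSpace ℝ EH] [ChartedSpace EH H]
  (S : InvariantSplitting Q H EH)
  {EP : Type*} [NormedAddCommGroup EP] [NormedSpace ℝ EP]
  {P : Type*} [TopologicalSpace P] [ChartedSpace EP P] [MulAction H P]
  [IsManifold 𝓘(ℝ, EP) ∞ P]
  [LieGroup 𝓘(ℝ, E) ∞ G] [LieGroup 𝓘(ℝ, EH) ∞ H]
  (hι : ContMDiff 𝓘(ℝ, EH) 𝓘(ℝ, E) ∞ (fun h : H => (h : G)))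

theorem isoE_brk_swap (ρ : F) (x y : E) :
    Q.isoE (brk G x y) ρ = -Q.isoE (brk G y x) ρ := by
  rw [brk_swap, map_neg, neg_apply]

theorem isoE_brk_add_left (ρ : F) (x y z : E) :
    Q.isoE (brk G (x + y) z) ρ = Q.isoE (brk G x z) ρ + Q.isoE (brk G y z) ρ := by
  rw [← brkPair_apply, map_add, add_apply, brkPair_apply, brkPair_apply]

theorem isoE_brk_add_right (ρ : F) (x y z : E) :
    Q.isoE (brk G x (y + z)) ρ = Q.isoE (brk G x y) ρ + Q.isoE (brk G x z) ρ := by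
  rw [← brkPair_apply, map_add, brkPair_apply, brkPair_apply]

theorem isoE_brk_smul_left (ρ : F) (c : ℝ) (x y : E) :
    Q.isoE (brk G (c • x) y) ρ = c * Q.isoE (brk G x y) ρ := by
  rw [← brkPair_apply, map_smul, smul_apply, brkPair_apply, smul_eq_mul]

theorem isoE_brk_smul_right (ρ : F) (c : ℝ) (x y : E) :
    Q.isoE (brk G x (c • y)) ρ = c * Q.isoE (brk G x y) ρ := by
  rw [← brkPair_apply, map_smul, brkPair_apply, smul_eq_mul]

include hι

/-- Since `ad*_x` with `x ∈ 𝔥` preserves `𝔥_*`, bracketing with `x` preserves the annihilator `𝔥^⊥`.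
-/
theorem isoE_brk_embE_sub (x : EH) {ρ : F} (hρ : ρ ∈ S.sub) {y : E} (hy : S.MemPerp y) :
    Q.isoE (brk G (S.embE x) y) ρ = 0 := by
  rw [← Q.isoE_coadL]
  exact hy _ (S.coadL_mem_sub hι x hρ)

/-- Dually, `ad*_x` preserves `𝔥_*^⊥`, so bracketing with `x` preserves its annihilator `𝔥`. -/
theorem isoE_brk_embE_perp (x y : EH) {ρ : F} (hρ : ρ ∈ S.perp) :
    Q.isoE (brk G (S.embE x) (S.embE y)) ρ = 0 := by
  rw [← Q.isoE_coadL]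
  exact S.isoE_embE_perp y (S.coadL_mem_perp hι x hρ)

/-- The canonical part of the form in terms of the splitting of the Lie algebra. -/
theorem isoE_brk_split (ρs : S.sub) (ρ : S.perp) (x y : EH) {x' y' : E} (hx : S.MemPerp x')
    (hy : S.MemPerp y') :
    Q.isoE (brk G (S.embE x + x') (S.embE y + y')) (ρs + ρ)
      = Q.isoE (brk G (S.embE x) (S.embE y)) ρs
        + (Q.isoE (brk G x' (S.embE y)) ρ + Q.isoE (brk G (S.embE x) y') ρ)
        + Q.isoE (brk G x' y') (ρs + ρ) := by
  have h1 := S.isoE_brk_embE_sub hι x ρs.2 hy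
  have h2 := S.isoE_brk_embE_sub hι y ρs.2 hx
  have h3 := S.isoE_brk_embE_perp hι x y ρ.2
  have h4 := isoE_brk_swap (Q := Q) (ρs : F) (S.embE y) x'
  rw [isoE_brk_add_left, isoE_brk_add_right, isoE_brk_add_right]
  simp only [map_add]
  linarith

variable {ωP : TwoForm EP P} {J : P → S.sub}

/-- The form on the zero level set in terms of the splitting of the Lie algebra. -/
theorem bigForm_split (g : G) (p : P) (ρ μ ν : S.perp) (x y : EH) {x' y' : E} (a b : EP)
    (hx : S.MemPerp x') (hy : S.MemPerp y') :
    S.bigForm ωP J (g, p, ρ) ![(leftT E g (S.embE x + x'), a, μ), (leftT E g (S.embE y + y'), b, ν)]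
      = formAt ωP p ![a, b]
        + Q.isoE (S.embE x) (S.tJ J p b) + Q.isoE x' ν
        - Q.isoE (S.embE y) (S.tJ J p a) - Q.isoE y' μ
        + Q.isoE (brk G (S.embE x) (S.embE y)) (J p)
        + Q.isoE (brk G x' (S.embE y) + brk G (S.embE x) y') ρ
        + Q.isoE (brk G x' y') ((J p : F) + ρ) := by
  have h1 : Q.isoE x' (S.tJ J p b) = 0 := hx _ (S.tJ_mem_sub J p b)
  have h2 : Q.isoE y' (S.tJ J p a) = 0 := hy _ (S.tJ_mem_sub J p a)
  have h3 := S.isoE_embE_perp x ν.2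
  have h4 := S.isoE_embE_perp y μ.2
  rw [bigForm_apply]
  simp only [leftTInv_leftT]
  rw [S.isoE_brk_split hι _ _ _ _ hx hy]
  simp only [map_add, add_apply]
  linarith

/-- The form on the zero level set in terms of vectors transversal to the orbits. -/
theorem bigForm_split_transversal (hJ : IsHamiltonianAction ωP S.pairSub S.coAdSub J) (g : G)
    (p : P) (ρ μ ν : S.perp) (x y : EH) {x' y' : E} (a b : EP)
    (hx : S.MemPerp x') (hy : S.MemPerp y') :
    S.bigForm ωP J (g, p, ρ) ![(leftT E g (S.embE x + x'), a, μ), (leftT E g (S.embE y + y'), b, ν)]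
      = formAt ωP p ![a - gen H EH p x, b - gen H EH p y]
        + Q.isoE ((2 : ℝ) • S.embE x) (S.tJ J p (b - gen H EH p y))
        + Q.isoE x' (ν + Q.coad (S.embE y) ρ)
        - Q.isoE ((2 : ℝ) • S.embE y) (S.tJ J p (a - gen H EH p x))
        - Q.isoE y' (μ + Q.coad (S.embE x) ρ)
        + Q.isoE (brk G ((2 : ℝ) • S.embE x) ((2 : ℝ) • S.embE y)) (J p)
        + Q.isoE (brk G x' ((2 : ℝ) • S.embE y) + brk G ((2 : ℝ) • S.embE x) y') ρ
        + Q.isoE (brk G x' y') ((J p : F) + ρ) := by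
  rw [Q.coad_eq_coadL, Q.coad_eq_coadL]
  have := hJ.smooth_action
  have h1 := S.formAt_gen hJ p x b
  have h2 := S.formAt_gen hJ p y a
  have h3 := S.formAt_gen hJ p x (gen H EH p y)
  -- The formula holds because the vector `(2x + x', a - x_P, μ + ad*_x ρ)` is the given one minus
  -- the orbit vector of `x`. The check is by expansion: the generator terms of `ω` become values of
  -- `J` by `formAt_gen` and infinitesimal equivariance.
  have e1 : formAt ωP p ![a, b] = formAt ωP p ![a - gen H EH p x, b - gen H EH p y]
      + formAt ωP p ![gen H EH p x, b] - formAt ωP p ![gen H EH p y, a]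
      - formAt ωP p ![gen H EH p x, gen H EH p y] := by
    have k1 := form_add_left (formAt ωP p) (a - gen H EH p x) (gen H EH p x) b
    have k2 := form_add_right (formAt ωP p) (a - gen H EH p x) (b - gen H EH p y) (gen H EH p y)
    have k3 := form_add_left (formAt ωP p) (a - gen H EH p x) (gen H EH p x) (gen H EH p y)
    have k4 := form_swap (formAt ωP p) a (gen H EH p y)
    rw [sub_add_cancel] at k1 k2 k3
    linarith
  have h5 := S.tJ_gen hι hJ.smooth hJ.equivariant p x
  have h6 := S.tJ_gen hι hJ.smooth hJ.equivariant p y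
  have h7 := isoE_brk_swap (Q := Q) (J p : F) (S.embE y) (S.embE x)
  have h8 := isoE_brk_swap (Q := Q) (ρ : F) (S.embE y) x'
  rw [h6] at h3
  rw [S.bigForm_split hι g p ρ μ ν x y a b hx hy, e1, h1, h2, h3]
  simp only [map_sub, map_add, add_apply, map_smul, smul_apply, smul_eq_mul, h5, h6,
    map_neg, Q.isoE_coadL, isoE_brk_smul_left, isoE_brk_smul_right]
  rw [h7, h8]
  ring

omit hι in
/-- Every element of the Lie algebra has the form `2 x + x'` with `x` in the subalgebra and `x'`
in the complement. -/
theorem exists_two_smul_embE_add (y : E) :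
    ∃ (x : EH) (x' : E), S.MemPerp x' ∧ (2 : ℝ) • S.embE x + x' = y := by
  obtain ⟨z, hz⟩ := S.exists_decomp y
  -- Half of the component in `𝔥` absorbs the factor `2`.
  refine ⟨(2⁻¹ : ℝ) • z, S.perpE (S.restrPerp y), S.memPerp_perpE _, ?_⟩
  rw [map_smul, smul_smul, mul_inv_cancel₀ two_ne_zero, one_smul, hz]

/-- Every tangent vector of `G × P × 𝔥_*^⊥` has the form that occurs in the formula for
transversal vectors. -/
theorem exists_transversal_eq (g : G) (p : P) (ρ : S.perp) (u : E × EP × S.perp) :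
    ∃ (x : EH) (x' : E) (a : EP) (μ μ' : S.perp), S.MemPerp x' ∧
      (μ' : F) = μ + Q.coad (S.embE x) ρ ∧
      u = (leftT E g ((2 : ℝ) • S.embE x + x'), a - gen H EH p x, μ') := by
  obtain ⟨x, x', hx', hx⟩ := S.exists_two_smul_embE_add (leftTInv E g u.1)
  -- Once `x` is fixed by the first component, the shifts in the other two are undone by the choice
  -- of `a` and `μ`; the coadjoint term stays in `𝔥_*^⊥` because `x ∈ 𝔥`.
  refine ⟨x, x', u.2.1 + gen H EH p x,
    u.2.2 - ⟨Q.coadL (S.embE x) ρ, S.coadL_mem_perp hι x ρ.2⟩, u.2.2, hx', ?_, ?_⟩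
  · rw [Q.coad_eq_coadL]
    simp
  · rw [hx, leftT_leftTInv, add_sub_cancel_right]

end InvariantSplitting

/-! ### The action of `G` on the induced space and the derivative of the induced momentum map. -/

/-- Smoothness of a map with a parameter descends to the base. -/
theorem PrincipalChart.contMDiff_uncurry_of_comp_proj
    {EX : Type*} [NormedAddCommGroup EX] [NormedSpace ℝ EX]
    {HX : Type*} [TopologicalSpace HX] {I : ModelWithCorners ℝ EX HX}
    {X : Type*} [TopologicalSpace X] [ChartedSpace HX X] {Y : Type*} [TopologicalSpace Y]
    {π : X → Y} {E' : Type*} [NormedAddCommGroup E'] [NormedSpace ℝ E']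
    {EA : Type*} [NormedAddCommGroup EA] [NormedSpace ℝ EA]
    {A : Type*} [TopologicalSpace A] [ChartedSpace EA A] {o : A}
    [ChartedSpace E' Y] [IsManifold 𝓘(ℝ, E') ∞ Y] {hπ : IsOpenQuotientMap π}
    {c : Y → PrincipalChart I π E' EA o} (hc : ∀ y, chartAt E' y = (c y).baseChart hπ)
    {EN : Type*} [NormedAddCommGroup EN] [NormedSpace ℝ EN]
    {HN : Type*} [TopologicalSpace HN] {J : ModelWithCorners ℝ EN HN} {N : Type*}
    [TopologicalSpace N] [ChartedSpace HN N]
    {EZ : Type*} [NormedAddCommGroup EZ] [NormedSpace ℝ EZ]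
    {HZ : Type*} [TopologicalSpace HZ] {IZ : ModelWithCorners ℝ EZ HZ} {Z : Type*}
    [TopologicalSpace Z] [ChartedSpace HZ Z] {f : Z × Y → N}
    (hf : ContMDiff (IZ.prod I) J ∞ (fun q : Z × X => f (q.1, π q.2))) :
    ContMDiff (IZ.prod 𝓘(ℝ, E')) J ∞ f := by
  rintro ⟨z, y⟩
  have hW : (c y).W ∈ 𝓝 y := (c y).isOpen_W.mem_nhds (mem_W hc y)
  have h1 : ContMDiffAt 𝓘(ℝ, E') I ∞ (fun y' => (c y).σ (extChartAt 𝓘(ℝ, E') y y')) y :=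
    (contMDiffOn_section hc y).contMDiffAt hW
  have h2 : ContMDiffAt (IZ.prod 𝓘(ℝ, E')) I ∞
      (fun q : Z × Y => (c y).σ (extChartAt 𝓘(ℝ, E') y q.2)) (z, y) :=
    ContMDiffAt.comp (I' := 𝓘(ℝ, E')) (z, y) (f := Prod.snd)
      (g := fun y' => (c y).σ (extChartAt 𝓘(ℝ, E') y y')) h1 contMDiffAt_snd
  have h3 : ContMDiffAt (IZ.prod 𝓘(ℝ, E')) J ∞
      (fun q : Z × Y => f (q.1, π ((c y).σ (extChartAt 𝓘(ℝ, E') y q.2)))) (z, y) :=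
    ContMDiffAt.comp (I' := IZ.prod I) (z, y)
      (f := fun q : Z × Y => (q.1, (c y).σ (extChartAt 𝓘(ℝ, E') y q.2)))
      (g := fun q : Z × X => f (q.1, π q.2)) (hf _) (contMDiffAt_fst.prodMk h2)
  refine h3.congr_of_eventuallyEq ?_
  filter_upwards [continuousAt_snd.preimage_mem_nhds hW] with q hq
  rw [proj_section hc y hq]

section Generator

variable {E : Type*} [NormedAddCommGroup E] [NormedSpace ℝ E]
  {G : Type*} [TopologicalSpace G] [ChartedSpace E G] [Group G] [LieGroup 𝓘(ℝ, E) ∞ G]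
  {E' : Type*} [NormedAddCommGroup E'] [NormedSpace ℝ E']
  {M : Type*} [TopologicalSpace M] [ChartedSpace E' M] [IsManifold 𝓘(ℝ, E') ∞ M]
  [MulAction G M] [ContMDiffSMul 𝓘(ℝ, E) 𝓘(ℝ, E') ∞ G M]

omit [IsManifold 𝓘(ℝ, E') ∞ M] in
theorem mk_tangentBundle_congr {m m' : M} (h : m = m') {v v' : E'} (hv : v = v') :
    (⟨m, v⟩ : TangentBundle 𝓘(ℝ, E') M) = ⟨m', v'⟩ := by
  subst h hv
  rfl

/-- The infinitesimal generators of a smooth action are smooth vector fields. -/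
theorem contMDiff_generator (z : LieAlg E G) :
    ContMDiff 𝓘(ℝ, E') 𝓘(ℝ, E').tangent ∞
      (fun m : M => (⟨m, generator z m⟩ : TangentBundle 𝓘(ℝ, E') M)) := by
  have hA : ContMDiff (𝓘(ℝ, E).prod 𝓘(ℝ, E')) 𝓘(ℝ, E') ∞ (fun q : G × M => q.1 • q.2) :=
    contMDiff_smul
  have h1 : ContMDiff 𝓘(ℝ, E') 𝓘(ℝ, E').tangent ∞
      (fun m : M => (⟨m, 0⟩ : TangentBundle 𝓘(ℝ, E') M)) :=
    Bundle.contMDiff_zeroSection ℝ (TangentSpace 𝓘(ℝ, E') : M → Type _)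
  have h2 : ContMDiff 𝓘(ℝ, E') 𝓘(ℝ, E).tangent ∞
      (fun _ : M => (⟨1, z⟩ : TangentBundle 𝓘(ℝ, E) G)) := contMDiff_const
  have h3 := (contMDiff_equivTangentBundleProd_symm (I := 𝓘(ℝ, E)) (I' := 𝓘(ℝ, E')) (M := G)
    (M' := M) (n := ∞)).comp (h2.prodMk h1)
  have h4 := (hA.contMDiff_tangentMap (m := ∞) le_rfl).comp h3
  refine h4.congr fun m => ?_
  refine mk_tangentBundle_congr (one_smul G m).symm ?_
  refine Eq.trans ?_ (tderiv_prod_apply (f := fun q : G × M => q.1 • q.2) (x := (1 : G)) (y := m)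
    ((hA _).mdifferentiableAt (by simp)) (z : E) (0 : E')).symm
  rw [map_zero, add_zero]
  rfl

end Generator

section Adjoint

variable {E : Type*} [NormedAddCommGroup E] [NormedSpace ℝ E]
  {G : Type*} [TopologicalSpace G] [ChartedSpace E G] [Group G] [LieGroup 𝓘(ℝ, E) ∞ G]

theorem mdiffAt_adMap_inv (g : G) :
    MDifferentiableAt 𝓘(ℝ, E) 𝓘(ℝ, E →L[ℝ] E) (fun g : G => adMap E g⁻¹) g :=
  MDifferentiableAt.comp (I' := 𝓘(ℝ, E)) g (f := fun g : G => g⁻¹) (mdiffAt_adMap g⁻¹)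
    (((contMDiff_inv 𝓘(ℝ, E) ∞) g).mdifferentiableAt (by simp))

theorem tderiv_adMap_inv_one (x y : E) :
    tderiv 𝓘(ℝ, E) 𝓘(ℝ, E →L[ℝ] E) (fun g : G => adMap E g⁻¹) 1 x y = -brk G x y := by
  have h := tderiv_comp_apply (g := fun g : G => adMap E g) (f := fun g : G => g⁻¹) (x := (1 : G))
    (mdiffAt_adMap (1 : G)⁻¹) (((contMDiff_inv 𝓘(ℝ, E) ∞) 1).mdifferentiableAt (by simp)) x
  rw [tderiv_inv_one, inv_one, map_neg] at h
  rw [h, neg_apply, tderiv_adMap]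

/-- The derivative of the inverse adjoint action in the left trivialization. -/
theorem tderiv_adMap_inv (g : G) (x y : E) :
    tderiv 𝓘(ℝ, E) 𝓘(ℝ, E →L[ℝ] E) (fun g : G => adMap E g⁻¹) g (leftT E g x) y
      = -brk G x (adMap E g⁻¹ y) := by
  have h1 := tderiv_comp_apply (g := fun g : G => adMap E g⁻¹) (f := fun a : G => g * a)
    (x := (1 : G)) (mdiffAt_adMap_inv (g * 1)) (mdiffAt_mul_left g 1) x
  have h2 : (fun a : G => adMap E (g * a)⁻¹)
      = fun a : G => (ContinuousLinearMap.compL ℝ E E E).flip (adMap E g⁻¹) (adMap E a⁻¹) := by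
    funext a
    ext y
    rw [mul_inv_rev, adMap_mul]
    rfl
  have h3 := tderiv_clm_comp ((ContinuousLinearMap.compL ℝ E E E).flip (adMap E g⁻¹))
    (mdiffAt_adMap_inv (E := E) (1 : G))
  rw [h2, h3, mul_one] at h1
  have h4 := congrArg (fun T : E →L[ℝ] E => T y) h1
  exact h4.symm.trans (tderiv_adMap_inv_one x _)

end Adjoint

namespace InvariantSplitting

set_option linter.unusedSectionVars false

variable {E : Type*} [NormedAddCommGroup E] [NormedSpace ℝ E]
  {G : Type*} [TopologicalSpace G] [ChartedSpace E G] [Group G]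
  {F : Type*} [NormedAddCommGroup F] [NormedSpace ℝ F] [CompleteSpace F]
  {Q : InvariantPredual E G F} {H : Subgroup G}
  {EH : Type*} [NormedAddCommGroup EH] [NormedSpace ℝ EH] [ChartedSpace EH H]
  (S : InvariantSplitting Q H EH)
  {EP : Type*} [NormedAddCommGroup EP] [NormedSpace ℝ EP]
  {P : Type*} [TopologicalSpace P] [ChartedSpace EP P] [MulAction H P]
  [IsManifold 𝓘(ℝ, EP) ∞ P]
  [LieGroup 𝓘(ℝ, E) ∞ G] [LieGroup 𝓘(ℝ, EH) ∞ H]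
  (hι : ContMDiff 𝓘(ℝ, EH) 𝓘(ℝ, E) ∞ (fun h : H => (h : G)))
  [ContMDiffSMul 𝓘(ℝ, EH) 𝓘(ℝ, EP) ∞ H P] {sl : Slice E H EH (S.perp →L[ℝ] ℝ)}

section LeftTranslation

theorem contMDiff_leftTranslation :
    ContMDiff (𝓘(ℝ, E).prod (S.totalModel EP)) (S.totalModel EP) ∞
      (fun r : G × G × P × S.perp => (r.1 * r.2.1, r.2.2)) :=
  (contMDiff_fst.mul (contMDiff_fst.comp contMDiff_snd)).prodMk
    (contMDiff_snd.comp contMDiff_snd)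

theorem tderiv_leftTranslation (g' g : G) (p : P) (ρ μ : S.perp) (x : E) (a : EP) :
    tderiv (S.totalModel EP) (S.totalModel EP) (fun q : G × P × S.perp => (g' * q.1, q.2)) (g, p, ρ)
        (leftT E g x, a, μ) = (leftT E (g' * g) x, a, μ) := by
  have h1 : MDifferentiableAt (S.totalModel EP) 𝓘(ℝ, E) (fun q : G × P × S.perp => g' * q.1)
      (g, p, ρ) :=
    MDifferentiableAt.comp (I' := 𝓘(ℝ, E)) (g, p, ρ) (mdiffAt_mul_left _ _) mdifferentiableAt_fst
  have key := tderiv_prodMk (I := S.totalModel EP) (I'' := 𝓘(ℝ, EP).prod 𝓘(ℝ, S.perp)) h1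
    (g := fun q : G × P × S.perp => q.2) mdifferentiableAt_snd
  rw [key]
  refine Prod.ext ?_ ?_
  · refine (tderiv_comp_apply (I' := 𝓘(ℝ, E)) (g := fun a : G => g' * a) (f := Prod.fst)
      (x := (g, p, ρ)) (mdiffAt_mul_left _ _) mdifferentiableAt_fst _).trans ?_
    rw [tderiv_fst]
    exact leftT_mul g' g x
  · refine congrArg (fun T : (E × EP × S.perp) →L[ℝ] EP × S.perp => T (leftT E g x, a, μ))
      (tderiv_snd (I := 𝓘(ℝ, E)) (I' := 𝓘(ℝ, EP).prod 𝓘(ℝ, S.perp)) (g, p, ρ))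

theorem tderiv_rightTranslation (g : G) (p : P) (ρ : S.perp) (z : E) :
    tderiv 𝓘(ℝ, E) (S.totalModel EP) (fun a : G => (a * g, p, ρ)) 1 z
      = (leftT E g (adMap E g⁻¹ z), 0, 0) := by
  have h1 : MDifferentiableAt 𝓘(ℝ, E) 𝓘(ℝ, E) (fun a : G => a * g) 1 := mdiffAt_mul_right _ _
  have key := tderiv_prodMk (I := 𝓘(ℝ, E)) (I'' := 𝓘(ℝ, EP).prod 𝓘(ℝ, S.perp)) h1
    (g := fun _ : G => (p, ρ)) mdifferentiableAt_const
  rw [key, tderiv_const]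
  refine Prod.ext ?_ rfl
  have h2 := rightT_leftT (1 : G) g z
  rw [leftT_one, one_mul] at h2
  exact h2

/-- In the left trivialization neither the tangent vectors nor the form depend on the component in
`G`. -/
theorem bigForm_leftTranslation (ωP : TwoForm EP P) (J : P → S.sub) (g' : G) (q : G × P × S.perp)
    (u w : E × EP × S.perp) :
    S.bigForm ωP J (g' * q.1, q.2)
      ![tderiv (S.totalModel EP) (S.totalModel EP)
          (fun q : G × P × S.perp => (g' * q.1, q.2)) q u,
        tderiv (S.totalModel EP) (S.totalModel EP)
          (fun q : G × P × S.perp => (g' * q.1, q.2)) q w]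
      = S.bigForm ωP J q ![u, w] := by
  obtain ⟨g, p, ρ⟩ := q
  obtain ⟨u₁, a, μ⟩ := u
  obtain ⟨w₁, b, ν⟩ := w
  obtain ⟨x, rfl⟩ : ∃ x, leftT E g x = u₁ := ⟨_, leftT_leftTInv g u₁⟩
  obtain ⟨y, rfl⟩ : ∃ y, leftT E g y = w₁ := ⟨_, leftT_leftTInv g w₁⟩
  rw [S.tderiv_leftTranslation, S.tderiv_leftTranslation, bigForm_apply, bigForm_apply]
  simp only [leftTInv_leftT]

end LeftTranslation

section Momentum

variable {J : P → S.sub} (hJs : ContMDiff 𝓘(ℝ, EP) 𝓘(ℝ, S.sub) ∞ J)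

/-- The map `(g, p, ρ) ↦ Ad*_{g⁻¹} (J p + ρ)`. -/
def totalMomentum (J : P → S.sub) (q : G × P × S.perp) : F :=
  Q.coAd q.1⁻¹ ((J q.2.1 : F) + q.2.2)

include hJs

theorem contMDiff_sum :
    ContMDiff (S.totalModel EP) 𝓘(ℝ, F) ∞
      (fun q : G × P × S.perp => (J q.2.1 : F) + q.2.2) := by
  have h1 : ContMDiff (S.totalModel EP) 𝓘(ℝ, S.sub) ∞ (fun q : G × P × S.perp => J q.2.1) :=
    hJs.comp (contMDiff_fst.comp contMDiff_snd)
  have h2 : ContMDiff (S.totalModel EP) 𝓘(ℝ, S.perp) ∞ (fun q : G × P × S.perp => q.2.2) :=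
    contMDiff_snd.comp contMDiff_snd
  exact (S.sub.subtypeL.contMDiff.comp h1).add (S.perp.subtypeL.contMDiff.comp h2)

theorem contMDiff_totalMomentum :
    ContMDiff (S.totalModel EP) 𝓘(ℝ, F) ∞ (S.totalMomentum J) := by
  have h1 : ContMDiff (S.totalModel EP) 𝓘(ℝ, F →L[ℝ] F) ∞
      (fun q : G × P × S.perp => Q.coAdL q.1⁻¹) :=
    ContMDiff.comp (I' := 𝓘(ℝ, E)) (g := fun g : G => Q.coAdL g)
      (f := fun q : G × P × S.perp => q.1⁻¹) Q.contMDiff_coAdL contMDiff_fst.inv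
  exact h1.clm_apply (S.contMDiff_sum hJs)

theorem tderiv_sum (q : G × P × S.perp) (u : E × EP × S.perp) :
    tderiv (S.totalModel EP) 𝓘(ℝ, F) (fun q : G × P × S.perp => (J q.2.1 : F) + q.2.2) q u
      = S.tJ J q.2.1 u.2.1 + u.2.2 := by
  have e2 : MDifferentiableAt (S.totalModel EP) 𝓘(ℝ, EP) (fun q : G × P × S.perp => q.2.1) q :=
    MDifferentiableAt.comp (I' := 𝓘(ℝ, EP).prod 𝓘(ℝ, S.perp)) q
      (g := Prod.fst) (f := Prod.snd) mdifferentiableAt_fst mdifferentiableAt_snd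
  have e3 : MDifferentiableAt (S.totalModel EP) 𝓘(ℝ, S.perp) (fun q : G × P × S.perp => q.2.2) q :=
    MDifferentiableAt.comp (I' := 𝓘(ℝ, EP).prod 𝓘(ℝ, S.perp)) q
      (g := Prod.snd) (f := Prod.snd) mdifferentiableAt_snd mdifferentiableAt_snd
  have hJd : MDifferentiableAt 𝓘(ℝ, EP) 𝓘(ℝ, S.sub) J q.2.1 := (hJs _).mdifferentiableAt (by simp)
  have e4 : MDifferentiableAt (S.totalModel EP) 𝓘(ℝ, S.sub) (fun q : G × P × S.perp => J q.2.1) q :=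
    MDifferentiableAt.comp (I' := 𝓘(ℝ, EP)) (g := J) q hJd e2
  have t2 : tderiv (S.totalModel EP) 𝓘(ℝ, EP) (fun q : G × P × S.perp => q.2.1) q u = u.2.1 := by
    refine (tderiv_comp_apply (I' := 𝓘(ℝ, EP).prod 𝓘(ℝ, S.perp)) (g := Prod.fst)
      (f := Prod.snd) (x := q) mdifferentiableAt_fst mdifferentiableAt_snd _).trans ?_
    rw [tderiv_snd, tderiv_fst]; rfl
  have t3 : tderiv (S.totalModel EP) 𝓘(ℝ, S.perp) (fun q : G × P × S.perp => q.2.2) q u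
      = u.2.2 := by
    refine (tderiv_comp_apply (I' := 𝓘(ℝ, EP).prod 𝓘(ℝ, S.perp)) (g := Prod.snd)
      (f := Prod.snd) (x := q) mdifferentiableAt_snd mdifferentiableAt_snd _).trans ?_
    rw [tderiv_snd, tderiv_snd]; rfl
  have t4 := tderiv_comp_apply (g := J) (f := fun q : G × P × S.perp => q.2.1) hJd e2 u
  have k1 : MDifferentiableAt (S.totalModel EP) 𝓘(ℝ, F)
      (fun q : G × P × S.perp => S.sub.subtypeL (J q.2.1)) q :=
    MDifferentiableAt.comp (I' := 𝓘(ℝ, S.sub)) q S.sub.subtypeL.mdifferentiableAt e4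
  have k2 : MDifferentiableAt (S.totalModel EP) 𝓘(ℝ, F)
      (fun q : G × P × S.perp => S.perp.subtypeL q.2.2) q :=
    MDifferentiableAt.comp (I' := 𝓘(ℝ, S.perp)) q S.perp.subtypeL.mdifferentiableAt e3
  have k3 : tderiv (S.totalModel EP) 𝓘(ℝ, F)
      (fun q : G × P × S.perp => S.sub.subtypeL (J q.2.1) + S.perp.subtypeL q.2.2) q
      = tderiv (S.totalModel EP) 𝓘(ℝ, F) (fun q : G × P × S.perp => S.sub.subtypeL (J q.2.1)) q
        + tderiv (S.totalModel EP) 𝓘(ℝ, F) (fun q : G × P × S.perp => S.perp.subtypeL q.2.2) q :=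
    mfderiv_add k1 k2
  rw [tderiv_clm_comp _ e4, tderiv_clm_comp _ e3] at k3
  refine (congrArg (fun T : (E × EP × S.perp) →L[ℝ] F => T u) k3).trans ?_
  rw [add_apply, ContinuousLinearMap.comp_apply, ContinuousLinearMap.comp_apply, t3, t4, t2]
  rfl

/-- The derivative of the components of the momentum map. -/
theorem isoE_tderiv_totalMomentum (ωP : TwoForm EP P) (q : G × P × S.perp) (z : E)
    (u : E × EP × S.perp) :
    Q.isoE z (tderiv (S.totalModel EP) 𝓘(ℝ, F) (S.totalMomentum J) q u)
      = S.bigForm ωP J q ![(leftT E q.1 (adMap E q.1⁻¹ z), 0, 0), u] := by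
  obtain ⟨x, hx⟩ : ∃ x, leftT E q.1 x = u.1 := ⟨_, leftT_leftTInv q.1 u.1⟩
  have d0 : MDifferentiableAt (S.totalModel EP) 𝓘(ℝ, F) (S.totalMomentum J) q :=
    (S.contMDiff_totalMomentum hJs q).mdifferentiableAt (by simp)
  have d1 : MDifferentiableAt (S.totalModel EP) 𝓘(ℝ, F)
      (fun q : G × P × S.perp => (J q.2.1 : F) + q.2.2) q :=
    (S.contMDiff_sum hJs q).mdifferentiableAt (by simp)
  have d2 : MDifferentiableAt (S.totalModel EP) 𝓘(ℝ, E →L[ℝ] E)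
      (fun q : G × P × S.perp => adMap E q.1⁻¹) q :=
    MDifferentiableAt.comp (I' := 𝓘(ℝ, E)) q (f := Prod.fst) (mdiffAt_adMap_inv q.1)
      mdifferentiableAt_fst
  have d3 : MDifferentiableAt (S.totalModel EP) 𝓘(ℝ, E)
      (fun q : G × P × S.perp => adMap E q.1⁻¹ z) q :=
    MDifferentiableAt.comp (I' := 𝓘(ℝ, E →L[ℝ] E)) q
      (ContinuousLinearMap.apply ℝ E z).mdifferentiableAt d2
  have t2 : tderiv (S.totalModel EP) 𝓘(ℝ, E →L[ℝ] E)
      (fun q : G × P × S.perp => adMap E q.1⁻¹) q u z = -brk G x (adMap E q.1⁻¹ z) := by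
    rw [tderiv_comp_apply (I' := 𝓘(ℝ, E)) (f := Prod.fst) (g := fun g : G => adMap E g⁻¹)
      (mdiffAt_adMap_inv q.1) mdifferentiableAt_fst, tderiv_fst, ← tderiv_adMap_inv, hx]
    rfl
  have t3 : tderiv (S.totalModel EP) 𝓘(ℝ, E) (fun q : G × P × S.perp => adMap E q.1⁻¹ z) q u
      = -brk G x (adMap E q.1⁻¹ z) := by
    rw [← t2]
    exact congrArg (fun T : (E × EP × S.perp) →L[ℝ] E => T u)
      (tderiv_clm_comp (ContinuousLinearMap.apply ℝ E z) d2)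
  have hB : MDifferentiableAt (𝓘(ℝ, E).prod 𝓘(ℝ, F)) 𝓘(ℝ, ℝ) (fun r : E × F => Q.isoE r.1 r.2)
      (adMap E q.1⁻¹ z, (J q.2.1 : F) + q.2.2) := by
    have h : ContMDiff (𝓘(ℝ, E).prod 𝓘(ℝ, F)) 𝓘(ℝ, ℝ) ∞ (fun r : E × F => Q.isoE r.1 r.2) :=
      ((Q.isoE : E →L[ℝ] (F →L[ℝ] ℝ)).contMDiff.comp contMDiff_fst).clm_apply contMDiff_snd
    exact (h _).mdifferentiableAt (by simp)
  have t4 := tderiv_comp₂ hB d3 d1 u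
  rw [t3, S.tderiv_sum hJs] at t4
  -- Moving the coadjoint action to `z` avoids differentiating the coadjoint representation: the
  -- component becomes the pairing of `J + ρ` with `Ad_{g⁻¹} z`, and only `Ad` is differentiated.
  have t5 : (fun q : G × P × S.perp => Q.isoE (adMap E q.1⁻¹ z) ((J q.2.1 : F) + q.2.2))
      = fun q => Q.isoE z (S.totalMomentum J q) := by
    funext q
    rw [totalMomentum, Q.isoE_coAd]
  have t6 := tderiv_clm_comp (Q.isoE z) d0
  rw [← t5] at t6
  have t7 := congrArg (fun T : (E × EP × S.perp) →L[ℝ] ℝ => T u) t6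
  have t8 := tderiv_clm (((Q.isoE : E →L[ℝ] (F →L[ℝ] ℝ)).flip ((J q.2.1 : F) + q.2.2)))
    (adMap E q.1⁻¹ z)
  have t9 := tderiv_clm (Q.isoE (adMap E q.1⁻¹ z)) ((J q.2.1 : F) + q.2.2)
  refine (t7.symm.trans t4).trans ?_
  rw [bigForm_apply, ← hx]
  simp only [leftTInv_leftT]
  have h1 : formAt ωP q.2.1 ![(0 : EP), u.2.1] = 0 := by
    have h := form_add_left (formAt ωP q.2.1) 0 0 u.2.1
    rw [add_zero] at h
    linarith
  have h2 : S.tJ J q.2.1 (0 : EP) + ((0 : S.perp) : F) = 0 := by simp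
  have h3 := congrArg (fun T : E →L[ℝ] ℝ => T (-brk G x (adMap E q.1⁻¹ z))) t8
  have h4 := congrArg (fun T : F →L[ℝ] ℝ => T (S.tJ J q.2.1 u.2.1 + u.2.2)) t9
  rw [h1, h2, map_zero, sub_zero, zero_add, brk_swap _ x]
  exact (congrArg₂ (· + ·) h3 h4).trans (add_comm _ _)

end Momentum

variable [ChartedSpace (S.Model EP) (S.InducedSpace P)]
  [IsManifold 𝓘(ℝ, S.Model EP) ∞ (S.InducedSpace P)]
  (hM : ∀ m : S.InducedSpace P, chartAt (S.Model EP) m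
      = (S.inducedAtlas hι sl m).baseChart (S.isOpenQuotientMap_proj₀ (EP := EP) hι))

include hM

/-- The group acts smoothly on the induced space. -/
theorem contMDiffSMul_inducedSpace :
    ContMDiffSMul 𝓘(ℝ, E) 𝓘(ℝ, S.Model EP) ∞ G (S.InducedSpace P) where
  contMDiff_smul := by
    refine PrincipalChart.contMDiff_uncurry_of_comp_proj
      (π := fun q : G × P × S.perp => S.proj₀ q) (c := S.inducedAtlas (EP := EP) hι sl) hM
      (f := fun q : G × S.InducedSpace P => q.1 • q.2) ?_
    exact (PrincipalChart.contMDiff_proj hM).comp S.contMDiff_leftTranslation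

theorem tderiv_smul_tProj (g' : G) (q : G × P × S.perp) (u : E × EP × S.perp) :
    tderiv 𝓘(ℝ, S.Model EP) 𝓘(ℝ, S.Model EP) (fun m : S.InducedSpace P => g' • m) (S.proj₀ q)
        (S.tProj EP q u)
      = S.tProj EP (g' * q.1, q.2) (tderiv (S.totalModel EP) (S.totalModel EP)
          (fun q : G × P × S.perp => (g' * q.1, q.2)) q u) := by
  have := S.contMDiffSMul_inducedSpace hι hM
  have h1 : MDifferentiableAt 𝓘(ℝ, S.Model EP) 𝓘(ℝ, S.Model EP)
      (fun m : S.InducedSpace P => g' • m) (S.proj₀ q) :=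
    ((((contMDiff_smul (I := 𝓘(ℝ, E)) (I' := 𝓘(ℝ, S.Model EP)) (n := ∞) (G := G)
      (M := S.InducedSpace P)).comp (contMDiff_const.prodMk contMDiff_id) :
      ContMDiff 𝓘(ℝ, S.Model EP) 𝓘(ℝ, S.Model EP) ∞ (fun m : S.InducedSpace P => g' • m)))
      (S.proj₀ q)).mdifferentiableAt (by simp)
  have h2 : MDifferentiableAt (S.totalModel EP) (S.totalModel EP)
      (fun q : G × P × S.perp => (g' * q.1, q.2)) q :=
    ((S.contMDiff_leftTranslation (EP := EP)).comp
      (contMDiff_const.prodMk contMDiff_id) q).mdifferentiableAt (by simp)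
  have e1 := tderiv_comp_apply (g := fun m : S.InducedSpace P => g' • m)
    (f := fun q : G × P × S.perp => S.proj₀ q) h1 (S.mdiffAt_proj₀ hι hM q) u
  have e2 := tderiv_comp_apply (g := fun q : G × P × S.perp => S.proj₀ q)
    (f := fun q : G × P × S.perp => (g' * q.1, q.2)) (x := q) (S.mdiffAt_proj₀ hι hM _) h2 u
  exact e1.symm.trans e2

/-- The generator lifts to the right-invariant field of `z` on the factor `G`, rewritten in the left
trivialization. -/
theorem gen_inducedSpace (q : G × P × S.perp) (z : E) :
    tderiv 𝓘(ℝ, E) 𝓘(ℝ, S.Model EP) (fun g' : G => g' • (S.proj₀ q : S.InducedSpace P)) 1 z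
      = S.tProj EP q (leftT E q.1 (adMap E q.1⁻¹ z), 0, 0) := by
  obtain ⟨g, p, ρ⟩ := q
  have h2 : MDifferentiableAt 𝓘(ℝ, E) (S.totalModel EP)
      (fun a : G => (a * g, p, ρ)) 1 :=
    (ContMDiff.prodMk (f := fun a : G => a * g) (g := fun _ : G => (p, ρ))
      (contMDiff_mul_right (I := 𝓘(ℝ, E)) (n := ∞) (a := g)) contMDiff_const
      1).mdifferentiableAt (by simp)
  have e2 := tderiv_comp_apply (g := fun q : G × P × S.perp => S.proj₀ q)
    (f := fun a : G => (a * g, p, ρ)) (x := (1 : G)) (S.mdiffAt_proj₀ hι hM _) h2 z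
  rw [S.tderiv_rightTranslation] at e2
  simp only [one_mul] at e2
  exact e2

variable {ωP : TwoForm EP P} {J : P → S.sub}
  (hJ : IsHamiltonianAction ωP S.pairSub S.coAdSub J)

include hJ

theorem inducedForm_smul (g' : G) (m : S.InducedSpace P) (v w : S.Model EP) :
    formAt (S.inducedForm sl ωP J) (g' • m)
      ![tderiv 𝓘(ℝ, S.Model EP) 𝓘(ℝ, S.Model EP) (fun m : S.InducedSpace P => g' • m) m v,
        tderiv 𝓘(ℝ, S.Model EP) 𝓘(ℝ, S.Model EP) (fun m : S.InducedSpace P => g' • m) m w]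
      = formAt (S.inducedForm sl ωP J) m ![v, w] := by
  obtain ⟨q, rfl⟩ := (S.isOpenQuotientMap_proj₀ (EP := EP) hι).surjective m
  obtain ⟨u, rfl⟩ := S.tProj_surjective hι hM q v
  obtain ⟨u', rfl⟩ := S.tProj_surjective hι hM q w
  rw [S.tderiv_smul_tProj hι hM, S.tderiv_smul_tProj hι hM, S.smul_proj₀,
    S.inducedForm_tProj hι hM hJ, S.inducedForm_tProj hι hM hJ, S.bigForm_leftTranslation]

theorem contMDiff_inducedMomentum :
    ContMDiff 𝓘(ℝ, S.Model EP) 𝓘(ℝ, F) ∞ (S.inducedMomentum J hJ.equivariant) :=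
  PrincipalChart.contMDiff_of_comp_proj (π := fun q : G × P × S.perp => S.proj₀ q)
    (c := S.inducedAtlas (EP := EP) hι sl) hM (S.contMDiff_totalMomentum hJ.smooth)

theorem tderiv_inducedMomentum_tProj (q : G × P × S.perp) (u : E × EP × S.perp) :
    tderiv 𝓘(ℝ, S.Model EP) 𝓘(ℝ, F) (S.inducedMomentum J hJ.equivariant) (S.proj₀ q)
        (S.tProj EP q u)
      = tderiv (S.totalModel EP) 𝓘(ℝ, F) (S.totalMomentum J) q u :=
  (tderiv_comp_apply (g := S.inducedMomentum J hJ.equivariant)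
    (f := fun q : G × P × S.perp => S.proj₀ q)
    ((S.contMDiff_inducedMomentum hι hM hJ _).mdifferentiableAt (by simp))
    (S.mdiffAt_proj₀ hι hM q) u).symm

/-- The components of the momentum map generate the action. -/
theorem isoE_tderiv_inducedMomentum (m : S.InducedSpace P) (z : E) (v : S.Model EP) :
    Q.isoE z (tderiv 𝓘(ℝ, S.Model EP) 𝓘(ℝ, F) (S.inducedMomentum J hJ.equivariant) m v)
      = formAt (S.inducedForm sl ωP J) m
        ![tderiv 𝓘(ℝ, E) 𝓘(ℝ, S.Model EP) (fun g' : G => g' • m) 1 z, v] := by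
  obtain ⟨q, rfl⟩ := (S.isOpenQuotientMap_proj₀ (EP := EP) hι).surjective m
  obtain ⟨u, rfl⟩ := S.tProj_surjective hι hM q v
  rw [S.tderiv_inducedMomentum_tProj hι hM hJ, S.gen_inducedSpace hι hM,
    S.inducedForm_tProj hι hM hJ, S.isoE_tderiv_totalMomentum hJ.smooth ωP]

/-- The infinitesimal generators satisfy `Ω(ξ, η) = ⟨J, [ξ, η]⟩`. -/
theorem inducedForm_generators (m : S.InducedSpace P) (x y : E) :
    formAt (S.inducedForm sl ωP J) m
        ![tderiv 𝓘(ℝ, E) 𝓘(ℝ, S.Model EP) (fun g' : G => g' • m) 1 x,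
          tderiv 𝓘(ℝ, E) 𝓘(ℝ, S.Model EP) (fun g' : G => g' • m) 1 y]
      = Q.isoE (brk G x y) (S.inducedMomentum J hJ.equivariant m) := by
  obtain ⟨q, rfl⟩ := (S.isOpenQuotientMap_proj₀ (EP := EP) hι).surjective m
  rw [S.gen_inducedSpace hι hM, S.gen_inducedSpace hι hM, S.inducedForm_tProj hι hM hJ,
    bigForm_apply]
  simp only [leftTInv_leftT]
  have h1 : formAt ωP q.2.1 ![(0 : EP), 0] = 0 := by
    have h := form_add_left (formAt ωP q.2.1) 0 0 0
    rw [add_zero] at h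
    linarith
  have h2 : S.tJ J q.2.1 (0 : EP) + ((0 : S.perp) : F) = 0 := by simp
  rw [h1, h2, map_zero, map_zero, add_zero, sub_zero, zero_add, ← adMap_brk, ← Q.isoE_coAd]
  rfl

end InvariantSplitting

theorem eq_of_forall_form_eq {X : Type*} [NormedAddCommGroup X] [NormedSpace ℝ X]
    {f : X [⋀^Fin 2]→L[ℝ] ℝ} (hf : ∀ v, (∀ w, f ![v, w] = 0) → v = 0) {x y : X}
    (h : ∀ v, f ![x, v] = f ![y, v]) : x = y := by
  refine sub_eq_zero.1 (hf _ fun v => ?_)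
  have h3 := form_add_left f (x - y) y v
  rw [sub_add_cancel, h v] at h3
  linarith

/-- The equivalence `E × Y ≃ (K × Y) × Z` that is given by `E ≃ K × Z`. -/
def prodRotate {E K Z Y : Type*} [NormedAddCommGroup E] [NormedSpace ℝ E] [NormedAddCommGroup K]
    [NormedSpace ℝ K] [NormedAddCommGroup Z] [NormedSpace ℝ Z] [NormedAddCommGroup Y]
    [NormedSpace ℝ Y] (e : E ≃L[ℝ] K × Z) : (E × Y) ≃L[ℝ] (K × Y) × Z :=
  ContinuousLinearEquiv.equivOfInverse
    (((ContinuousLinearMap.fst ℝ K Z).comp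
        ((e : E →L[ℝ] K × Z).comp (ContinuousLinearMap.fst ℝ E Y))).prod
        (ContinuousLinearMap.snd ℝ E Y) |>.prod
      ((ContinuousLinearMap.snd ℝ K Z).comp
        ((e : E →L[ℝ] K × Z).comp (ContinuousLinearMap.fst ℝ E Y))))
    (((e.symm : K × Z →L[ℝ] E).comp
        (((ContinuousLinearMap.fst ℝ K Y).comp (ContinuousLinearMap.fst ℝ (K × Y) Z)).prod
          (ContinuousLinearMap.snd ℝ (K × Y) Z))).prod
      ((ContinuousLinearMap.snd ℝ K Y).comp (ContinuousLinearMap.fst ℝ (K × Y) Z)))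
    (fun x => by ext <;> simp) (fun x => by ext <;> simp)

theorem mem_homogeneousChart {E : Type*} [NormedAddCommGroup E] [NormedSpace ℝ E]
    {G : Type*} [TopologicalSpace G] [ChartedSpace E G] [Group G] [LieGroup 𝓘(ℝ, E) ∞ G]
    {H : Subgroup G} {EH : Type*} [NormedAddCommGroup EH] [NormedSpace ℝ EH] [ChartedSpace EH H]
    [LieGroup 𝓘(ℝ, EH) ∞ H] {K : Type*} [NormedAddCommGroup K] [NormedSpace ℝ K]
    (hι : ContMDiff 𝓘(ℝ, EH) 𝓘(ℝ, E) ∞ (fun h : H => (h : G)))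
    (sl : Slice E H EH K) (b : G ⧸ H) : b ∈ (homogeneousChart hι sl b.out).W :=
  ⟨b.out, sl.self_mem_nhd _, QuotientGroup.out_eq' b⟩

/-! ### The Hamiltonian action of `G` and the momentum map property. -/

namespace InvariantSplitting

set_option linter.unusedSectionVars false

variable {E : Type*} [NormedAddCommGroup E] [NormedSpace ℝ E]
  {G : Type*} [TopologicalSpace G] [ChartedSpace E G] [Group G]
  {F : Type*} [NormedAddCommGroup F] [NormedSpace ℝ F] [CompleteSpace F]
  {Q : InvariantPredual E G F} {H : Subgroup G}
  {EH : Type*} [NormedAddCommGroup EH] [NormedSpace ℝ EH] [ChartedSpace EH H]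
  (S : InvariantSplitting Q H EH)
  {EP : Type*} [NormedAddCommGroup EP] [NormedSpace ℝ EP]
  {P : Type*} [TopologicalSpace P] [ChartedSpace EP P] [MulAction H P]
  [IsManifold 𝓘(ℝ, EP) ∞ P]
  [LieGroup 𝓘(ℝ, E) ∞ G] [LieGroup 𝓘(ℝ, EH) ∞ H]
  (hι : ContMDiff 𝓘(ℝ, EH) 𝓘(ℝ, E) ∞ (fun h : H => (h : G)))
  [ContMDiffSMul 𝓘(ℝ, EH) 𝓘(ℝ, EP) ∞ H P] {sl : Slice E H EH (S.perp →L[ℝ] ℝ)}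

  [ChartedSpace (S.Model EP) (S.InducedSpace P)]
  [IsManifold 𝓘(ℝ, S.Model EP) ∞ (S.InducedSpace P)]
  (hM : ∀ m : S.InducedSpace P, chartAt (S.Model EP) m
      = (S.inducedAtlas hι sl m).baseChart (S.isOpenQuotientMap_proj₀ (EP := EP) hι))
  {ωP : TwoForm EP P} {J : P → S.sub}
  (hJ : IsHamiltonianAction ωP S.pairSub S.coAdSub J)

include hM

theorem inducedMomentum_smul (g : G) (m : S.InducedSpace P) :
    S.inducedMomentum J hJ.equivariant (g • m)
      = Q.coAd g⁻¹ (S.inducedMomentum J hJ.equivariant m) := by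
  obtain ⟨q, rfl⟩ := (S.isOpenQuotientMap_proj₀ (EP := EP) hι).surjective m
  show Q.coAd (g * q.1)⁻¹ _ = Q.coAd g⁻¹ (Q.coAd q.1⁻¹ _)
  rw [← Q.coAd_mul, mul_inv_rev]

/-- The group acts on the induced space in a Hamiltonian way. -/
theorem isHamiltonianAction_inducedSpace :
    IsHamiltonianAction (S.inducedForm sl ωP J) Q.pair Q.coAd
      (S.inducedMomentum J hJ.equivariant) where
  smooth_action := S.contMDiffSMul_inducedSpace hι hM
  symplectic g m v w := S.inducedForm_smul hι hM hJ g m v w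
  smooth := S.contMDiff_inducedMomentum hι hM hJ
  equivariant := S.inducedMomentum_smul hι hM hJ
  hamiltonian z := by
    have := S.contMDiffSMul_inducedSpace hι hM
    have hs := S.contMDiff_inducedMomentum hι hM hJ
    refine ⟨?_, (contMDiff_generator z).contMDiffOn, fun m _ v => ?_⟩
    · exact ((Q.isoE z).contMDiff.comp hs).contMDiffOn
    · have h1 := tderiv_clm_comp (I := 𝓘(ℝ, S.Model EP)) (Q.isoE z)
        ((hs m).mdifferentiableAt (by simp))
      exact (congrArg (fun T : S.Model EP →L[ℝ] ℝ => T v) h1).trans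
        (S.isoE_tderiv_inducedMomentum hι hM hJ m z v)

/-- A Hamiltonian vector field of a function of the momentum map is a generator of the action. -/
theorem eq_generator_of_isHamiltonianVectorField (hω : IsWeakSymplectic ωP) {U : Set F}
    {φ : F → ℝ} (hU : IsOpen U) (hφ : ContDiffOn ℝ ∞ φ U) {W : Set (S.InducedSpace P)}
    {X : ∀ m : S.InducedSpace P, TangentSpace 𝓘(ℝ, S.Model EP) m}
    (hWU : Set.MapsTo (S.inducedMomentum J hJ.equivariant) W U)
    (hX : IsHamiltonianVectorField (S.inducedForm sl ωP J) W
      (φ ∘ S.inducedMomentum J hJ.equivariant) X) {m : S.InducedSpace P} (hm : m ∈ W) :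
    X m = tderiv 𝓘(ℝ, E) 𝓘(ℝ, S.Model EP) (fun g' : G => g' • m) 1
      (Q.isoE.symm (fderiv ℝ φ (S.inducedMomentum J hJ.equivariant m))) := by
  have hs := S.contMDiff_inducedMomentum hι hM hJ
  have hd : MDifferentiableAt 𝓘(ℝ, F) 𝓘(ℝ, ℝ) φ (S.inducedMomentum J hJ.equivariant m) :=
    ((hφ.contDiffAt (hU.mem_nhds (hWU hm))).differentiableAt (by simp)).mdifferentiableAt
  -- The functional `dφ` at the single point `J m` is the pairing with a Lie algebra element, whose
  -- generator has the same contraction with the reduced form as `X m`.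
  have key : ∀ v : S.Model EP, formAt (S.inducedForm sl ωP J) m ![(X m : S.Model EP), v]
      = formAt (S.inducedForm sl ωP J) m
        ![tderiv 𝓘(ℝ, E) 𝓘(ℝ, S.Model EP) (fun g' : G => g' • m) 1
          (Q.isoE.symm (fderiv ℝ φ (S.inducedMomentum J hJ.equivariant m))), v] := by
    intro v
    have h1 := hX.eq m hm v
    have h2 := tderiv_comp_apply (g := φ) hd ((hs m).mdifferentiableAt (by simp)) v
    rw [← S.isoE_tderiv_inducedMomentum hι hM hJ, ContinuousLinearEquiv.apply_symm_apply]
    rw [tderiv_eq_fderiv] at h2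
    exact h1.symm.trans h2
  exact eq_of_forall_form_eq (S.inducedForm_nondegenerate hι hM hJ hω m) key

/-- The induced map is a momentum map for the Lie-Poisson structure. -/
theorem isMomentumMap_inducedMomentum (hω : IsWeakSymplectic ωP) :
    Q.IsMomentumMap (S.inducedForm sl ωP J) (S.inducedMomentum J hJ.equivariant) where
  smooth := S.contMDiff_inducedMomentum hι hM hJ
  poisson U φ ψ hU hφ hψ W X Y hW hWU hX hY m hm := by
    have h := S.inducedForm_generators hι hM hJ m
      (Q.isoE.symm (fderiv ℝ φ (S.inducedMomentum J hJ.equivariant m)))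
      (Q.isoE.symm (fderiv ℝ ψ (S.inducedMomentum J hJ.equivariant m)))
    rw [← S.eq_generator_of_isHamiltonianVectorField hι hM hJ hω hU hφ hWU hX hm,
      ← S.eq_generator_of_isHamiltonianVectorField hι hM hJ hω hU hψ hWU hY hm] at h
    exact h

/-- The model space of `G × P × 𝔥_*^⊥` is the product of the model space of the induced space and
of `𝔥`. -/
abbrev totalSplitEquiv (EP : Type*) [NormedAddCommGroup EP] [NormedSpace ℝ EP] [CompleteSpace E]
    [CompleteSpace EH] (hinj : Function.Injective S.embE) :=
  prodRotate (E := E) (K := S.perp →L[ℝ] ℝ) (Z := EH) (Y := EP × S.perp) (S.splitEquiv hinj).symm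

end InvariantSplitting

namespace InvariantSplitting

set_option linter.unusedSectionVars false

variable {E : Type*} [NormedAddCommGroup E] [NormedSpace ℝ E]
  {G : Type*} [TopologicalSpace G] [ChartedSpace E G] [Group G]
  {F : Type*} [NormedAddCommGroup F] [NormedSpace ℝ F] [CompleteSpace F]
  {Q : InvariantPredual E G F} {H : Subgroup G}
  {EH : Type*} [NormedAddCommGroup EH] [NormedSpace ℝ EH] [ChartedSpace EH H]
  (S : InvariantSplitting Q H EH)
  [LieGroup 𝓘(ℝ, E) ∞ G] [LieGroup 𝓘(ℝ, EH) ∞ H]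

theorem nonempty_slice [CompleteSpace E] [CompleteSpace EH]
    (hι : ContMDiff 𝓘(ℝ, EH) 𝓘(ℝ, E) ∞ (fun h : H => (h : G)))
    (hinj : Function.Injective S.embE) : Nonempty (Slice E H EH (S.perp →L[ℝ] ℝ)) :=
  SymplecticInduction.nonempty_slice (E := E) (EH := EH) (K := S.perp →L[ℝ] ℝ) hι S.perpE
    (S.splitEquiv hinj) (S.splitEquiv_apply hinj)

end InvariantSplitting

end SymplecticInduction

end

/-! ### The induction theorem. -/

open SymplecticInduction in
theorem proposition3p4
    -- the Banach Lie group `G`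
    {EG : Type*} [NormedAddCommGroup EG] [NormedSpace ℝ EG] [CompleteSpace EG]
    {G : Type*} [TopologicalSpace G] [ChartedSpace EG G] [Group G] [LieGroup 𝓘(ℝ, EG) ∞ G]
    -- the closed Banach Lie subgroup `H` (a split submanifold of `G`)
    (H : Subgroup G) (hHclosed : IsClosed (H : Set G))
    {EH : Type*} [NormedAddCommGroup EH] [NormedSpace ℝ EH] [CompleteSpace EH]
    [ChartedSpace EH H] [LieGroup 𝓘(ℝ, EH) ∞ H]
    (hH : Manifold.IsSmoothEmbedding 𝓘(ℝ, EH) 𝓘(ℝ, EG) ∞ (fun h : H => (h : G)))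
    -- the predual of the Lie algebra of `G` and its splitting
    {F : Type*} [NormedAddCommGroup F] [NormedSpace ℝ F] [CompleteSpace F]
    (Q : InvariantPredual EG G F) (S : InvariantSplitting Q H EH)
    -- the Hamiltonian `H`-space `(P, ω)` with momentum map `J`
    {EP : Type*} [NormedAddCommGroup EP] [NormedSpace ℝ EP] [CompleteSpace EP]
    {P : Type*} [TopologicalSpace P] [ChartedSpace EP P] [IsManifold 𝓘(ℝ, EP) ∞ P]
    [MulAction H P]
    (ωP : TwoForm EP P) (hωP : IsWeakSymplectic ωP) (J : P → S.sub)
    (hJ : IsHamiltonianAction ωP S.pairSub S.coAdSub J) :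
    -- the infinitesimal coadjoint action is defined on the predual
    (∀ (x : LieAlg EG G) (ρ : F) (y : LieAlg EG G),
      Q.pair (Q.coad x ρ) y = Q.pair ρ ⁅x, y⁆) ∧
    -- smooth structures on `G ⧸ H` and on the induced space
    ∃ (_ : ChartedSpace (S.perp →L[ℝ] ℝ) (G ⧸ H))
      (_ : IsManifold 𝓘(ℝ, S.perp →L[ℝ] ℝ) ∞ (G ⧸ H))
      (_ : ChartedSpace (S.Model EP) (S.InducedSpace P))
      (_ : IsManifold 𝓘(ℝ, S.Model EP) ∞ (S.InducedSpace P)),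
      Manifold.IsSubmersion 𝓘(ℝ, EG) 𝓘(ℝ, S.perp →L[ℝ] ℝ) ∞ (fun g : G => (g : G ⧸ H)) ∧
      Manifold.IsSubmersion (𝓘(ℝ, EG).prod (𝓘(ℝ, EP).prod 𝓘(ℝ, S.perp))) 𝓘(ℝ, S.Model EP) ∞
        (fun q : G × P × S.perp => S.proj₀ q) ∧
      (T2Space P → T2Space (S.InducedSpace P)) ∧
      -- the induced space is a smooth bundle over `G ⧸ H`, associated to `G → G ⧸ H`
      (∀ b : G ⧸ H, ∃ (s : G ⧸ H → G)
        (t : Bundle.Trivialization (P × S.perp) (S.toBase : S.InducedSpace P → G ⧸ H)),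
        b ∈ t.baseSet ∧
        ContMDiffOn 𝓘(ℝ, S.perp →L[ℝ] ℝ) 𝓘(ℝ, EG) ∞ s t.baseSet ∧
        (∀ u ∈ t.baseSet, (s u : G ⧸ H) = u) ∧
        (∀ u ∈ t.baseSet, ∀ f : P × S.perp,
          t.toOpenPartialHomeomorph.symm (u, f) = S.proj₀ (s u, f)) ∧
        ContMDiffOn 𝓘(ℝ, S.Model EP)
          (𝓘(ℝ, S.perp →L[ℝ] ℝ).prod (𝓘(ℝ, EP).prod 𝓘(ℝ, S.perp))) ∞ t t.source ∧
        ContMDiffOn (𝓘(ℝ, S.perp →L[ℝ] ℝ).prod (𝓘(ℝ, EP).prod 𝓘(ℝ, S.perp)))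
          𝓘(ℝ, S.Model EP) ∞ t.toOpenPartialHomeomorph.symm t.target) ∧
      -- the induced space is the reduced space
      (∃ Θ : S.InducedSpace P ≃ₜ S.ReducedSpace J, ∀ (g : G) (p : P) (ρ : S.perp),
        ∃ hq : (p, g, (J p : F) + (ρ : F)) ∈ S.zeroLevel J,
          Θ (S.proj₀ (g, p, ρ)) = Quotient.mk (S.reducedSetoid J) ⟨_, hq⟩) ∧
      -- the weak symplectic form
      ∃ Ω : TwoForm (S.Model EP) (S.InducedSpace P),
        IsWeakSymplectic Ω ∧
        -- `Ω` is the reduced form of `ω ⊕ ω_L`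
        (∀ (g : G) (p : P) (ρ μ ν : S.perp) (x y : LieAlg EG G)
          (a b : TangentSpace 𝓘(ℝ, EP) p),
          Ω (S.proj₀ (g, p, ρ)) ![S.tangentProj g p ρ x a μ, S.tangentProj g p ρ y b ν] =
            S.sumForm ωP p (J p + ρ)
              a x (S.tangentMap J p a + μ) b y (S.tangentMap J p b + ν)) ∧
        -- the two explicit formulas for `Ω`
        (∀ (g : G) (p : P) (ρ μ ν : S.perp) (x y : LieAlg EH H) (x' y' : LieAlg EG G)
          (a b : TangentSpace 𝓘(ℝ, EP) p), S.MemPerp x' → S.MemPerp y' →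
          Ω (S.proj₀ (g, p, ρ))
              ![S.tangentProj g p ρ (S.emb x + x') a μ,
                S.tangentProj g p ρ (S.emb y + y') b ν] =
            ωP p ![a, b]
              + Q.pair (S.tangentMap J p b) (S.emb x) + Q.pair ν x'
              - Q.pair (S.tangentMap J p a) (S.emb y) - Q.pair μ y'
              + Q.pair (J p) ⁅S.emb x, S.emb y⁆
              + Q.pair ρ (⁅x', S.emb y⁆ + ⁅S.emb x, y'⁆)
              + Q.pair (J p + ρ) ⁅x', y'⁆ ∧
          Ω (S.proj₀ (g, p, ρ))
              ![S.tangentProj g p ρ (S.emb x + x') a μ,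
                S.tangentProj g p ρ (S.emb y + y') b ν] =
            ωP p ![a - generator x p, b - generator y p]
              + Q.pair (S.tangentMap J p (b - generator y p)) ((2 : ℝ) • S.emb x)
              + Q.pair (ν + Q.coad (S.emb y) ρ) x'
              - Q.pair (S.tangentMap J p (a - generator x p)) ((2 : ℝ) • S.emb y)
              - Q.pair (μ + Q.coad (S.emb x) ρ) y'
              + Q.pair (J p) ⁅(2 : ℝ) • S.emb x, (2 : ℝ) • S.emb y⁆
              + Q.pair ρ (⁅x', (2 : ℝ) • S.emb y⁆ + ⁅(2 : ℝ) • S.emb x, y'⁆)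
              + Q.pair (J p + ρ) ⁅x', y'⁆) ∧
        -- the tangent vectors in the second formula are transversal to the `H`-orbits
        (∀ (g : G) (p : P) (ρ : S.perp)
          (u : TangentSpace (𝓘(ℝ, EG).prod (𝓘(ℝ, EP).prod 𝓘(ℝ, S.perp))) (g, p, ρ)),
          ∃ (z x : LieAlg EH H) (x' : LieAlg EG G) (a : TangentSpace 𝓘(ℝ, EP) p)
            (μ μ' : S.perp), S.MemPerp x' ∧ (μ' : F) = μ + Q.coad (S.emb x) ρ ∧
            u = S.orbitTangent g p ρ z
              + S.tangentVector g p ρ ((2 : ℝ) • S.emb x + x') (a - generator x p) μ') ∧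
        -- and represent the tangent space of the induced space
        (∀ (g : G) (p : P) (ρ : S.perp)
          (v : TangentSpace 𝓘(ℝ, S.Model EP) (S.proj₀ (g, p, ρ) : S.InducedSpace P)),
          ∃ (x : LieAlg EH H) (x' : LieAlg EG G) (a : TangentSpace 𝓘(ℝ, EP) p)
            (μ μ' : S.perp), S.MemPerp x' ∧ (μ' : F) = μ + Q.coad (S.emb x) ρ ∧
            v = S.tangentProj g p ρ ((2 : ℝ) • S.emb x + x') (a - generator x p) μ') ∧
        -- the map `[g, p, ρ] ↦ Ad*_{g⁻¹} (J(p) + ρ)` is a `G`-equivariant momentum map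
        IsHamiltonianAction Ω Q.pair Q.coAd (S.inducedMomentum J hJ.equivariant) ∧
        Q.IsMomentumMap Ω (S.inducedMomentum J hJ.equivariant) := by
  have hι : ContMDiff 𝓘(ℝ, EH) 𝓘(ℝ, EG) ∞ (fun h : H => (h : G)) := hH.isImmersion.contMDiff
  have hinj : Function.Injective S.embE :=
    tderiv_injective_of_isImmersionAt (hH.isImmersion.isImmersionAt 1)
  have hsm := hJ.smooth_action
  obtain ⟨sl⟩ := S.nonempty_slice hι hinj
  let _ : ChartedSpace (S.perp →L[ℝ] ℝ) (G ⧸ H) :=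
    PrincipalChart.chartedSpace (isOpenQuotientMap_mk EG H)
      (fun b : G ⧸ H => homogeneousChart hι sl b.out) (mem_homogeneousChart hι sl)
  -- By construction, the preferred charts are those of the local trivializations.
  have hB : ∀ b : G ⧸ H, chartAt (S.perp →L[ℝ] ℝ) b
      = (homogeneousChart hι sl b.out).baseChart (isOpenQuotientMap_mk EG H) := fun _ => rfl
  let _ : IsManifold 𝓘(ℝ, S.perp →L[ℝ] ℝ) ∞ (G ⧸ H) :=
    PrincipalChart.isManifold (isOpenQuotientMap_mk EG H)
      (fun b : G ⧸ H => homogeneousChart hι sl b.out) (mem_homogeneousChart hι sl)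
  let _ : ChartedSpace (S.Model EP) (S.InducedSpace P) :=
    PrincipalChart.chartedSpace (π := fun q : G × P × S.perp => S.proj₀ q)
      (S.isOpenQuotientMap_proj₀ (EP := EP) hι) (S.inducedAtlas hι sl) (S.mem_inducedAtlas hι sl)
  have hM : ∀ m : S.InducedSpace P, chartAt (S.Model EP) m
      = (S.inducedAtlas hι sl m).baseChart (S.isOpenQuotientMap_proj₀ (EP := EP) hι) :=
    fun _ => rfl
  let _ : IsManifold 𝓘(ℝ, S.Model EP) ∞ (S.InducedSpace P) :=
    PrincipalChart.isManifold (π := fun q : G × P × S.perp => S.proj₀ q)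
      (S.isOpenQuotientMap_proj₀ (EP := EP) hι) (S.inducedAtlas hι sl) (S.mem_inducedAtlas hι sl)
  refine ⟨Q.pair_coad, inferInstance, inferInstance, inferInstance, inferInstance,
    PrincipalChart.isSubmersion (c := fun b : G ⧸ H => homogeneousChart hι sl b.out) hB
      (S.splitEquiv hinj).symm,
    PrincipalChart.isSubmersion (π := fun q : G × P × S.perp => S.proj₀ q)
      (c := S.inducedAtlas (EP := EP) hι sl) hM (S.totalSplitEquiv EP hinj),
    fun _ => S.t2Space_inducedSpace (EP := EP) hι hHclosed, S.exists_trivialization hι sl hB hM,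
    S.exists_homeomorph_reducedSpace J hJ.smooth.continuous hJ.equivariant,
    S.inducedForm sl ωP J, S.isWeakSymplectic_inducedForm sl hι hM hJ hωP,
    fun g p ρ μ ν x y a b => ?_, fun g p ρ μ ν x y x' y' a b hx hy => ⟨?_, ?_⟩,
    fun g p ρ u => ?_, fun g p ρ v => ?_, S.isHamiltonianAction_inducedSpace hι hM hJ,
    S.isMomentumMap_inducedMomentum hι hM hJ hωP⟩
  · exact (S.inducedForm_tProj hι hM hJ (g, p, ρ) _ _).trans
      (S.bigForm_eq_sumForm (EP := EP) ωP J g p ρ x y a b μ ν)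
  · exact (S.inducedForm_tProj hι hM hJ (g, p, ρ) _ _).trans
      (S.bigForm_split (EP := EP) hι g p ρ μ ν x y a b hx hy)
  · exact (S.inducedForm_tProj hι hM hJ (g, p, ρ) _ _).trans
      (S.bigForm_split_transversal (EP := EP) hι hJ g p ρ μ ν x y a b hx hy)
  · obtain ⟨x, x', a, μ, μ', hx', hμ, hu⟩ := S.exists_transversal_eq hι g p ρ u
    -- The shifted vectors already exhaust the tangent space, so no orbit vector has to be added.
    refine ⟨0, x, x', a, μ, μ', hx', ?_, ?_⟩
    · exact hμ
    · have h0 : S.orbitTangent (EP := EP) g p ρ (0 : LieAlg EH H) = 0 := map_zero _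
      rw [h0, zero_add]
      exact hu
  · obtain ⟨u, hu⟩ := S.tProj_surjective hι hM (g, p, ρ) v
    obtain ⟨x, x', a, μ, μ', hx', hμ, hu'⟩ := S.exists_transversal_eq hι g p ρ u
    refine ⟨x, x', a, μ, μ', hx', ?_, ?_⟩
    · exact hμ
    · rw [← hu, hu']
      rfl
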